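/- Let $R$ be a commutative ring. Terminology. A category $\mathbb C$ with finite limits is *locally algebraically cartesian closed* (LACC) if for every morphism $q\colon E\to B$ the change-of-base functor $q^*\colon \mathsf{Pt}_B(\mathbb C)\to\mathsf{Pt}_E(\mathbb C)$ given by pullback along $q$ has a right adjoint. Here $\mathsf{Pt}_B(\mathbb C)$ has as objects the triples $(A,\ p\colon A\to B,\ s\colon B\to A)$ with $p s=1_B$, and as morphisms the maps $A\to A'$ commuting with $p,p'$ and with $s,s'$. A *Lie algebra* in an additive symmetric monoidal category with associativity $\alpha$ and symmetry $\sigma$ is a pair $(X,b)$ with $b\colon X\otimes X\to X$, $b(1+\sigma)=0$ and $b(1\otimes b)(1+\sigma\alpha+(\sigma\alpha)^2)=0$, where $\alpha\colon X\otimes (X\otimes X)\to (X\otimes X)\otimes X$ and $\sigma\colon (X\otimes X)\otimes X\to X\otimes (X\otimes X)$; morphisms preserve $b$. 1. Consider $\mathbb Z$-graded chain complexes of $R$-modules (differential of degree $-1$) with $(V\otimes W)_k=\bigoplus_{i+j=k}V_i\otimes W_j$. The differential satisfies $\delta(v\otimes w)=dv\otimes w+(-1)^{i}v\otimes dw$ for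 $v\in V_i$. With the symmetry $\sigma(v\otimes w)=(-1)^{ij}w\otimes v$ for $v\in V_i$, $w\in W_j$, chain complexes form a symmetric monoidal closed category which is cocomplete and abelian. Its category of Lie algebras is equivalent to the category of *differential graded Lie algebras*, compatibly with underlying complexes and brackets. These are chain complexes $V$ with bilinear maps $[-,-]\colon V_i\times V_j\to V_{i+j}$ such that for homogeneous $x,y,z$ $$[x,y]=-(-1)^{|x||y|}[y,x],$$ $$(-1)^{|x||z|}[x,[y,z]]+(-1)^{|y||x|}[y,[z,x]]+(-1)^{|z||y|}[z,[x,y]]=0,$$ $$d[x,y]=[dx,y]+(-1)^{|x|}[x,dy].$$ The category of differential graded Lie algebras is LACC. 2. Let $\Gamma$ be an abelian group (small relative to the universe of $R$) and let $\varepsilon\colon\Gamma\times\Gamma\to R^\times$ be bimultiplicative with $\varepsilon(a,b)\varepsilon(b,a)=1$. The $\Gamma$-graded $R$-modules, with the usual graded tensor product and the symmetry $v\otimes w\mapsto\varepsilon(i,j)\,w\otimes v$ ($v\in V_i$, $w\in W_j$), form a symmetric monoidal closed category which is cocomplete and abelian. Its category of Lie algebras is equivalent, compatibly with underlying graded modules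 and brackets, to the category of *$\varepsilon$-Lie colour algebras*. These are graded modules with a bilinear degree-preserving bracket such that for homogeneous $x,y,z$ $$[x,y]=-\varepsilon(|x|,|y|)[y,x],$$ $$\varepsilon(|z|,|x|)[x,[y,z]]+\varepsilon(|x|,|y|)[y,[z,x]]+\varepsilon(|y|,|z|)[z,[x,y]]=0.$$ The category of $\varepsilon$-Lie colour algebras is LACC. 3. The full subcategory of chain complexes with $d=0$ is closed under the tensor product and contains the unit, and it is symmetric monoidal closed, cocomplete and abelian. Its category of Lie algebras is equivalent, compatibly with underlying graded modules and brackets, to the category of Lie colour algebras with $\Gamma=\mathbb Z$, $\varepsilon(i,j)=(-1)^{ij}$; the latter category is LACC. The category of Lie superalgebras over $R$, that is, the case $\Gamma=\mathbb Z/2$, $\varepsilon(i,j)=(-1)^{ij}$ of part 2, is LACC. -/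

import Mathlib

open CategoryTheory Limits MonoidalCategory
open scoped TensorProduct

universe v u w

namespace InternalLie

/-! ### Points and local algebraic cartesian closedness -/

section Points

variable {C : Type u} [Category.{v} C]

/-- A point over `B`: a split epimorphism `p : A ⟶ B` with a chosen section `s`. -/
structure Pt (B : C) where
  A : C
  p : A ⟶ B
  s : B ⟶ A
  sp : s ≫ p = 𝟙 B

/-- A morphism of points over `B`. -/
@[ext]
structure Pt.Hom {B : C} (X Y : Pt B) where
  f : X.A ⟶ Y.A
  comp_p : f ≫ Y.p = X.p
  s_comp : X.s ≫ f = Y.s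

instance Pt.category (B : C) : Category (Pt B) where
  Hom X Y := Pt.Hom X Y
  id X := ⟨𝟙 X.A, Category.id_comp _, Category.comp_id _⟩
  comp f g := ⟨f.f ≫ g.f, by rw [Category.assoc, g.comp_p, f.comp_p],
    by rw [← Category.assoc, f.s_comp, g.s_comp]⟩
  id_comp _ := Pt.Hom.ext (Category.id_comp _)
  comp_id _ := Pt.Hom.ext (Category.comp_id _)
  assoc _ _ _ := Pt.Hom.ext (Category.assoc _ _ _)

@[ext]
theorem Pt.hom_ext {B : C} {X Y : Pt B} {f g : X ⟶ Y} (h : f.f = g.f) : f = g :=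
  Pt.Hom.ext h

@[simp]
theorem Pt.id_f {B : C} (X : Pt B) : Pt.Hom.f (𝟙 X) = 𝟙 X.A := rfl

@[simp]
theorem Pt.comp_f {B : C} {X Y Z : Pt B} (f : X ⟶ Y) (g : Y ⟶ Z) :
    Pt.Hom.f (f ≫ g) = f.f ≫ g.f := rfl

/-- The change-of-base functor `q^* : Pt B ⥤ Pt E` given by pulling back along `q : E ⟶ B`;
the section of the pulled back point is `⟨𝟙, q ≫ s⟩`. -/
noncomputable def changeOfBase [HasPullbacks C] {E B : C} (q : E ⟶ B) : Pt B ⥤ Pt E where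
  obj X :=
    { A := pullback q X.p
      p := pullback.fst q X.p
      s := pullback.lift (𝟙 E) (q ≫ X.s)
        (by rw [Category.id_comp, Category.assoc, X.sp, Category.comp_id])
      sp := pullback.lift_fst _ _ _ }
  map {X Y} f :=
    { f := pullback.lift (pullback.fst q X.p) (pullback.snd q X.p ≫ f.f)
        (pullback.condition.trans
          ((congrArg (pullback.snd q X.p ≫ ·) f.comp_p).symm.trans (Category.assoc _ _ _).symm))
      comp_p := pullback.lift_fst _ _ _
      s_comp := by
        apply pullback.hom_ext
        · rw [Category.assoc, pullback.lift_fst, pullback.lift_fst, pullback.lift_fst]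
        · rw [Category.assoc, pullback.lift_snd, ← Category.assoc, pullback.lift_snd,
            Category.assoc, f.s_comp, pullback.lift_snd] }
  map_id X := by
    apply Pt.hom_ext
    apply pullback.hom_ext <;> simp
  map_comp {X Y Z} f g := by
    apply Pt.hom_ext
    apply pullback.hom_ext
    · refine (pullback.lift_fst _ _ _).trans (Eq.symm ?_)
      exact (Category.assoc _ _ _).trans
        ((congrArg _ (pullback.lift_fst _ _ _)).trans (pullback.lift_fst _ _ _))
    · refine (pullback.lift_snd _ _ _).trans (Eq.symm ?_)
      refine (Category.assoc _ _ _).trans ((congrArg _ (pullback.lift_snd _ _ _)).trans ?_)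
      refine (Category.assoc _ _ _).symm.trans
        ((congrArg (· ≫ g.f) (pullback.lift_snd _ _ _)).trans ?_)
      exact Category.assoc _ _ _

variable (C) in
/-- A finitely complete category is locally algebraically cartesian closed if every
change-of-base functor between categories of points has a right adjoint. -/
def IsLACC : Prop :=
  ∃ _ : HasFiniteLimits C, ∀ {E B : C} (q : E ⟶ B), (changeOfBase q).IsLeftAdjoint

end Points

/-! ### Internal Lie algebras -/

section LieObj

variable (C : Type u) [Category.{v} C] [Preadditive C] [MonoidalCategory C] [BraidedCategory C]

variable {C} in
/-- The cyclic permutation `x ⊗ (y ⊗ z) ↦ z ⊗ (x ⊗ y)` (up to the symmetry of `C`). -/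
def cyc (X : C) : X ⊗ (X ⊗ X) ⟶ X ⊗ (X ⊗ X) :=
  (α_ X X X).inv ≫ (β_ (X ⊗ X) X).hom

/-- Lie algebras in a (symmetric) monoidal preadditive category. -/
structure LieObj where
  X : C
  b : X ⊗ X ⟶ X
  skew : (𝟙 (X ⊗ X) + (β_ X X).hom) ≫ b = 0
  jacobi : (𝟙 (X ⊗ (X ⊗ X)) + cyc X + cyc X ≫ cyc X) ≫ (X ◁ b) ≫ b = 0

variable {C}

/-- Morphisms of internal Lie algebras. -/
@[ext]
structure LieObj.Hom (L M : LieObj C) where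
  f : L.X ⟶ M.X
  map_b : L.b ≫ f = (f ⊗ₘ f) ≫ M.b

instance LieObj.category : Category (LieObj C) where
  Hom L M := LieObj.Hom L M
  id L := ⟨𝟙 L.X, by rw [Category.comp_id, id_tensorHom_id, Category.id_comp]⟩
  comp f g := ⟨f.f ≫ g.f, by
    rw [← Category.assoc, f.map_b, Category.assoc, g.map_b, ← Category.assoc,
      tensorHom_comp_tensorHom]⟩
  id_comp _ := LieObj.Hom.ext (Category.id_comp _)
  comp_id _ := LieObj.Hom.ext (Category.comp_id _)
  assoc _ _ _ := LieObj.Hom.ext (Category.assoc _ _ _)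

variable (C) in
/-- The forgetful functor from internal Lie algebras to the base category. -/
def LieObj.forget : LieObj C ⥤ C where
  obj L := L.X
  map f := LieObj.Hom.f f

end LieObj

/-! ### Chain complexes and differential graded Lie algebras -/

section DG

/-- The Koszul signs `(-1)^i` for `ℤ`-graded chain complexes; with these signs the differential of
the tensor product of `V` and `W` is `v ⊗ w ↦ d v ⊗ w + (-1)^i v ⊗ d w` for `v ∈ V_i`. -/
instance tensorSignsDownInt : (ComplexShape.down ℤ).TensorSigns where
  ε' := MonoidHom.mk' (fun i : Multiplicative ℤ => Int.negOnePow i.toAdd)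
    (fun a b => Int.negOnePow_add a.toAdd b.toAdd)
  rel_add p q r (hpq : q + 1 = p) := show q + r + 1 = p + r by lia
  add_rel p q r (hpq : q + 1 = p) := show r + q + 1 = r + p by lia
  ε'_succ p q (hpq : q + 1 = p) := by
    subst hpq
    change Int.negOnePow q = - Int.negOnePow (q + 1)
    rw [Int.negOnePow_succ, neg_neg]

variable (R : Type u) [CommRing R]

/-- The category of `ℤ`-graded chain complexes of `R`-modules (differential of degree `-1`), with
Mathlib's tensor product `(V ⊗ W)_k = ⨁_{i + j = k} V_i ⊗ W_j`. -/
abbrev Ch : Type (u + 1) := ChainComplex (ModuleCat.{u} R) ℤ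

variable {R}

/-- The element `v ⊗ w` of `(V ⊗ W)_k` for `v ∈ V_i`, `w ∈ W_j` and `i + j = k`. -/
noncomputable def Ch.tmul (V W : Ch R) (i j k : ℤ) (h : i + j = k) (x : V.X i) (y : W.X j) :
    (V ⊗ W : Ch R).X k :=
  (HomologicalComplex.ιTensorObj V W i j k h).hom (x ⊗ₜ[R] y)

variable (R)

/-- A differential graded Lie algebra over `R`. -/
structure DGLieAlg where
  V : Ch R
  bracket (i j k : ℤ) (h : i + j = k) : V.X i →ₗ[R] V.X j →ₗ[R] V.X k
  skew (i j k : ℤ) (h : i + j = k) (h' : j + i = k) (x : V.X i) (y : V.X j) :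
    bracket i j k h x y = -((i * j).negOnePow • bracket j i k h' y x)
  jacobi (i j l ij jl li n : ℤ) (hij : i + j = ij) (hjl : j + l = jl) (hli : l + i = li)
    (h₁ : i + jl = n) (h₂ : j + li = n) (h₃ : l + ij = n)
    (x : V.X i) (y : V.X j) (z : V.X l) :
    (i * l).negOnePow • bracket i jl n h₁ x (bracket j l jl hjl y z) +
      (j * i).negOnePow • bracket j li n h₂ y (bracket l i li hli z x) +
      (l * j).negOnePow • bracket l ij n h₃ z (bracket i j ij hij x y) = 0
  leibniz (i j k : ℤ) (h : i + j = k) (h₁ : (i - 1) + j = k - 1) (h₂ : i + (j - 1) = k - 1)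
    (x : V.X i) (y : V.X j) :
    V.d k (k - 1) (bracket i j k h x y) =
      bracket (i - 1) j (k - 1) h₁ (V.d i (i - 1) x) y +
        i.negOnePow • bracket i (j - 1) (k - 1) h₂ x (V.d j (j - 1) y)

variable {R}

/-- Morphisms of differential graded Lie algebras: chain maps preserving the bracket. -/
@[ext]
structure DGLieAlg.Hom (L M : DGLieAlg R) where
  f : L.V ⟶ M.V
  map_bracket (i j k : ℤ) (h : i + j = k) (x : L.V.X i) (y : L.V.X j) :
    f.f k (L.bracket i j k h x y) = M.bracket i j k h (f.f i x) (f.f j y)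

instance DGLieAlg.category : Category (DGLieAlg R) where
  Hom L M := DGLieAlg.Hom L M
  id L := ⟨𝟙 L.V, fun _ _ _ _ _ _ => rfl⟩
  comp f g := ⟨f.f ≫ g.f, fun i j k h x y => by
    simp only [HomologicalComplex.comp_f, ModuleCat.comp_apply, f.map_bracket, g.map_bracket]⟩
  id_comp _ := DGLieAlg.Hom.ext (Category.id_comp _)
  comp_id _ := DGLieAlg.Hom.ext (Category.comp_id _)
  assoc _ _ _ := DGLieAlg.Hom.ext (Category.assoc _ _ _)

variable (R) in
/-- The forgetful functor from differential graded Lie algebras to chain complexes. -/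
def DGLieAlg.forget : DGLieAlg R ⥤ Ch R where
  obj L := L.V
  map f := DGLieAlg.Hom.f f

variable (R) in
/-- The chain complexes with zero differential. -/
def zeroDiff : ObjectProperty (Ch R) := fun V => ∀ i j, V.d i j = 0

end DG

/-! ### Graded modules, Lie colour algebras and Lie superalgebras -/

section Colour

/-- A commutation factor (skew-symmetric bicharacter) on `Γ` with values in the units of `R`. -/
structure CommutationFactor (Γ : Type w) [AddCommGroup Γ] (R : Type u) [CommRing R] where
  ε : Γ → Γ → Rˣ
  add_left (a b c : Γ) : ε (a + b) c = ε a c * ε b c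
  add_right (a b c : Γ) : ε a (b + c) = ε a b * ε a c
  skew (a b : Γ) : ε a b * ε b a = 1

/-- The sign `(-1)^{ij}` for `i j : ℤ`. -/
def koszul (R : Type u) [CommRing R] : CommutationFactor ℤ R where
  ε i j := Units.map (Int.castRingHom R).toMonoidHom (i * j).negOnePow
  add_left a b c := by rw [add_mul, Int.negOnePow_add, map_mul]
  add_right a b c := by rw [mul_add, Int.negOnePow_add, map_mul]
  skew a b := by rw [← map_mul, mul_comm b a, Int.units_mul_self, map_one]

/-- The sign `(-1)^{ij}` for `i j : ℤ/2`. -/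
def superSign (R : Type u) [CommRing R] : CommutationFactor (ZMod 2) R where
  ε i j := Units.map (Int.castRingHom R).toMonoidHom ((-1 : ℤˣ) ^ (i.val * j.val))
  add_left a b c := by
    rw [← map_mul]
    congr 1
    revert a b c
    decide
  add_right a b c := by
    rw [← map_mul]
    congr 1
    revert a b c
    decide
  skew a b := by
    rw [← map_mul, mul_comm b.val a.val, Int.units_mul_self, map_one]

/-- Morphisms of graded objects in a preadditive category are added degreewise. -/
instance gradedPreadditive {β : Type w} {C : Type u} [Category.{v} C] [Preadditive C] :
    Preadditive (GradedObject β C) where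
  homGroup X Y := inferInstanceAs (AddCommGroup (∀ i, X i ⟶ Y i))
  add_comp _ _ _ _ _ _ := funext fun _ => Preadditive.add_comp _ _ _ _ _ _
  comp_add _ _ _ _ _ _ := funext fun _ => Preadditive.comp_add _ _ _ _ _ _

variable (Γ : Type w) [AddCommGroup Γ] (R : Type u) [CommRing R]

/-- The category of `Γ`-graded `R`-modules, with Mathlib's tensor product
`(V ⊗ W)_k = ⨁_{i + j = k} V_i ⊗ W_j`. -/
abbrev Gr : Type (max w (u + 1)) := GradedObject Γ (ModuleCat.{u} R)

variable {Γ R}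

/-- The element `v ⊗ w` of `(V ⊗ W)_k` for `v ∈ V_i`, `w ∈ W_j` and `i + j = k`. -/
noncomputable def Gr.tmul [Small.{u} Γ] [DecidableEq Γ] (V W : Gr Γ R) (i j k : Γ)
    (h : i + j = k) (x : V i) (y : W j) : (V ⊗ W : Gr Γ R) k :=
  (GradedObject.Monoidal.ιTensorObj V W i j k h).hom (x ⊗ₜ[R] y)

/-- A Lie colour algebra over `R`, graded by `Γ`, with commutation factor `c`. -/
structure LieColourAlg (c : CommutationFactor Γ R) where
  V : Gr Γ R
  bracket (i j k : Γ) (h : i + j = k) : V i →ₗ[R] V j →ₗ[R] V k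
  skew (i j k : Γ) (h : i + j = k) (h' : j + i = k) (x : V i) (y : V j) :
    bracket i j k h x y = -((c.ε i j : R) • bracket j i k h' y x)
  jacobi (i j l ij jl li n : Γ) (hij : i + j = ij) (hjl : j + l = jl) (hli : l + i = li)
    (h₁ : i + jl = n) (h₂ : j + li = n) (h₃ : l + ij = n)
    (x : V i) (y : V j) (z : V l) :
    (c.ε l i : R) • bracket i jl n h₁ x (bracket j l jl hjl y z) +
      (c.ε i j : R) • bracket j li n h₂ y (bracket l i li hli z x) +
      (c.ε j l : R) • bracket l ij n h₃ z (bracket i j ij hij x y) = 0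

variable {c : CommutationFactor Γ R}

/-- Morphisms of Lie colour algebras: degree-preserving linear maps preserving the bracket. -/
@[ext]
structure LieColourAlg.Hom (L M : LieColourAlg c) where
  f : L.V ⟶ M.V
  map_bracket (i j k : Γ) (h : i + j = k) (x : L.V i) (y : L.V j) :
    f k (L.bracket i j k h x y) = M.bracket i j k h (f i x) (f j y)

instance LieColourAlg.category : Category (LieColourAlg c) where
  Hom L M := LieColourAlg.Hom L M
  id L := ⟨𝟙 L.V, fun _ _ _ _ _ _ => rfl⟩
  comp f g := ⟨f.f ≫ g.f, fun i j k h x y => by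
    simp only [GradedObject.categoryOfGradedObjects_comp, ModuleCat.comp_apply, f.map_bracket,
      g.map_bracket]⟩
  id_comp _ := LieColourAlg.Hom.ext (Category.id_comp _)
  comp_id _ := LieColourAlg.Hom.ext (Category.comp_id _)
  assoc _ _ _ := LieColourAlg.Hom.ext (Category.assoc _ _ _)

variable (c) in
/-- The forgetful functor from Lie colour algebras to graded modules. -/
def LieColourAlg.forget : LieColourAlg c ⥤ Gr Γ R where
  obj L := L.V
  map f := LieColourAlg.Hom.f f

/-- Lie superalgebras over `R`: `ℤ/2`-graded modules with a super-skew-symmetric even bracket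
satisfying the super Jacobi identity. -/
abbrev LieSuperAlg (R : Type u) [CommRing R] : Type (u + 1) := LieColourAlg (superSign R)

end Colour

end InternalLie

/-! The monoidal claims are checked on pure tensors, which determine a map out of any degree of a
tensor product. Bimultiplicativity of the commutation factor gives the hexagons, and ε(a,b)ε(b,a) =
1 gives the symmetry. In each degree the tensor product of complexes is that of the underlying
graded modules, so the Koszul case of the graded statements serves for complexes as well, and only
compatibility with differentials is left to check. A morphism V ⊗ V ⟶ V is a family of bilinear
maps, and under this dictionary the internal axioms become the classical ones
(`isColourSkew_bilin_iff`, `isColourJacobi_bilin_iff`).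

For local algebraic cartesian closedness, colour algebras and differential graded Lie algebras are
both instances of `OpLie`: graded Lie algebras with a set Ω of square-zero derivations, where Ω is
empty or consists of one operator of degree -1. A point over B amounts to its kernel K with the
action of B by derivations, and the total object is a semidirect product. Change of base along q : E
⟶ B thus restricts the action on K along q. Restriction has a right adjoint, coinduction: morally K
↦ Hom_{U(E)}(U(B), K), with the convolution bracket for the coproduct that makes the generators
primitive.

Enveloping algebras are replaced by words. The letters are the homogeneous elements of B and the
operators. `WFun` consists of all K-valued functions on words, and `good` is the largest family of
submodules stable under letters whose members satisfy the relations of an action and evaluate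
E-equivariantly at the empty word. The bracket on functions is defined so that letters act by
derivations; skew symmetry and Jacobi follow by induction on words (`WFun.skew`, `WFun.jac`), and
maximality makes `good` closed under the bracket (`br_mem_good`). Square-zero operators survive on
brackets because ε(δω, δω) = -1. An equivariant map into functions on words is determined by its
values at the empty word (`WFun.lift_unique`), which yields the couniversal property
(`transpose_counit`, `eq_transpose`) and hence `isLACC_opLie`. The result is carried to the two
concrete categories by `IsLACC.of_isEquivalence`. -/

namespace InternalLie

/-! ### Elements of tensor products of graded modules -/

section GradedTensor

variable {Γ : Type w} [AddCommGroup Γ] [Small.{u} Γ] [DecidableEq Γ] {R : Type u} [CommRing R]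

namespace Gr

variable {U V W Z : Gr Γ R}

/-- This and its iterated forms below reduce every identity of morphisms to one on pure tensors. -/
theorem tensor_hom_ext {k : Γ} {A : ModuleCat.{u} R} {f g : (V ⊗ W : Gr Γ R) k ⟶ A}
    (h : ∀ (i j : Γ) (hij : i + j = k) (x : V i) (y : W j),
      f (tmul V W i j k hij x y) = g (tmul V W i j k hij x y)) : f = g := by
  refine GradedObject.Monoidal.tensorObj_ext (X₁ := V) (X₂ := W) f g fun i j hij => ?_
  exact ModuleCat.hom_ext (TensorProduct.ext' fun x y => h i j hij x y)

theorem hom_ext_tmul {f g : (V ⊗ W : Gr Γ R) ⟶ Z}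
    (h : ∀ (i j k : Γ) (hij : i + j = k) (x : V i) (y : W j),
      f k (tmul V W i j k hij x y) = g k (tmul V W i j k hij x y)) : f = g :=
  funext fun _ => tensor_hom_ext fun i j hij x y => h i j _ hij x y

/-- The map out of a degree of the tensor product given by bilinear maps on the summands. -/
noncomputable def desc {k : Γ} {A : ModuleCat.{u} R}
    (f : ∀ i j : Γ, i + j = k → (V i →ₗ[R] W j →ₗ[R] A)) : (V ⊗ W : Gr Γ R) k ⟶ A :=
  GradedObject.Monoidal.tensorObjDesc (X₁ := V) (X₂ := W)
    fun i j h => ModuleCat.ofHom (TensorProduct.lift (f i j h))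

@[simp]
theorem desc_tmul {k : Γ} {A : ModuleCat.{u} R}
    (f : ∀ i j : Γ, i + j = k → (V i →ₗ[R] W j →ₗ[R] A)) (i j : Γ) (h : i + j = k)
    (x : V i) (y : W j) : desc f (tmul V W i j k h x y) = f i j h x y := by
  have := GradedObject.Monoidal.ι_tensorObjDesc (X₁ := V) (X₂ := W)
    (fun i j h => ModuleCat.ofHom (TensorProduct.lift (f i j h))) i j h
  exact (ConcreteCategory.congr_hom this (x ⊗ₜ[R] y)).trans (TensorProduct.lift.tmul _ _)

variable (V W) in
/-- The elements `v ⊗ w`, as a bilinear map. -/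
noncomputable def tmulₗ (i j k : Γ) (h : i + j = k) :
    V i →ₗ[R] W j →ₗ[R] (V ⊗ W : Gr Γ R) k :=
  (TensorProduct.mk R (V i) (W j)).compr₂ (GradedObject.Monoidal.ιTensorObj V W i j k h).hom

theorem tmulₗ_apply (i j k : Γ) (h : i + j = k) (x : V i) (y : W j) :
    tmulₗ V W i j k h x y = tmul V W i j k h x y := rfl

theorem smul_tmul (i j k : Γ) (h : i + j = k) (r : R) (x : V i) (y : W j) :
    tmul V W i j k h (r • x) y = r • tmul V W i j k h x y :=
  LinearMap.map_smul₂ (tmulₗ V W i j k h) r x y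

theorem tmul_smul (i j k : Γ) (h : i + j = k) (r : R) (x : V i) (y : W j) :
    tmul V W i j k h x (r • y) = r • tmul V W i j k h x y :=
  map_smul (tmulₗ V W i j k h x) r y

theorem tensorHom_tmul {V' W' : Gr Γ R} (f : V ⟶ V') (g : W ⟶ W') (i j k : Γ) (h : i + j = k)
    (x : V i) (y : W j) :
    (f ⊗ₘ g : V ⊗ W ⟶ V' ⊗ W') k (tmul V W i j k h x y) = tmul V' W' i j k h (f i x) (g j y) :=
  ConcreteCategory.congr_hom (GradedObject.Monoidal.ι_tensorHom f g i j k h) (x ⊗ₜ[R] y)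

theorem whiskerLeft_tmul {W' : Gr Γ R} (g : W ⟶ W') (i j k : Γ) (h : i + j = k)
    (x : V i) (y : W j) :
    (V ◁ g : V ⊗ W ⟶ V ⊗ W') k (tmul V W i j k h x y) = tmul V W' i j k h x (g j y) :=
  tensorHom_tmul (𝟙 V) g i j k h x y

theorem whiskerRight_tmul {V' : Gr Γ R} (f : V ⟶ V') (i j k : Γ) (h : i + j = k)
    (x : V i) (y : W j) :
    (f ▷ W : V ⊗ W ⟶ V' ⊗ W) k (tmul V W i j k h x y) = tmul V' W i j k h (f i x) y :=
  tensorHom_tmul f (𝟙 W) i j k h x y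

/-- All degrees are variables tied by equations, so the formula rewrites whatever form the degrees
take; after substitution it is the defining property of the associator on a summand. -/
theorem associator_hom_tmul (i j l ij jl n : Γ) (hij : i + j = ij) (hjl : j + l = jl)
    (h : ij + l = n) (h' : i + jl = n) (x : U i) (y : V j) (z : W l) :
    (α_ U V W).hom n (tmul (U ⊗ V) W ij l n h (tmul U V i j ij hij x y) z) =
      tmul U (V ⊗ W) i jl n h' x (tmul V W j l jl hjl y z) := by
  subst hij hjl h
  exact ConcreteCategory.congr_hom
    (GradedObject.Monoidal.ιTensorObj₃'_associator_hom U V W i j l _ rfl) ((x ⊗ₜ[R] y) ⊗ₜ[R] z)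

theorem associator_inv_tmul (i j l ij jl n : Γ) (hij : i + j = ij) (hjl : j + l = jl)
    (h : ij + l = n) (h' : i + jl = n) (x : U i) (y : V j) (z : W l) :
    (α_ U V W).inv n (tmul U (V ⊗ W) i jl n h' x (tmul V W j l jl hjl y z)) =
      tmul (U ⊗ V) W ij l n h (tmul U V i j ij hij x y) z := by
  rw [← associator_hom_tmul i j l ij jl n hij hjl h h']
  exact ConcreteCategory.congr_hom (congrFun (α_ U V W).hom_inv_id n) _

theorem hom_ext_tmul_tmul {f g : (U ⊗ (V ⊗ W) : Gr Γ R) ⟶ Z}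
    (h : ∀ (i j l jl n : Γ) (hjl : j + l = jl) (hn : i + jl = n) (x : U i) (y : V j) (z : W l),
      f n (tmul U (V ⊗ W) i jl n hn x (tmul V W j l jl hjl y z)) =
        g n (tmul U (V ⊗ W) i jl n hn x (tmul V W j l jl hjl y z))) : f = g := by
  refine hom_ext_tmul fun i jl n hn x t => ?_
  -- For fixed `x` both sides are linear in the element of `V ⊗ W`, so `tensor_hom_ext` applies once
  -- more.
  have : ModuleCat.ofHom ((f n).hom ∘ₗ tmulₗ U (V ⊗ W) i jl n hn x) =
      ModuleCat.ofHom ((g n).hom ∘ₗ tmulₗ U (V ⊗ W) i jl n hn x) :=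
    tensor_hom_ext fun j l hjl y z => h i j l jl n hjl hn x y z
  exact ConcreteCategory.congr_hom this t

theorem hom_ext_tmul_tmul' {f g : ((U ⊗ V) ⊗ W : Gr Γ R) ⟶ Z}
    (h : ∀ (i j l ij n : Γ) (hij : i + j = ij) (hn : ij + l = n) (x : U i) (y : V j) (z : W l),
      f n (tmul (U ⊗ V) W ij l n hn (tmul U V i j ij hij x y) z) =
        g n (tmul (U ⊗ V) W ij l n hn (tmul U V i j ij hij x y) z)) : f = g := by
  refine hom_ext_tmul fun ij l n hn t z => ?_
  have : ModuleCat.ofHom ((f n).hom ∘ₗ (tmulₗ (U ⊗ V) W ij l n hn).flip z) =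
      ModuleCat.ofHom ((g n).hom ∘ₗ (tmulₗ (U ⊗ V) W ij l n hn).flip z) :=
    tensor_hom_ext fun i j hij x y => h i j l ij n hij hn x y z
  exact ConcreteCategory.congr_hom this t

end Gr

end GradedTensor

/-! ### The braiding given by a commutation factor -/

section ColourBraiding

theorem CommutationFactor.mul_swap {Γ : Type w} [AddCommGroup Γ] {R : Type u} [CommRing R]
    (c : CommutationFactor Γ R) (a b : Γ) : (c.ε a b : R) * c.ε b a = 1 := by
  rw [← Units.val_mul, c.skew, Units.val_one]

variable {Γ : Type w} [AddCommGroup Γ] [Small.{u} Γ] [DecidableEq Γ] {R : Type u} [CommRing R]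
  (c : CommutationFactor Γ R)

namespace CommutationFactor

/-- The braiding morphism `v ⊗ w ↦ ε(i, j) w ⊗ v`. -/
noncomputable def braidingHom (V W : Gr Γ R) : V ⊗ W ⟶ W ⊗ V := fun k =>
  Gr.desc fun i j h => (c.ε i j : R) • (Gr.tmulₗ W V j i k ((add_comm j i).trans h)).flip

theorem braidingHom_tmul (V W : Gr Γ R) (i j k : Γ) (h : i + j = k) (h' : j + i = k)
    (x : V i) (y : W j) :
    c.braidingHom V W k (Gr.tmul V W i j k h x y) = (c.ε i j : R) • Gr.tmul W V j i k h' y x := by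
  simp [braidingHom, Gr.tmulₗ_apply]

theorem braidingHom_comp (V W : Gr Γ R) : c.braidingHom V W ≫ c.braidingHom W V = 𝟙 _ := by
  refine Gr.hom_ext_tmul fun i j k h x y => ?_
  have h' : j + i = k := by rw [add_comm, h]
  rw [GradedObject.categoryOfGradedObjects_comp, ModuleCat.comp_apply,
    c.braidingHom_tmul V W i j k h h', map_smul, c.braidingHom_tmul W V j i k h' h, smul_smul,
    c.mul_swap, one_smul]
  rfl

/-- The braiding of graded modules given by a commutation factor. -/
noncomputable def braidingIso (V W : Gr Γ R) : V ⊗ W ≅ W ⊗ V where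
  hom := c.braidingHom V W
  inv := c.braidingHom W V
  hom_inv_id := c.braidingHom_comp V W
  inv_hom_id := c.braidingHom_comp W V

theorem braidingHom_naturality_right (X : Gr Γ R) {Y Z : Gr Γ R} (f : Y ⟶ Z) :
    X ◁ f ≫ c.braidingHom X Z = c.braidingHom X Y ≫ f ▷ X := by
  refine Gr.hom_ext_tmul fun i j k h x y => ?_
  have h' : j + i = k := by rw [add_comm, h]
  simp only [GradedObject.categoryOfGradedObjects_comp, ModuleCat.comp_apply,
    c.braidingHom_tmul _ _ i j k h h', map_smul, Gr.whiskerLeft_tmul, Gr.whiskerRight_tmul]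

theorem braidingHom_naturality_left {X Y : Gr Γ R} (f : X ⟶ Y) (Z : Gr Γ R) :
    f ▷ Z ≫ c.braidingHom Y Z = c.braidingHom X Z ≫ Z ◁ f := by
  refine Gr.hom_ext_tmul fun i j k h x y => ?_
  have h' : j + i = k := by rw [add_comm, h]
  simp only [GradedObject.categoryOfGradedObjects_comp, ModuleCat.comp_apply,
    c.braidingHom_tmul _ _ i j k h h', map_smul, Gr.whiskerLeft_tmul, Gr.whiskerRight_tmul]

/-- Both sides send (x ⊗ y) ⊗ z to a multiple of y ⊗ (z ⊗ x), with scalars ε(i, j + l) and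
ε(i,j)ε(i,l). -/
theorem hexagon_forward (X Y Z : Gr Γ R) :
    (α_ X Y Z).hom ≫ c.braidingHom X (Y ⊗ Z) ≫ (α_ Y Z X).hom =
      (c.braidingHom X Y ▷ Z) ≫ (α_ Y X Z).hom ≫ (Y ◁ c.braidingHom X Z) := by
  refine Gr.hom_ext_tmul_tmul' fun i j l ij n hij hn x y z => ?_
  obtain ⟨jl, hjl⟩ : ∃ jl, j + l = jl := ⟨_, rfl⟩
  obtain ⟨li, hli⟩ : ∃ li, l + i = li := ⟨_, rfl⟩
  have h₁ : i + jl = n := by rw [← hn, ← hij, ← hjl, add_assoc]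
  have h₂ : jl + i = n := by rw [add_comm, h₁]
  have h₃ : j + i = ij := by rw [add_comm, hij]
  have h₄ : j + li = n := by rw [← h₂, ← hli, ← hjl, add_assoc]
  have h₅ : i + l = li := by rw [add_comm, hli]
  simp only [GradedObject.categoryOfGradedObjects_comp, ModuleCat.comp_apply]
  rw [Gr.associator_hom_tmul i j l ij jl n hij hjl hn h₁,
    c.braidingHom_tmul X (Y ⊗ Z) i jl n h₁ h₂, map_smul,
    Gr.associator_hom_tmul j l i jl li n hjl hli h₂ h₄,
    Gr.whiskerRight_tmul, c.braidingHom_tmul X Y i j ij hij h₃, Gr.smul_tmul, map_smul, map_smul,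
    Gr.associator_hom_tmul j i l ij li n h₃ h₅ hn h₄, Gr.whiskerLeft_tmul,
    c.braidingHom_tmul X Z i l li h₅ hli, Gr.tmul_smul, smul_smul, ← hjl, c.add_right,
    Units.val_mul]

/-- The scalars are now ε(i + j, l) and ε(i,l)ε(j,l), so additivity in the first variable is what
matters. -/
theorem hexagon_reverse (X Y Z : Gr Γ R) :
    (α_ X Y Z).inv ≫ c.braidingHom (X ⊗ Y) Z ≫ (α_ Z X Y).inv =
      (X ◁ c.braidingHom Y Z) ≫ (α_ X Z Y).inv ≫ (c.braidingHom X Z ▷ Y) := by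
  refine Gr.hom_ext_tmul_tmul fun i j l jl n hjl hn x y z => ?_
  obtain ⟨ij, hij⟩ : ∃ ij, i + j = ij := ⟨_, rfl⟩
  obtain ⟨li, hli⟩ : ∃ li, l + i = li := ⟨_, rfl⟩
  have h₁ : ij + l = n := by rw [← hn, ← hij, ← hjl, add_assoc]
  have h₂ : l + ij = n := by rw [add_comm, h₁]
  have h₃ : l + j = jl := by rw [add_comm, hjl]
  have h₄ : li + j = n := by rw [← h₂, ← hli, ← hij, add_assoc]
  have h₅ : i + l = li := by rw [add_comm, hli]
  simp only [GradedObject.categoryOfGradedObjects_comp, ModuleCat.comp_apply]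
  rw [Gr.associator_inv_tmul i j l ij jl n hij hjl h₁ hn,
    c.braidingHom_tmul (X ⊗ Y) Z ij l n h₁ h₂, map_smul,
    Gr.associator_inv_tmul l i j li ij n hli hij h₄ h₂,
    Gr.whiskerLeft_tmul, c.braidingHom_tmul Y Z j l jl hjl h₃, Gr.tmul_smul, map_smul, map_smul,
    Gr.associator_inv_tmul i l j li jl n h₅ h₃ h₄ hn, Gr.whiskerRight_tmul,
    c.braidingHom_tmul X Z i l li h₅ hli, Gr.smul_tmul, smul_smul, ← hij, c.add_left,
    Units.val_mul, mul_comm]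

/-- The braided structure on graded modules given by a commutation factor. -/
noncomputable abbrev braidedCategory : BraidedCategory (Gr Γ R) where
  braiding := c.braidingIso
  braiding_naturality_left f Z := c.braidingHom_naturality_left f Z
  braiding_naturality_right X _ _ f := c.braidingHom_naturality_right X f
  hexagon_forward := c.hexagon_forward
  hexagon_reverse := c.hexagon_reverse

end CommutationFactor

end ColourBraiding

end InternalLie

namespace InternalLie

/-! ### Adjoints from couniversal arrows -/

/-- A couniversal arrow is a terminal object of the category of arrows from `F` to `A`. Both the
internal homs and the adjoints of change of base are obtained this way, without constructing the
right adjoint on morphisms. -/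
theorem isLeftAdjoint_of_couniversal {C : Type*} {D : Type*} [Category* C] [Category* D]
    (F : D ⥤ C) (h : ∀ A : C, ∃ (Z : D) (e : F.obj Z ⟶ A), ∀ (B : D) (f : F.obj B ⟶ A),
      ∃! g : B ⟶ Z, F.map g ≫ e = f) : F.IsLeftAdjoint := by
  have (A : C) : HasTerminal (CostructuredArrow F A) := by
    obtain ⟨Z, e, he⟩ := h A
    refine IsTerminal.hasTerminal (X := CostructuredArrow.mk e) (IsTerminal.ofUniqueHom
      (fun B => CostructuredArrow.homMk (he B.left B.hom).choose
        (he B.left B.hom).choose_spec.1) fun B m => ?_)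
    ext
    exact (he B.left B.hom).choose_spec.2 _ (CostructuredArrow.w m)
  exact isLeftAdjoint_of_costructuredArrowTerminals F

theorem nonempty_monoidalClosed {C : Type*} [Category* C] [MonoidalCategory C]
    (h : ∀ V W : C, ∃ (Z : C) (e : V ⊗ Z ⟶ W), ∀ (B : C) (f : V ⊗ B ⟶ W),
      ∃! g : B ⟶ Z, V ◁ g ≫ e = f) : Nonempty (MonoidalClosed C) :=
  have (V : C) : (tensorLeft V).IsLeftAdjoint := isLeftAdjoint_of_couniversal _ (h V)
  ⟨{ closed := fun V => { rightAdj := _, adj := (this V).exists_rightAdjoint.choose_spec.some } }⟩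

/-! ### Small modules of families -/

section Family

variable {R : Type u} [CommRing R] {ι : Type w} [Small.{u} ι] {M : ι → Type u}
  [∀ i, AddCommGroup (M i)] [∀ i, Module R (M i)]

/-- The projection from the small model of a product of modules. -/
noncomputable def smallProj (i : ι) : Shrink.{u} (∀ i, M i) →ₗ[R] M i :=
  LinearMap.proj i ∘ₗ (Shrink.linearEquiv R (∀ i, M i)).toLinearMap

variable (R) in
/-- The element of the small model of a product of modules with given components. -/
noncomputable def smallMk (f : ∀ i, M i) : Shrink.{u} (∀ i, M i) :=
  (Shrink.linearEquiv R (∀ i, M i)).symm f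

@[simp]
theorem smallProj_smallMk (f : ∀ i, M i) (i : ι) :
    smallProj (R := R) i (smallMk R f) = f i := by
  simp [smallProj, smallMk]

variable (R) in
theorem small_ext {f g : Shrink.{u} (∀ i, M i)}
    (h : ∀ i, smallProj (R := R) i f = smallProj (R := R) i g) : f = g :=
  (Shrink.linearEquiv R (∀ i, M i)).injective (funext h)

end Family

/-! ### Graded modules form a closed, cocomplete, abelian category -/

section GradedClosed

variable {Γ : Type w} [AddCommGroup Γ] [Small.{u} Γ] {R : Type u} [CommRing R]

namespace Gr

/-- The graded module of homogeneous linear maps. -/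
noncomputable def ihom (V W : Gr Γ R) : Gr Γ R := fun k =>
  -- Indexing by pairs keeps the target degree free up to an equation; `Shrink` brings the product,
  -- indexed over a possibly different universe, back to `u`.
  ModuleCat.of R (Shrink.{u} (∀ p : {p : Γ × Γ // p.1 + k = p.2}, V p.1.1 →ₗ[R] W p.1.2))

variable {V W : Gr Γ R}

/-- The components of a homogeneous linear map. -/
noncomputable def ihomApp (i k j : Γ) (h : i + k = j) : ihom V W k →ₗ[R] V i →ₗ[R] W j :=
  smallProj (M := fun p : {p : Γ × Γ // p.1 + k = p.2} => V p.1.1 →ₗ[R] W p.1.2) ⟨(i, j), h⟩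

/-- The homogeneous linear map with given components. -/
noncomputable def ihomMk (k : Γ) (f : ∀ i j : Γ, i + k = j → (V i →ₗ[R] W j)) : ihom V W k :=
  smallMk R fun p : {p : Γ × Γ // p.1 + k = p.2} => f p.1.1 p.1.2 p.2

@[simp]
theorem ihomApp_ihomMk (k : Γ) (f : ∀ i j : Γ, i + k = j → (V i →ₗ[R] W j)) (i j : Γ)
    (h : i + k = j) : ihomApp i k j h (ihomMk k f) = f i j h :=
  smallProj_smallMk (R := R) (fun p : {p : Γ × Γ // p.1 + k = p.2} => f p.1.1 p.1.2 p.2) ⟨(i, j), h⟩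

theorem ihom_ext {k : Γ} {f g : ihom V W k}
    (h : ∀ (i j : Γ) (hij : i + k = j) (x : V i), ihomApp i k j hij f x = ihomApp i k j hij g x) :
    f = g :=
  small_ext R fun p => LinearMap.ext (h p.1.1 p.1.2 p.2)

/-- The homogeneous linear map with given components, as a linear map. -/
noncomputable def ihomMkₗ {M : Type*} [AddCommGroup M] [Module R M] (k : Γ)
    (f : ∀ i j : Γ, i + k = j → (M →ₗ[R] V i →ₗ[R] W j)) : M →ₗ[R] ihom V W k where
  toFun m := ihomMk k fun i j h => f i j h m
  map_add' _ _ := ihom_ext fun i j h x => by simp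
  map_smul' _ _ := ihom_ext fun i j h x => by simp

@[simp]
theorem ihomApp_ihomMkₗ {M : Type*} [AddCommGroup M] [Module R M] (k : Γ)
    (f : ∀ i j : Γ, i + k = j → (M →ₗ[R] V i →ₗ[R] W j)) (i j : Γ) (h : i + k = j) (m : M) :
    ihomApp i k j h (ihomMkₗ k f m) = f i j h m :=
  ihomApp_ihomMk k (fun i j h => f i j h m) i j h

variable [DecidableEq Γ]

/-- The evaluation `x ⊗ f ↦ f x`. -/
noncomputable def ihomEv (V W : Gr Γ R) : V ⊗ ihom V W ⟶ W := fun j =>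
  desc fun i k h => (ihomApp i k j h).flip

theorem ihomEv_tmul (i k j : Γ) (h : i + k = j) (x : V i) (f : ihom V W k) :
    ihomEv V W j (tmul V (ihom V W) i k j h x f) = ihomApp i k j h f x :=
  desc_tmul ..

/-- Currying of morphisms out of a tensor product. -/
noncomputable def ihomCurry {B : Gr Γ R} (f : V ⊗ B ⟶ W) : B ⟶ ihom V W := fun k =>
  ModuleCat.ofHom (ihomMkₗ k fun i j h => ((tmulₗ V B i k j h).compr₂ (f j).hom).flip)

theorem ihomApp_ihomCurry {B : Gr Γ R} (f : V ⊗ B ⟶ W) (i k j : Γ) (h : i + k = j) (x : V i)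
    (y : B k) : ihomApp i k j h (ihomCurry f k y) x = f j (tmul V B i k j h x y) :=
  LinearMap.congr_fun (ihomApp_ihomMkₗ k
    (fun i j h => ((tmulₗ V B i k j h).compr₂ (f j).hom).flip) i j h y) x

theorem whiskerLeft_ihomEv_tmul {B : Gr Γ R} (g : B ⟶ ihom V W) (i k j : Γ) (h : i + k = j)
    (x : V i) (y : B k) :
    (V ◁ g ≫ ihomEv V W) j (tmul V B i k j h x y) = ihomApp i k j h (g k y) x := by
  rw [GradedObject.categoryOfGradedObjects_comp, ModuleCat.comp_apply, whiskerLeft_tmul,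
    ihomEv_tmul]

theorem whiskerLeft_ihomCurry_ihomEv {B : Gr Γ R} (f : V ⊗ B ⟶ W) :
    V ◁ ihomCurry f ≫ ihomEv V W = f :=
  hom_ext_tmul fun i k j h x y => by rw [whiskerLeft_ihomEv_tmul, ihomApp_ihomCurry]

theorem eq_of_whiskerLeft_ihomEv {B : Gr Γ R} {g g' : B ⟶ ihom V W}
    (h : V ◁ g ≫ ihomEv V W = V ◁ g' ≫ ihomEv V W) : g = g' :=
  funext fun k => ModuleCat.hom_ext (LinearMap.ext fun y => ihom_ext fun i j hij x => by
    rw [← whiskerLeft_ihomEv_tmul, h, whiskerLeft_ihomEv_tmul])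

theorem nonempty_monoidalClosed : Nonempty (MonoidalClosed (Gr Γ R)) :=
  InternalLie.nonempty_monoidalClosed fun V W => ⟨ihom V W, ihomEv V W, fun _ f =>
    ⟨ihomCurry f, whiskerLeft_ihomCurry_ihomEv f, fun _ hg =>
      eq_of_whiskerLeft_ihomEv (hg.trans (whiskerLeft_ihomCurry_ihomEv f).symm)⟩⟩

end Gr

end GradedClosed

section GradedAbelian

variable (Γ : Type w) (C : Type*) [Category.{v} C]

/-- Graded objects are functors on a discrete category, and functor categories inherit colimits and
abelianness from their target. -/
theorem graded_hasColimitsOfSize [HasColimitsOfSize.{v, v} C] :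
    HasColimitsOfSize.{v, v} (GradedObject Γ C) :=
  Adjunction.has_colimits_of_equivalence (piEquivalenceFunctorDiscrete Γ C).functor

theorem graded_nonempty_abelian [Abelian C] : Nonempty (Abelian (GradedObject Γ C)) :=
  have : HasFiniteProducts (GradedObject Γ C) :=
    ⟨fun _ => Adjunction.hasLimitsOfShape_of_equivalence
      (piEquivalenceFunctorDiscrete Γ C).functor⟩
  ⟨abelianOfEquivalence (piEquivalenceFunctorDiscrete Γ C).functor⟩

end GradedAbelian

/-! ### Internal Lie algebras in graded modules -/

section GradedLie

variable {Γ : Type w} [AddCommGroup Γ] [Small.{u} Γ] [DecidableEq Γ] {R : Type u} [CommRing R]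

namespace Gr

/-- The bilinear maps given by a morphism out of a tensor product. -/
noncomputable def bilin {V W Z : Gr Γ R} (f : V ⊗ W ⟶ Z) (i j k : Γ) (h : i + j = k) :
    V i →ₗ[R] W j →ₗ[R] Z k :=
  (tmulₗ V W i j k h).compr₂ (f k).hom

end Gr

variable (c : CommutationFactor Γ R)

/-- Skew symmetry of a graded bilinear bracket. -/
def IsColourSkew {Γ : Type w} [AddCommGroup Γ] {R : Type u} [CommRing R]
    (c : CommutationFactor Γ R) {V : Gr Γ R}
    (b : ∀ i j k : Γ, i + j = k → (V i →ₗ[R] V j →ₗ[R] V k)) : Prop :=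
  ∀ (i j k : Γ) (h : i + j = k) (h' : j + i = k) (x : V i) (y : V j),
    b i j k h x y = -((c.ε i j : R) • b j i k h' y x)

/-- The Jacobi identity for a graded bilinear bracket. -/
def IsColourJacobi {Γ : Type w} [AddCommGroup Γ] {R : Type u} [CommRing R]
    (c : CommutationFactor Γ R) {V : Gr Γ R}
    (b : ∀ i j k : Γ, i + j = k → (V i →ₗ[R] V j →ₗ[R] V k)) : Prop :=
  ∀ (i j l ij jl li n : Γ) (hij : i + j = ij) (hjl : j + l = jl) (hli : l + i = li)
    (h₁ : i + jl = n) (h₂ : j + li = n) (h₃ : l + ij = n)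
    (x : V i) (y : V j) (z : V l),
    (c.ε l i : R) • b i jl n h₁ x (b j l jl hjl y z) +
      (c.ε i j : R) • b j li n h₂ y (b l i li hli z x) +
      (c.ε j l : R) • b l ij n h₃ z (b i j ij hij x y) = 0

variable {V : Gr Γ R} (b : V ⊗ V ⟶ V)

theorem isColourSkew_bilin_iff :
    letI := c.braidedCategory
    IsColourSkew c (Gr.bilin b) ↔ (𝟙 (V ⊗ V) + (β_ V V).hom) ≫ b = 0 := by
  let _ := c.braidedCategory
  have key (i j k : Γ) (h : i + j = k) (h' : j + i = k) (x : V i) (y : V j) :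
      ((𝟙 (V ⊗ V) + (β_ V V).hom) ≫ b) k (Gr.tmul V V i j k h x y) =
        Gr.bilin b i j k h x y + (c.ε i j : R) • Gr.bilin b j i k h' y x := by
    change b k (Gr.tmul V V i j k h x y + c.braidingHom V V k (Gr.tmul V V i j k h x y)) = _
    rw [c.braidingHom_tmul V V i j k h h', map_add, map_smul]
    rfl
  constructor
  · intro H
    refine Gr.hom_ext_tmul fun i j k h x y => ?_
    rw [key i j k h ((add_comm j i).trans h), H i j k h ((add_comm j i).trans h), neg_add_cancel]
    rfl
  · intro H i j k h h' x y
    rw [eq_neg_iff_add_eq_zero, ← key, H]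
    rfl

theorem cyc_tmul (i j l jl n ij : Γ) (hjl : j + l = jl) (hn : i + jl = n) (hij : i + j = ij)
    (hn' : l + ij = n) (x : V i) (y : V j) (z : V l) :
    letI := c.braidedCategory
    cyc V n (Gr.tmul V (V ⊗ V) i jl n hn x (Gr.tmul V V j l jl hjl y z)) =
      (c.ε ij l : R) • Gr.tmul V (V ⊗ V) l ij n hn' z (Gr.tmul V V i j ij hij x y) := by
  have h : ij + l = n := by rw [add_comm, hn']
  change c.braidingHom (V ⊗ V) V n ((α_ V V V).inv n _) = _
  rw [Gr.associator_inv_tmul i j l ij jl n hij hjl h hn, c.braidingHom_tmul _ _ ij l n h hn']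

/-- On x ⊗ (y ⊗ z) the cyclic sum has coefficients 1, ε(i + j, l) and ε(i + j, l)ε(l + i, j), on
[x,[y,z]], [z,[x,y]] and [y,[z,x]] respectively. Multiplying by the unit ε(l,i) turns them into
ε(l,i), ε(j,l) and ε(i,j). -/
theorem isColourJacobi_bilin_iff :
    letI := c.braidedCategory
    IsColourJacobi c (Gr.bilin b) ↔
      (𝟙 (V ⊗ (V ⊗ V)) + cyc V + cyc V ≫ cyc V) ≫ (V ◁ b) ≫ b = 0 := by
  let _ := c.braidedCategory
  have key (i j l ij jl li n : Γ) (hij : i + j = ij) (hjl : j + l = jl) (hli : l + i = li)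
      (h₁ : i + jl = n) (h₂ : j + li = n) (h₃ : l + ij = n) (x : V i) (y : V j) (z : V l) :
      (c.ε l i : R) • ((𝟙 (V ⊗ (V ⊗ V)) + cyc V + cyc V ≫ cyc V) ≫ (V ◁ b) ≫ b) n
          (Gr.tmul V (V ⊗ V) i jl n h₁ x (Gr.tmul V V j l jl hjl y z)) =
        (c.ε l i : R) • Gr.bilin b i jl n h₁ x (Gr.bilin b j l jl hjl y z) +
          (c.ε i j : R) • Gr.bilin b j li n h₂ y (Gr.bilin b l i li hli z x) +
          (c.ε j l : R) • Gr.bilin b l ij n h₃ z (Gr.bilin b i j ij hij x y) := by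
    have e (t : (V ⊗ (V ⊗ V) : Gr Γ R) n) :
        ((𝟙 (V ⊗ (V ⊗ V)) + cyc V + cyc V ≫ cyc V) ≫ (V ◁ b) ≫ b) n t =
          b n ((V ◁ b) n (t + cyc V n t + cyc V n (cyc V n t))) := rfl
    rw [e, cyc_tmul c i j l jl n ij hjl h₁ hij h₃, map_smul,
      cyc_tmul c l i j ij n li hij h₃ hli h₂, map_add, map_add, map_add, map_add, map_smul,
      map_smul, map_smul, map_smul, map_smul, map_smul, Gr.whiskerLeft_tmul, Gr.whiskerLeft_tmul,
      Gr.whiskerLeft_tmul, smul_add, smul_add, smul_smul, smul_smul, smul_smul, add_right_comm]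
    have h₄ : (c.ε l i : R) * c.ε ij l = c.ε j l := by
      rw [← hij, c.add_left, Units.val_mul, ← mul_assoc, c.mul_swap, one_mul]
    have h₅ : (c.ε j l : R) * c.ε li j = c.ε i j := by
      rw [← hli, c.add_left, Units.val_mul, ← mul_assoc, c.mul_swap, one_mul]
    rw [h₄, h₅]
    rfl
  constructor
  · intro H
    refine Gr.hom_ext_tmul_tmul fun i j l jl n hjl hn x y z => ?_
    have h₁ : l + (i + j) = n := by rw [← hn, ← hjl]; abel
    have h₂ : j + (l + i) = n := by rw [← hn, ← hjl]; abel
    have := key i j l _ jl _ n rfl hjl rfl hn h₂ h₁ x y z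
    rw [H i j l _ jl _ n rfl hjl rfl hn h₂ h₁ x y z] at this
    -- ε(l,i) is a unit, so it can be cancelled.
    exact (smul_eq_zero_iff_eq (c.ε l i)).1 this
  · intro H i j l ij jl li n hij hjl hli h₁ h₂ h₃ x y z
    rw [← key, H]
    exact smul_zero _

variable (Γ) in
/-- The Lie colour algebra given by an internal Lie algebra. -/
noncomputable def LieObj.toColour :
    letI := c.braidedCategory
    LieObj (Gr Γ R) ⥤ LieColourAlg c :=
  letI := c.braidedCategory
  { obj := fun L =>
      { V := L.X
        bracket := Gr.bilin L.b
        skew := (isColourSkew_bilin_iff c L.b).2 L.skew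
        jacobi := (isColourJacobi_bilin_iff c L.b).2 L.jacobi }
    map := fun {L M} f =>
      { f := f.f
        map_bracket := fun i j k h x y =>
          (ConcreteCategory.congr_hom (congrFun f.map_b k) (Gr.tmul L.X L.X i j k h x y)).trans
            (congrArg (M.b k) (Gr.tensorHom_tmul f.f f.f i j k h x y)) } }

theorem LieObj.toColour_isEquivalence :
    letI := c.braidedCategory
    (LieObj.toColour Γ c).IsEquivalence := by
  let _ := c.braidedCategory
  refine { faithful := ⟨fun h => ?_⟩, full := ⟨fun {_ M} f => ⟨⟨f.f, ?_⟩, rfl⟩⟩,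
            essSurj := ⟨fun M => ?_⟩ }
  · exact LieObj.Hom.ext (congrArg LieColourAlg.Hom.f h)
  · refine Gr.hom_ext_tmul fun i j k h x y => (f.map_bracket i j k h x y).trans ?_
    exact (congrArg (M.b k) (Gr.tensorHom_tmul f.f f.f i j k h x y)).symm
  · let b : M.V ⊗ M.V ⟶ M.V := fun k => Gr.desc fun i j h => M.bracket i j k h
    have hb : Gr.bilin b = M.bracket := by
      ext i j k h x y
      exact Gr.desc_tmul _ i j h x y
    have h₁ := (isColourSkew_bilin_iff c b).1 (hb ▸ M.skew)
    have h₂ := (isColourJacobi_bilin_iff c b).1 (hb ▸ M.jacobi)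
    -- The bracket read off from `b` is the given one, so the image is equal to `M`, not merely
    -- isomorphic to it.
    refine ⟨⟨M.V, b, h₁, h₂⟩, ⟨eqToIso ?_⟩⟩
    rcases M with ⟨V, br, s, t⟩
    change LieColourAlg.mk V (Gr.bilin b) _ _ = _
    congr

variable (Γ R) in
theorem graded_main :
    ∃ _ : BraidedCategory (Gr Γ R),
      (∀ V W : Gr Γ R, (β_ V W).hom ≫ (β_ W V).hom = 𝟙 (V ⊗ W)) ∧
      (∀ (V W : Gr Γ R) (i j k : Γ) (h : i + j = k) (h' : j + i = k) (x : V i) (y : W j),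
        (β_ V W).hom k (Gr.tmul V W i j k h x y) =
          (c.ε i j : R) • Gr.tmul W V j i k h' y x) ∧
      Nonempty (MonoidalClosed (Gr Γ R)) ∧
      HasColimitsOfSize.{u, u} (Gr Γ R) ∧
      Nonempty (Abelian (Gr Γ R)) ∧
      (∃ (e : LieObj (Gr Γ R) ≌ LieColourAlg c)
          (φ : e.functor ⋙ LieColourAlg.forget c ≅ LieObj.forget (Gr Γ R)),
        ∀ (L : LieObj (Gr Γ R)) (i j k : Γ) (h : i + j = k)
          (x : (e.functor.obj L).V i) (y : (e.functor.obj L).V j),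
          φ.hom.app L k ((e.functor.obj L).bracket i j k h x y) =
            L.b k (Gr.tmul L.X L.X i j k h (φ.hom.app L i x) (φ.hom.app L j y))) := by
  let _ := c.braidedCategory
  have := LieObj.toColour_isEquivalence c
  exact ⟨c.braidedCategory, c.braidingHom_comp, c.braidingHom_tmul, Gr.nonempty_monoidalClosed,
    graded_hasColimitsOfSize _ _, graded_nonempty_abelian _ _,
    (LieObj.toColour Γ c).asEquivalence, Iso.refl _, fun _ _ _ _ _ _ _ => rfl⟩

end GradedLie

end InternalLie

namespace InternalLie

/-! ### The tensor product of chain complexes -/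

section ChainTensor

variable {R : Type u} [CommRing R]

namespace Ch

variable {U V W Z : Ch R}

/-- The total differential is a sum of a horizontal and a vertical part. On the summand (i, j) each
is a single term, the vertical one carrying the sign from `tensorSignsDownInt`. -/
theorem d_tmul (V W : Ch R) (i j k : ℤ) (h : i + j = k) (h₁ : (i - 1) + j = k - 1)
    (h₂ : i + (j - 1) = k - 1) (x : V.X i) (y : W.X j) :
    (V ⊗ W : Ch R).d k (k - 1) (tmul V W i j k h x y) =
      tmul V W (i - 1) j (k - 1) h₁ (V.d i (i - 1) x) y +
        i.negOnePow • tmul V W i (j - 1) (k - 1) h₂ x (W.d j (j - 1) y) := by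
  have := HomologicalComplex.mapBifunctor.d_eq V W (curriedTensor _) (ComplexShape.down ℤ) k (k - 1)
  have e : HomologicalComplex.ιTensorObj V W i j k h ≫ (V ⊗ W : Ch R).d k (k - 1) =
      V.d i (i - 1) ▷ W.X j ≫ HomologicalComplex.ιTensorObj V W (i - 1) j (k - 1) h₁ +
        i.negOnePow • V.X i ◁ W.d j (j - 1) ≫
          HomologicalComplex.ιTensorObj V W i (j - 1) (k - 1) h₂ := by
    erw [this]
    rw [Preadditive.comp_add, HomologicalComplex.mapBifunctor.ι_D₁,
      HomologicalComplex.mapBifunctor.ι_D₂,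
      HomologicalComplex.mapBifunctor.d₁_eq _ _ _ _ (i₁' := i - 1) _ _ _ h₁,
      HomologicalComplex.mapBifunctor.d₂_eq _ _ _ _ _ (i₂' := j - 1) _ _ h₂]
    · simp
      rfl
    · simp
    · simp
  exact ConcreteCategory.congr_hom e (x ⊗ₜ[R] y)

/-- A degree of the tensor product of complexes is by definition the same degree of the tensor
product of graded modules. Hence the graded lemmas apply verbatim, here and throughout the section.
-/
theorem tensor_X_hom_ext {k : ℤ} {A : ModuleCat.{u} R} {f g : (V ⊗ W : Ch R).X k ⟶ A}
    (h : ∀ (i j : ℤ) (hij : i + j = k) (x : V.X i) (y : W.X j),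
      f (tmul V W i j k hij x y) = g (tmul V W i j k hij x y)) : f = g :=
  Gr.tensor_hom_ext (V := V.X) (W := W.X) h

theorem hom_ext_tmul {f g : V ⊗ W ⟶ Z}
    (h : ∀ (i j k : ℤ) (hij : i + j = k) (x : V.X i) (y : W.X j),
      f.f k (tmul V W i j k hij x y) = g.f k (tmul V W i j k hij x y)) : f = g :=
  HomologicalComplex.hom_ext _ _ fun _ => tensor_X_hom_ext fun i j hij x y => h i j _ hij x y

/-- The map out of a degree of the tensor product given by bilinear maps on the summands. -/
noncomputable def desc {k : ℤ} {A : ModuleCat.{u} R}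
    (f : ∀ i j : ℤ, i + j = k → (V.X i →ₗ[R] W.X j →ₗ[R] A)) : (V ⊗ W : Ch R).X k ⟶ A :=
  Gr.desc (V := V.X) (W := W.X) f

theorem desc_tmul {k : ℤ} {A : ModuleCat.{u} R}
    (f : ∀ i j : ℤ, i + j = k → (V.X i →ₗ[R] W.X j →ₗ[R] A)) (i j : ℤ) (h : i + j = k)
    (x : V.X i) (y : W.X j) : desc f (tmul V W i j k h x y) = f i j h x y :=
  Gr.desc_tmul (V := V.X) (W := W.X) f i j h x y

variable (V W) in
/-- The elements `v ⊗ w`, as a bilinear map. -/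
noncomputable def tmulₗ (i j k : ℤ) (h : i + j = k) :
    V.X i →ₗ[R] W.X j →ₗ[R] (V ⊗ W : Ch R).X k :=
  (TensorProduct.mk R (V.X i) (W.X j)).compr₂ (HomologicalComplex.ιTensorObj V W i j k h).hom

theorem tmulₗ_apply (i j k : ℤ) (h : i + j = k) (x : V.X i) (y : W.X j) :
    tmulₗ V W i j k h x y = tmul V W i j k h x y := rfl

theorem tensorHom_tmul {V' W' : Ch R} (f : V ⟶ V') (g : W ⟶ W') (i j k : ℤ) (h : i + j = k)
    (x : V.X i) (y : W.X j) :
    (f ⊗ₘ g : V ⊗ W ⟶ V' ⊗ W').f k (tmul V W i j k h x y) =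
      tmul V' W' i j k h (f.f i x) (g.f j y) :=
  Gr.tensorHom_tmul (V := V.X) (W := W.X) (V' := V'.X) (W' := W'.X) f.f g.f i j k h x y

theorem whiskerLeft_tmul {W' : Ch R} (g : W ⟶ W') (i j k : ℤ) (h : i + j = k)
    (x : V.X i) (y : W.X j) :
    (V ◁ g : V ⊗ W ⟶ V ⊗ W').f k (tmul V W i j k h x y) = tmul V W' i j k h x (g.f j y) :=
  tensorHom_tmul (𝟙 V) g i j k h x y

variable (V W) in
theorem d_eq_zero {i j : ℤ} (h : j + 1 ≠ i) : V.d i j = 0 := V.shape i j h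

/-- Constructor for chain maps. -/
def mkHom (f : ∀ k, V.X k ⟶ W.X k)
    (h : ∀ k (x : V.X k), W.d k (k - 1) (f k x) = f (k - 1) (V.d k (k - 1) x)) : V ⟶ W where
  f := f
  comm' i j hij := by
    obtain rfl : j = i - 1 := by change j + 1 = i at hij; lia
    exact ModuleCat.hom_ext (LinearMap.ext (h i))

theorem map_d (f : V ⟶ W) (i j : ℤ) (x : V.X i) : W.d i j (f.f i x) = f.f j (V.d i j x) :=
  ConcreteCategory.congr_hom (f.comm i j) x

theorem d_d (i j k : ℤ) (x : V.X i) : V.d j k (V.d i j x) = 0 :=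
  ConcreteCategory.congr_hom (V.d_comp_d i j k) x

theorem mkHom_tensor_comm (f : ∀ k, (V ⊗ W : Ch R).X k ⟶ Z.X k)
    (h : ∀ (i j k : ℤ) (hij : i + j = k) (h₁ : (i - 1) + j = k - 1) (h₂ : i + (j - 1) = k - 1)
      (x : V.X i) (y : W.X j), Z.d k (k - 1) (f k (tmul V W i j k hij x y)) =
        f (k - 1) (tmul V W (i - 1) j (k - 1) h₁ (V.d i (i - 1) x) y) +
          i.negOnePow • f (k - 1) (tmul V W i (j - 1) (k - 1) h₂ x (W.d j (j - 1) y)))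
    (k : ℤ) (t : (V ⊗ W : Ch R).X k) :
    Z.d k (k - 1) (f k t) = f (k - 1) ((V ⊗ W : Ch R).d k (k - 1) t) := by
  have : f k ≫ Z.d k (k - 1) = (V ⊗ W : Ch R).d k (k - 1) ≫ f (k - 1) :=
    tensor_X_hom_ext fun i j hij x y => by
      rw [ModuleCat.comp_apply, ModuleCat.comp_apply,
        d_tmul V W i j k hij (by lia) (by lia), map_add, h i j k hij (by lia) (by lia),
        Units.smul_def, Units.smul_def, map_zsmul]
  exact ConcreteCategory.congr_hom this t

/-- Constructor for chain maps out of a tensor product. -/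
noncomputable def mkHomTensor (f : ∀ k, (V ⊗ W : Ch R).X k ⟶ Z.X k)
    (h : ∀ (i j k : ℤ) (hij : i + j = k) (h₁ : (i - 1) + j = k - 1) (h₂ : i + (j - 1) = k - 1)
      (x : V.X i) (y : W.X j), Z.d k (k - 1) (f k (tmul V W i j k hij x y)) =
        f (k - 1) (tmul V W (i - 1) j (k - 1) h₁ (V.d i (i - 1) x) y) +
          i.negOnePow • f (k - 1) (tmul V W i (j - 1) (k - 1) h₂ x (W.d j (j - 1) y))) :
    V ⊗ W ⟶ Z :=
  mkHom f (mkHom_tensor_comm f h)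

end Ch

/-- Passes between the sign as a scalar of `R` and the sign as an integer unit. -/
theorem koszul_smul {M : Type*} [AddCommGroup M] [Module R M] (i j : ℤ) (x : M) :
    ((koszul R).ε i j : R) • x = (i * j).negOnePow • x := by
  rw [Units.smul_def]
  exact Int.cast_smul_eq_zsmul R _ x

end ChainTensor

/-! ### Chain complexes form a symmetric monoidal closed category -/

section ChainSymmetric

variable {R : Type u} [CommRing R]

namespace Ch

variable (U V W : Ch R)

/-- The degreewise maps `v ⊗ w ↦ (-1)^{ij} w ⊗ v`. -/
noncomputable def braidingX (k : ℤ) : (V ⊗ W : Ch R).X k ⟶ (W ⊗ V : Ch R).X k :=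
  (koszul R).braidingHom V.X W.X k

theorem braidingX_tmul (i j k : ℤ) (h : i + j = k) (h' : j + i = k) (x : V.X i) (y : W.X j) :
    braidingX V W k (tmul V W i j k h x y) = (i * j).negOnePow • tmul W V j i k h' y x :=
  ((koszul R).braidingHom_tmul V.X W.X i j k h h' x y).trans (koszul_smul i j _)

/-- The braiding morphism `v ⊗ w ↦ (-1)^{ij} w ⊗ v`. -/
noncomputable def braidingHom : V ⊗ W ⟶ W ⊗ V :=
  mkHomTensor (braidingX V W) fun i j k h h₁ h₂ x y => by
    rw [braidingX_tmul V W i j k h (by lia), braidingX_tmul V W _ _ _ _ (by lia),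
      braidingX_tmul V W _ _ _ _ (by lia), Units.smul_def, Units.smul_def, Units.smul_def,
      map_zsmul,
      d_tmul W V j i k _ (by lia) (by lia), smul_add, add_comm, Units.smul_def, smul_smul,
      Units.smul_def, smul_smul, ← Units.val_mul, ← Units.val_mul, ← Int.negOnePow_add,
      ← Int.negOnePow_add]
    -- The terms y ⊗ dx come with exponents ij + j and (i - 1)j, which differ by 2j; the terms dy ⊗
    -- x come with ij and i + i(j - 1), which are equal.
    have e : (i * j + j).negOnePow = ((i - 1) * j).negOnePow := by
      rw [Int.negOnePow_eq_iff]
      exact ⟨j, by ring⟩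
    rw [e, mul_sub, mul_one, add_sub_cancel]

theorem braidingHom_tmul (i j k : ℤ) (h : i + j = k) (h' : j + i = k) (x : V.X i) (y : W.X j) :
    (braidingHom V W).f k (tmul V W i j k h x y) =
      (i * j).negOnePow • tmul W V j i k h' y x :=
  braidingX_tmul V W i j k h h' x y

theorem braidingHom_comp : braidingHom V W ≫ braidingHom W V = 𝟙 (V ⊗ W) :=
  HomologicalComplex.hom_ext _ _ fun k => congrFun ((koszul R).braidingHom_comp V.X W.X) k

variable (R) in
/-- The symmetric structure on chain complexes, with the Koszul signs. -/
noncomputable abbrev symmetricCategory : SymmetricCategory (Ch R) where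
  braiding V W :=
    { hom := braidingHom V W
      inv := braidingHom W V
      hom_inv_id := braidingHom_comp V W
      inv_hom_id := braidingHom_comp W V }
  -- Naturality and coherence are equations in each degree, where they are the graded ones.
  braiding_naturality_left {X Y} f Z := HomologicalComplex.hom_ext _ _ fun k =>
    congrFun ((koszul R).braidingHom_naturality_left (X := X.X) (Y := Y.X) f.f Z.X) k
  braiding_naturality_right X Y Z f := HomologicalComplex.hom_ext _ _ fun k =>
    congrFun ((koszul R).braidingHom_naturality_right X.X (Y := Y.X) (Z := Z.X) f.f) k
  hexagon_forward X Y Z := HomologicalComplex.hom_ext _ _ fun k =>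
    congrFun ((koszul R).hexagon_forward X.X Y.X Z.X) k
  hexagon_reverse X Y Z := HomologicalComplex.hom_ext _ _ fun k =>
    congrFun ((koszul R).hexagon_reverse X.X Y.X Z.X) k
  symmetry := braidingHom_comp

variable {V W}

/-- The components of a homogeneous linear map between complexes. -/
noncomputable def homApp (i k j : ℤ) (h : i + k = j) :
    Gr.ihom (Γ := ℤ) (R := R) V.X W.X k →ₗ[R] V.X i →ₗ[R] W.X j :=
  Gr.ihomApp (Γ := ℤ) (V := V.X) (W := W.X) i k j h

theorem homApp_ext {k : ℤ} {f g : Gr.ihom (Γ := ℤ) (R := R) V.X W.X k}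
    (h : ∀ (i j : ℤ) (hij : i + k = j) (x : V.X i), homApp i k j hij f x = homApp i k j hij g x) :
    f = g :=
  Gr.ihom_ext (Γ := ℤ) (V := V.X) (W := W.X) h

/-- The differential on the complex of homogeneous linear maps. -/
noncomputable def ihomD (k l : ℤ) (h : l + 1 = k) :
    Gr.ihom (Γ := ℤ) (R := R) V.X W.X k →ₗ[R] Gr.ihom (Γ := ℤ) (R := R) V.X W.X l :=
  -- The sign (-1)^i, written `ε i 1` to be a scalar of `R`, is forced by asking that x ⊗ f ↦ f x be
  -- a chain map: d(f x) = f(dx) + (-1)^i (df)(x).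
  Gr.ihomMkₗ (Γ := ℤ) (V := V.X) (W := W.X) l fun i j hij => ((koszul R).ε i 1 : R) •
    ((homApp (V := V) (W := W) i k (j + 1) (by lia)).compr₂ (W.d (j + 1) j).hom -
      (homApp (i - 1) k j (by lia)).compl₂ (V.d i (i - 1)).hom)

theorem homApp_ihomD (k l : ℤ) (h : l + 1 = k) (i j : ℤ) (hij : i + l = j)
    (h₁ : i + k = j + 1) (h₂ : i - 1 + k = j) (f : Gr.ihom (Γ := ℤ) (R := R) V.X W.X k)
    (x : V.X i) :
    homApp (V := V) (W := W) i l j hij (ihomD k l h f) x =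
      i.negOnePow • (W.d (j + 1) j (homApp i k (j + 1) h₁ f x) -
        homApp (i - 1) k j h₂ f (V.d i (i - 1) x)) := by
  have := koszul_smul (R := R) i 1 (W.d (j + 1) j (homApp i k (j + 1) h₁ f x) -
        homApp (i - 1) k j h₂ f (V.d i (i - 1) x))
  rw [mul_one] at this
  rw [← this]
  exact LinearMap.congr_fun (Gr.ihomApp_ihomMkₗ (Γ := ℤ) (V := V.X) (W := W.X) l _ i j hij f) x

theorem ihomD_comp (k l m : ℤ) (h : l + 1 = k) (h' : m + 1 = l)
    (f : Gr.ihom (Γ := ℤ) (R := R) V.X W.X k) :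
    ihomD (V := V) (W := W) l m h' (ihomD k l h f) = 0 := by
  refine homApp_ext fun i j hij x => ?_
  rw [homApp_ihomD l m h' i j hij (by lia) (by lia),
    homApp_ihomD k l h i (j + 1) (by lia) (by lia) (by lia),
    homApp_ihomD k l h (i - 1) j (by lia) (by lia) (by lia), d_d, map_zero, sub_zero]
  -- Two terms d(f(dx)) remain, and they cancel because (-1)^(i-1) = -(-1)^i.
  simp only [Units.smul_def, map_zsmul, map_sub, d_d, zero_sub, map_zero, smul_neg,
    Int.negOnePow_sub, Int.negOnePow_one]
  simp

variable (V W) in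
/-- The differentials of the complex of homogeneous linear maps. -/
noncomputable def ihomδ (k l : ℤ) :
    Gr.ihom (Γ := ℤ) (R := R) V.X W.X k ⟶ Gr.ihom (Γ := ℤ) (R := R) V.X W.X l :=
  if h : l + 1 = k then ModuleCat.ofHom (ihomD (V := V) (W := W) k l h) else 0

theorem ihomδ_apply (k l : ℤ) (h : l + 1 = k) (f : Gr.ihom (Γ := ℤ) (R := R) V.X W.X k) :
    ihomδ V W k l f = ihomD (V := V) (W := W) k l h f :=
  ConcreteCategory.congr_hom (dif_pos h) f

theorem ihomδ_ihomδ (k l m : ℤ) (h : l + 1 = k) (h' : m + 1 = l)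
    (f : Gr.ihom (Γ := ℤ) (R := R) V.X W.X k) : ihomδ V W l m (ihomδ V W k l f) = 0 := by
  rw [ihomδ_apply l m h', ihomδ_apply k l h, ihomD_comp]

variable (V W) in
/-- The chain complex of homogeneous linear maps. -/
noncomputable def ihom : Ch R where
  X := Gr.ihom (Γ := ℤ) (R := R) V.X W.X
  d := ihomδ V W
  shape _ _ h := dif_neg h
  d_comp_d' k l m h h' := ModuleCat.hom_ext (LinearMap.ext (ihomδ_ihomδ k l m h h'))

/-- The components of an element of the complex of homogeneous linear maps. -/
noncomputable def ihomApp (i k j : ℤ) (h : i + k = j) :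
    (ihom V W).X k →ₗ[R] V.X i →ₗ[R] W.X j :=
  homApp i k j h

theorem ihom_ext {k : ℤ} {f g : (ihom V W).X k}
    (h : ∀ (i j : ℤ) (hij : i + k = j) (x : V.X i), ihomApp i k j hij f x = ihomApp i k j hij g x) :
    f = g :=
  homApp_ext h

theorem ihomApp_d (k l : ℤ) (h : l + 1 = k) (i j j' : ℤ) (hj : j + 1 = j') (hij : i + l = j)
    (h₁ : i + k = j') (h₂ : i - 1 + k = j) (f : (ihom V W).X k) (x : V.X i) :
    ihomApp i l j hij ((ihom V W).d k l f) x =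
      i.negOnePow • (W.d j' j (ihomApp i k j' h₁ f x) -
        ihomApp (i - 1) k j h₂ f (V.d i (i - 1) x)) := by
  subst hj
  exact (congrArg (fun f => homApp (V := V) (W := W) i l j hij f x) (ihomδ_apply k l h f)).trans
    (homApp_ihomD k l h i j hij h₁ h₂ f x)

variable (V W) in
/-- The degreewise evaluation `x ⊗ f ↦ f x`. -/
noncomputable def ihomEvX (k : ℤ) : (V ⊗ ihom V W : Ch R).X k ⟶ W.X k :=
  Gr.ihomEv (Γ := ℤ) (R := R) V.X W.X k

theorem ihomEvX_tmul (i k j : ℤ) (h : i + k = j) (x : V.X i) (f : (ihom V W).X k) :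
    ihomEvX V W j (tmul V (ihom V W) i k j h x f) = ihomApp i k j h f x :=
  Gr.ihomEv_tmul (Γ := ℤ) (V := V.X) (W := W.X) i k j h x f

variable (V W) in
/-- The evaluation `x ⊗ f ↦ f x`. -/
noncomputable def ihomEv : V ⊗ ihom V W ⟶ W :=
  mkHomTensor (ihomEvX V W) fun i k j h h₁ h₂ x f => by
    rw [ihomEvX_tmul, ihomEvX_tmul, ihomEvX_tmul,
      ihomApp_d k (k - 1) (by lia) i (j - 1) j (by lia) h₂ h h₁, smul_smul, Int.units_mul_self,
      one_smul, add_sub_cancel]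

/-- Currying of morphisms out of a tensor product. -/
noncomputable def ihomCurryX {B : Ch R} (f : V ⊗ B ⟶ W) (k : ℤ) : B.X k ⟶ (ihom V W).X k :=
  Gr.ihomCurry (Γ := ℤ) (R := R) (V := V.X) (W := W.X) (B := B.X) f.f k

theorem ihomApp_ihomCurryX {B : Ch R} (f : V ⊗ B ⟶ W) (i k j : ℤ) (h : i + k = j) (x : V.X i)
    (y : B.X k) : ihomApp i k j h (ihomCurryX f k y) x = f.f j (tmul V B i k j h x y) :=
  Gr.ihomApp_ihomCurry (Γ := ℤ) (V := V.X) (W := W.X) (B := B.X) f.f i k j h x y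

/-- Currying of chain maps out of a tensor product. -/
noncomputable def ihomCurry {B : Ch R} (f : V ⊗ B ⟶ W) : B ⟶ ihom V W :=
  mkHom (ihomCurryX f) fun k y => ihom_ext fun i j hij x => by
    obtain ⟨l, rfl⟩ : ∃ l, j = l - 1 := ⟨j + 1, by lia⟩
    -- Compatibility of `f` with differentials on x ⊗ y, solved for the term x ⊗ dy, is the formula
    -- for the differential of the curried map.
    have := map_d f l (l - 1) (tmul V B i k l (by lia) x y)
    rw [d_tmul V B i k l (by lia) (by lia) hij, map_add, Units.smul_def, map_zsmul,
      ← Units.smul_def, ← sub_eq_iff_eq_add'] at this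
    rw [ihomApp_d k (k - 1) (by lia) i (l - 1) l (by lia) hij (by lia) (by lia),
      ihomApp_ihomCurryX, ihomApp_ihomCurryX, ihomApp_ihomCurryX, this, smul_smul,
      Int.units_mul_self, one_smul]

theorem whiskerLeft_ihomEv_tmul {B : Ch R} (g : B ⟶ ihom V W) (i k j : ℤ) (h : i + k = j)
    (x : V.X i) (y : B.X k) :
    (V ◁ g ≫ ihomEv V W).f j (tmul V B i k j h x y) = ihomApp i k j h (g.f k y) x := by
  rw [HomologicalComplex.comp_f, ModuleCat.comp_apply, whiskerLeft_tmul]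
  exact ihomEvX_tmul i k j h x _

theorem whiskerLeft_ihomCurry_ihomEv {B : Ch R} (f : V ⊗ B ⟶ W) :
    V ◁ ihomCurry f ≫ ihomEv V W = f :=
  hom_ext_tmul fun i k j h x y => by
    rw [whiskerLeft_ihomEv_tmul]
    exact ihomApp_ihomCurryX f i k j h x y

theorem eq_of_whiskerLeft_ihomEv {B : Ch R} {g g' : B ⟶ ihom V W}
    (h : V ◁ g ≫ ihomEv V W = V ◁ g' ≫ ihomEv V W) : g = g' :=
  HomologicalComplex.hom_ext _ _ fun k => ModuleCat.hom_ext (LinearMap.ext fun y =>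
    ihom_ext fun i j hij x => by
      have := whiskerLeft_ihomEv_tmul g i k j hij x y
      rw [h, whiskerLeft_ihomEv_tmul] at this
      exact this.symm)

theorem nonempty_monoidalClosed : Nonempty (MonoidalClosed (Ch R)) :=
  InternalLie.nonempty_monoidalClosed fun V W => ⟨ihom V W, ihomEv V W, fun _ f =>
    ⟨ihomCurry f, whiskerLeft_ihomCurry_ihomEv f, fun _ hg =>
      eq_of_whiskerLeft_ihomEv (hg.trans (whiskerLeft_ihomCurry_ihomEv f).symm)⟩⟩

end Ch
end ChainSymmetric
end InternalLie

namespace InternalLie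

/-! ### Internal Lie algebras in chain complexes -/

section ChainLie

variable {R : Type u} [CommRing R]

theorem isColourSkew_koszul_iff {V : Gr ℤ R}
    (b : ∀ i j k : ℤ, i + j = k → (V i →ₗ[R] V j →ₗ[R] V k)) :
    IsColourSkew (koszul R) b ↔
      ∀ (i j k : ℤ) (h : i + j = k) (h' : j + i = k) (x : V i) (y : V j),
        b i j k h x y = -((i * j).negOnePow • b j i k h' y x) := by
  simp only [IsColourSkew, koszul_smul]

theorem isColourJacobi_koszul_iff {V : Gr ℤ R}
    (b : ∀ i j k : ℤ, i + j = k → (V i →ₗ[R] V j →ₗ[R] V k)) :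
    IsColourJacobi (koszul R) b ↔
      ∀ (i j l ij jl li n : ℤ) (hij : i + j = ij) (hjl : j + l = jl) (hli : l + i = li)
        (h₁ : i + jl = n) (h₂ : j + li = n) (h₃ : l + ij = n) (x : V i) (y : V j) (z : V l),
        (i * l).negOnePow • b i jl n h₁ x (b j l jl hjl y z) +
          (j * i).negOnePow • b j li n h₂ y (b l i li hli z x) +
          (l * j).negOnePow • b l ij n h₃ z (b i j ij hij x y) = 0 := by
  simp only [IsColourJacobi, koszul_smul]
  refine forall₃_congr fun i j l => ?_
  rw [mul_comm l i, mul_comm i j, mul_comm j l]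

namespace Ch

/-- The bilinear maps given by a morphism out of a tensor product. -/
noncomputable def bilin {V W Z : Ch R} (f : V ⊗ W ⟶ Z) (i j k : ℤ) (h : i + j = k) :
    V.X i →ₗ[R] W.X j →ₗ[R] Z.X k :=
  (tmulₗ V W i j k h).compr₂ (f.f k).hom

theorem bilin_apply {V W Z : Ch R} (f : V ⊗ W ⟶ Z) (i j k : ℤ) (h : i + j = k) (x : V.X i)
    (y : W.X j) : bilin f i j k h x y = f.f k (tmul V W i j k h x y) := rfl

variable {V : Ch R} (b : V ⊗ V ⟶ V)

/-- Equality of chain maps is equality in each degree, so the graded equivalence applies; the same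
holds for the Jacobi identity below. -/
theorem isColourSkew_bilin_iff :
    letI := symmetricCategory R
    IsColourSkew (V := V.X) (koszul R) (bilin b) ↔ (𝟙 (V ⊗ V) + (β_ V V).hom) ≫ b = 0 := by
  let _ := symmetricCategory R
  refine (InternalLie.isColourSkew_bilin_iff (V := V.X) (koszul R) b.f).trans ?_
  exact ⟨fun h => HomologicalComplex.hom_ext _ _ (congrFun h), congrArg HomologicalComplex.Hom.f⟩

theorem isColourJacobi_bilin_iff :
    letI := symmetricCategory R
    IsColourJacobi (V := V.X) (koszul R) (bilin b) ↔
      (𝟙 (V ⊗ (V ⊗ V)) + cyc V + cyc V ≫ cyc V) ≫ (V ◁ b) ≫ b = 0 := by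
  let _ := symmetricCategory R
  refine (InternalLie.isColourJacobi_bilin_iff (V := V.X) (koszul R) b.f).trans ?_
  exact ⟨fun h => HomologicalComplex.hom_ext _ _ (congrFun h), congrArg HomologicalComplex.Hom.f⟩

theorem bilin_d (i j k : ℤ) (h : i + j = k) (h₁ : (i - 1) + j = k - 1)
    (h₂ : i + (j - 1) = k - 1) (x : V.X i) (y : V.X j) :
    V.d k (k - 1) (bilin b i j k h x y) =
      bilin b (i - 1) j (k - 1) h₁ (V.d i (i - 1) x) y +
        i.negOnePow • bilin b i (j - 1) (k - 1) h₂ x (V.d j (j - 1) y) := by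
  rw [bilin_apply, map_d, d_tmul V V i j k h h₁ h₂, map_add, Units.smul_def, map_zsmul,
    ← Units.smul_def]
  rfl

/-- The morphism out of a tensor product given by bilinear maps satisfying the Leibniz rule. -/
noncomputable def ofBilin {V W Z : Ch R}
    (b : ∀ i j k : ℤ, i + j = k → (V.X i →ₗ[R] W.X j →ₗ[R] Z.X k))
    (hb : ∀ (i j k : ℤ) (h : i + j = k) (h₁ : (i - 1) + j = k - 1) (h₂ : i + (j - 1) = k - 1)
      (x : V.X i) (y : W.X j), Z.d k (k - 1) (b i j k h x y) =
        b (i - 1) j (k - 1) h₁ (V.d i (i - 1) x) y +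
          i.negOnePow • b i (j - 1) (k - 1) h₂ x (W.d j (j - 1) y)) : V ⊗ W ⟶ Z :=
  mkHomTensor (fun k => desc fun i j h => b i j k h) fun i j k h h₁ h₂ x y => by
    rw [desc_tmul, desc_tmul, desc_tmul]
    exact hb i j k h h₁ h₂ x y

theorem bilin_ofBilin {V W Z : Ch R}
    (b : ∀ i j k : ℤ, i + j = k → (V.X i →ₗ[R] W.X j →ₗ[R] Z.X k))
    (hb : ∀ (i j k : ℤ) (h : i + j = k) (h₁ : (i - 1) + j = k - 1) (h₂ : i + (j - 1) = k - 1)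
      (x : V.X i) (y : W.X j), Z.d k (k - 1) (b i j k h x y) =
        b (i - 1) j (k - 1) h₁ (V.d i (i - 1) x) y +
          i.negOnePow • b i (j - 1) (k - 1) h₂ x (W.d j (j - 1) y)) :
    bilin (ofBilin b hb) = b := by
  ext i j k h x y
  exact desc_tmul (fun i j h => b i j k h) i j h x y

end Ch

variable (R) in
/-- The differential graded Lie algebra given by an internal Lie algebra. -/
noncomputable def LieObj.toDG :
    letI := Ch.symmetricCategory R
    LieObj (Ch R) ⥤ DGLieAlg R :=
  letI := Ch.symmetricCategory R
  { obj := fun L =>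
      { V := L.X
        bracket := Ch.bilin L.b
        skew := (isColourSkew_koszul_iff (V := L.X.X) _).1
          ((Ch.isColourSkew_bilin_iff L.b).2 L.skew)
        jacobi := (isColourJacobi_koszul_iff (V := L.X.X) _).1
          ((Ch.isColourJacobi_bilin_iff L.b).2 L.jacobi)
        leibniz := Ch.bilin_d L.b }
    map := fun {L M} f =>
      { f := f.f
        map_bracket := fun i j k h x y =>
          (ConcreteCategory.congr_hom (HomologicalComplex.congr_hom f.map_b k)
            (Ch.tmul L.X L.X i j k h x y)).trans
            (congrArg (M.b.f k) (Ch.tensorHom_tmul f.f f.f i j k h x y)) } }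

variable (R) in
theorem LieObj.toDG_isEquivalence :
    letI := Ch.symmetricCategory R
    (LieObj.toDG R).IsEquivalence := by
  let _ := Ch.symmetricCategory R
  refine { faithful := ⟨fun h => ?_⟩, full := ⟨fun {_ M} f => ⟨⟨f.f, ?_⟩, rfl⟩⟩,
            essSurj := ⟨fun M => ?_⟩ }
  · exact LieObj.Hom.ext (congrArg DGLieAlg.Hom.f h)
  · refine Ch.hom_ext_tmul fun i j k h x y => (f.map_bracket i j k h x y).trans ?_
    exact (congrArg (M.b.f k) (Ch.tensorHom_tmul f.f f.f i j k h x y)).symm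
  · let b : M.V ⊗ M.V ⟶ M.V := Ch.ofBilin M.bracket M.leibniz
    have hb : Ch.bilin b = M.bracket := Ch.bilin_ofBilin M.bracket M.leibniz
    have h₁ := (Ch.isColourSkew_bilin_iff b).1
      (hb ▸ (isColourSkew_koszul_iff (V := M.V.X) _).2 M.skew)
    have h₂ := (Ch.isColourJacobi_bilin_iff b).1
      (hb ▸ (isColourJacobi_koszul_iff (V := M.V.X) _).2 M.jacobi)
    refine ⟨⟨M.V, b, h₁, h₂⟩, ⟨eqToIso ?_⟩⟩
    rcases M with ⟨V, br, s, t⟩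
    change DGLieAlg.mk V (Ch.bilin b) _ _ _ = _
    congr

end ChainLie

/-! ### Chain complexes with zero differential -/

section ZeroDiff

variable (R : Type u) [CommRing R]

/-- By `Ch.d_tmul` the differential of V ⊗ W kills pure tensors once those of V and W vanish; the
unit is concentrated in a single degree. -/
instance zeroDiff_isMonoidal : (zeroDiff R).IsMonoidal where
  prop_unit := fun _ _ => HomologicalComplex.single_obj_d ..
  prop_tensor V W hV hW i j := by
    by_cases h : j + 1 = i
    · obtain rfl : j = i - 1 := by lia
      refine Ch.tensor_X_hom_ext fun p q hpq x y => ?_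
      rw [Ch.d_tmul V W p q i hpq (by lia) (by lia), hV, hW, ← Ch.tmulₗ_apply, ← Ch.tmulₗ_apply]
      simp
    · exact Ch.d_eq_zero _ h

/-- The graded module underlying a complex with zero differential. -/
def zeroDiffToGraded : (zeroDiff R).FullSubcategory ⥤ Gr ℤ R :=
  (zeroDiff R).ι ⋙ HomologicalComplex.forget _ _

/-- Between complexes with zero differential every degreewise map is a chain map. Colimits and
abelianness are transported along this equivalence. -/
instance zeroDiffToGraded_isEquivalence : (zeroDiffToGraded R).IsEquivalence where
  faithful := inferInstanceAs ((zeroDiff R).ι ⋙ HomologicalComplex.forget _ _).Faithful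
  full := ⟨fun {X Y} f => ⟨ObjectProperty.homMk
    { f := f
      comm' := fun i j _ => by
        rw [X.property i j, Y.property i j]
        exact Limits.comp_zero.trans Limits.zero_comp.symm }, rfl⟩⟩
  essSurj := ⟨fun V => ⟨⟨{ X := V, d := fun _ _ => 0 }, fun _ _ => rfl⟩, ⟨Iso.refl _⟩⟩⟩

theorem zeroDiff_hasColimitsOfSize : HasColimitsOfSize.{u, u} (zeroDiff R).FullSubcategory :=
  have := graded_hasColimitsOfSize ℤ (ModuleCat.{u} R)
  Adjunction.has_colimits_of_equivalence (zeroDiffToGraded R)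

theorem zeroDiff_nonempty_abelian : Nonempty (Abelian (zeroDiff R).FullSubcategory) :=
  have := (graded_nonempty_abelian ℤ (ModuleCat.{u} R)).some
  have : HasFiniteProducts (zeroDiff R).FullSubcategory :=
    ⟨fun _ => Adjunction.hasLimitsOfShape_of_equivalence (zeroDiffToGraded R)⟩
  ⟨abelianOfEquivalence (zeroDiffToGraded R)⟩

variable {R} in
-- The subcategory is full and contains the internal homs of its objects, so it is closed with the
-- same evaluation and currying.
theorem zeroDiff_ihom {V W : Ch R} (hV : zeroDiff R V) (hW : zeroDiff R W) :
    zeroDiff R (Ch.ihom V W) := fun k l => by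
  by_cases h : l + 1 = k
  · refine ModuleCat.hom_ext (LinearMap.ext fun f => Ch.ihom_ext fun i j hij x => ?_)
    refine (Ch.ihomApp_d k l h i j _ rfl hij (by lia) (by lia) f x).trans ?_
    rw [hV, hW]
    simp
  · exact Ch.d_eq_zero _ h

theorem zeroDiff_nonempty_monoidalClosed :
    Nonempty (MonoidalClosed (zeroDiff R).FullSubcategory) :=
  nonempty_monoidalClosed fun V W =>
    ⟨⟨Ch.ihom V.obj W.obj, zeroDiff_ihom V.property W.property⟩,
      ObjectProperty.homMk (Ch.ihomEv V.obj W.obj), fun B f =>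
    ⟨ObjectProperty.homMk (Ch.ihomCurry (V := V.obj) (B := B.obj) f.hom),
      ObjectProperty.hom_ext _ (Ch.whiskerLeft_ihomCurry_ihomEv (V := V.obj) (B := B.obj) f.hom),
      fun _ hg => ObjectProperty.hom_ext _ <| Ch.eq_of_whiskerLeft_ihomEv <|
        (congrArg (·.hom) hg).trans
          (Ch.whiskerLeft_ihomCurry_ihomEv (V := V.obj) (B := B.obj) f.hom).symm⟩⟩

/-- The Lie colour algebra given by an internal Lie algebra in the complexes with zero
differential. -/
noncomputable def LieObj.zeroDiffToColour :
    letI := Ch.symmetricCategory R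
    LieObj (zeroDiff R).FullSubcategory ⥤ LieColourAlg (koszul R) :=
  letI := Ch.symmetricCategory R
  { obj := fun L =>
      { V := L.X.obj.X
        bracket := Ch.bilin (V := L.X.obj) (W := L.X.obj) L.b.hom
        skew := (Ch.isColourSkew_bilin_iff (V := L.X.obj) L.b.hom).2 (congrArg (·.hom) L.skew)
        jacobi := (Ch.isColourJacobi_bilin_iff (V := L.X.obj) L.b.hom).2
          (congrArg (·.hom) L.jacobi) }
    map := fun {L M} f =>
      { f := f.f.hom.f
        map_bracket := fun i j k h x y =>
          (ConcreteCategory.congr_hom (HomologicalComplex.congr_hom (congrArg (·.hom) f.map_b) k)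
            (Ch.tmul L.X.obj L.X.obj i j k h x y)).trans
            (congrArg (M.b.hom.f k) (Ch.tensorHom_tmul f.f.hom f.f.hom i j k h x y)) } }

theorem LieObj.zeroDiffToColour_isEquivalence :
    letI := Ch.symmetricCategory R
    (LieObj.zeroDiffToColour R).IsEquivalence := by
  let _ := Ch.symmetricCategory R
  refine { faithful := ⟨fun h => ?_⟩, full := ⟨fun {L M} f => ?_⟩,
            essSurj := ⟨fun M => ?_⟩ }
  · exact LieObj.Hom.ext (ObjectProperty.hom_ext _ (HomologicalComplex.hom_ext _ _
      (congrFun (congrArg LieColourAlg.Hom.f h))))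
  · let g : L.X.obj ⟶ M.X.obj := Ch.mkHom f.f fun k x => by
      rw [L.X.property, M.X.property]
      exact (map_zero (f.f (k - 1)).hom).symm
    refine ⟨⟨ObjectProperty.homMk g, ObjectProperty.hom_ext _
      (Ch.hom_ext_tmul fun i j k h x y => (f.map_bracket i j k h x y).trans ?_)⟩, rfl⟩
    exact (congrArg (M.b.hom.f k) (Ch.tensorHom_tmul g g i j k h x y)).symm
  · let V : Ch R := { X := M.V, d := fun _ _ => 0 }
    have hM (i j k : ℤ) (h : i + j = k) (h₁ : (i - 1) + j = k - 1) (h₂ : i + (j - 1) = k - 1)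
        (x : V.X i) (y : V.X j) : V.d k (k - 1) (M.bracket i j k h x y) =
        M.bracket (i - 1) j (k - 1) h₁ (V.d i (i - 1) x) y +
          i.negOnePow • M.bracket i (j - 1) (k - 1) h₂ x (V.d j (j - 1) y) := by
      change 0 = M.bracket _ _ _ _ 0 _ + i.negOnePow • M.bracket _ _ _ _ _ 0
      simp
    let b : V ⊗ V ⟶ V := Ch.ofBilin (V := V) (W := V) (Z := V) M.bracket hM
    have hb : Ch.bilin b = M.bracket := Ch.bilin_ofBilin (V := V) (W := V) (Z := V) M.bracket hM
    have h₁ := (Ch.isColourSkew_bilin_iff b).1 (hb ▸ M.skew)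
    have h₂ := (Ch.isColourJacobi_bilin_iff b).1 (hb ▸ M.jacobi)
    refine ⟨⟨⟨V, fun _ _ => rfl⟩, ObjectProperty.homMk b, ObjectProperty.hom_ext _ h₁,
      ObjectProperty.hom_ext _ h₂⟩, ⟨eqToIso ?_⟩⟩
    rcases M with ⟨M, br, s, t⟩
    change LieColourAlg.mk M (Ch.bilin b) _ _ = _
    congr

end ZeroDiff

/-! ### Assembly of the statements on chain complexes. -/

section ChainMain

variable (R : Type u) [CommRing R]

theorem chain_main :
    ∃ _ : SymmetricCategory (Ch R),
      (∀ (V W : Ch R) (i j k : ℤ) (h : i + j = k) (h' : j + i = k) (x : V.X i) (y : W.X j),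
        (β_ V W).hom.f k (Ch.tmul V W i j k h x y) =
          (i * j).negOnePow • Ch.tmul W V j i k h' y x) ∧
      Nonempty (MonoidalClosed (Ch R)) ∧
      HasColimitsOfSize.{u, u} (Ch R) ∧
      Nonempty (Abelian (Ch R)) ∧
      (∃ (e : LieObj (Ch R) ≌ DGLieAlg R)
          (φ : e.functor ⋙ DGLieAlg.forget R ≅ LieObj.forget (Ch R)),
        ∀ (L : LieObj (Ch R)) (i j k : ℤ) (h : i + j = k)
          (x : (e.functor.obj L).V.X i) (y : (e.functor.obj L).V.X j),
          (φ.hom.app L).f k ((e.functor.obj L).bracket i j k h x y) =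
            L.b.f k (Ch.tmul L.X L.X i j k h
              ((φ.hom.app L).f i x) ((φ.hom.app L).f j y))) ∧
      (∃ _ : (zeroDiff R).IsMonoidal,
        Nonempty (MonoidalClosed (zeroDiff R).FullSubcategory) ∧
        HasColimitsOfSize.{u, u} (zeroDiff R).FullSubcategory ∧
        Nonempty (Abelian (zeroDiff R).FullSubcategory) ∧
        ∃ (e : LieObj (zeroDiff R).FullSubcategory ≌ LieColourAlg (koszul R))
          (φ : e.functor ⋙ LieColourAlg.forget (koszul R) ≅
            LieObj.forget (zeroDiff R).FullSubcategory ⋙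
              (zeroDiff R).ι ⋙ HomologicalComplex.forget _ _),
          ∀ (L : LieObj (zeroDiff R).FullSubcategory)
            (i j k : ℤ) (h : i + j = k)
            (x : (e.functor.obj L).V i) (y : (e.functor.obj L).V j),
            φ.hom.app L k ((e.functor.obj L).bracket i j k h x y) =
              ((zeroDiff R).ι.map L.b).f k
                (Ch.tmul L.X.obj L.X.obj i j k h
                  (φ.hom.app L i x) (φ.hom.app L j y))) := by
  let _ := Ch.symmetricCategory R
  have := LieObj.toDG_isEquivalence R
  have := LieObj.zeroDiffToColour_isEquivalence R
  exact ⟨Ch.symmetricCategory R, Ch.braidingHom_tmul, Ch.nonempty_monoidalClosed, inferInstance,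
    ⟨inferInstance⟩,
    ⟨(LieObj.toDG R).asEquivalence, Iso.refl _, fun _ _ _ _ _ _ _ => rfl⟩,
    zeroDiff_isMonoidal R, zeroDiff_nonempty_monoidalClosed R, zeroDiff_hasColimitsOfSize R,
    zeroDiff_nonempty_abelian R,
    (LieObj.zeroDiffToColour R).asEquivalence, Iso.refl _, fun _ _ _ _ _ _ _ => rfl⟩

end ChainMain

end InternalLie

namespace InternalLie

/-! ### Graded Lie algebras with operators -/

section Operators

variable {Γ : Type w} [AddCommGroup Γ] {R : Type u} [CommRing R]

namespace CommutationFactor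

variable (c : CommutationFactor Γ R)

/-- The commutation factor with values in the ring. -/
def e (i j : Γ) : R := c.ε i j

theorem e_left {i j k : Γ} (h : i + j = k) (l : Γ) : c.e k l = c.e i l * c.e j l := by
  rw [e, ← h, c.add_left, Units.val_mul]
  rfl

theorem e_right (l : Γ) {i j k : Γ} (h : i + j = k) : c.e l k = c.e l i * c.e l j := by
  rw [e, ← h, c.add_right, Units.val_mul]
  rfl

theorem e_mul_e (i j : Γ) : c.e i j * c.e j i = 1 := c.mul_swap i j

end CommutationFactor

/-- Graded Lie algebras with commutation factor `c`, with the Jacobi identity in Leibniz form. -/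
structure GLie (c : CommutationFactor Γ R) where
  V : Γ → Type u
  [addCommGroup (i : Γ) : AddCommGroup (V i)]
  [module (i : Γ) : Module R (V i)]
  br (i j k : Γ) (h : i + j = k) : V i →ₗ[R] V j →ₗ[R] V k
  skew (i j k : Γ) (h : i + j = k) (h' : j + i = k) (x : V i) (y : V j) :
    br i j k h x y = -(c.e i j • br j i k h' y x)
  -- In this form bracketing with `x` is a derivation, as the operators are; elements and operators
  -- can then be handled together as letters.
  jac (i j l ij jl il n : Γ) (hij : i + j = ij) (hjl : j + l = jl) (hil : i + l = il)
    (h₁ : i + jl = n) (h₂ : ij + l = n) (h₃ : j + il = n) (x : V i) (y : V j) (z : V l) :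
    br i jl n h₁ x (br j l jl hjl y z) =
      br ij l n h₂ (br i j ij hij x y) z + c.e i j • br j il n h₃ y (br i l il hil x z)

attribute [instance] GLie.addCommGroup GLie.module

variable {Ω : Type}

/-- Graded Lie algebras with operators of square zero acting by derivations. -/
structure OpLie (c : CommutationFactor Γ R) (δ : Ω → Γ) extends GLie c where
  op (ω : Ω) (i k : Γ) (h : δ ω + i = k) : V i →ₗ[R] V k
  op_br (ω : Ω) (i j k i' j' m : Γ) (h : i + j = k) (hk : δ ω + k = m) (hi : δ ω + i = i')
    (hj : δ ω + j = j') (h₁ : i' + j = m) (h₂ : i + j' = m) (x : V i) (y : V j) :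
    op ω k m hk (br i j k h x y) =
      br i' j m h₁ (op ω i i' hi x) y + c.e (δ ω) i • br i j' m h₂ x (op ω j j' hj y)
  op_op (ω : Ω) (i j k : Γ) (hi : δ ω + i = j) (hj : δ ω + j = k) (x : V i) :
    op ω j k hj (op ω i j hi x) = 0

variable {c : CommutationFactor Γ R} {δ : Ω → Γ}

/-- Morphisms of graded Lie algebras with operators. -/
@[ext]
structure OpLie.Hom (L M : OpLie c δ) where
  f (i : Γ) : L.V i →ₗ[R] M.V i
  map_br (i j k : Γ) (h : i + j = k) (x : L.V i) (y : L.V j) :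
    f k (L.br i j k h x y) = M.br i j k h (f i x) (f j y)
  map_op (ω : Ω) (i k : Γ) (h : δ ω + i = k) (x : L.V i) :
    f k (L.op ω i k h x) = M.op ω i k h (f i x)

instance OpLie.category : Category (OpLie c δ) where
  Hom L M := OpLie.Hom L M
  id _ := ⟨fun _ => LinearMap.id, fun _ _ _ _ _ _ => rfl, fun _ _ _ _ _ => rfl⟩
  comp f g := ⟨fun i => g.f i ∘ₗ f.f i,
    fun i j k h x y => (congrArg (g.f k) (f.map_br i j k h x y)).trans (g.map_br ..),
    fun ω i k h x => (congrArg (g.f k) (f.map_op ω i k h x)).trans (g.map_op ..)⟩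
  id_comp _ := rfl
  comp_id _ := rfl
  assoc _ _ _ := rfl

namespace OpLie

@[simp]
theorem id_f (L : OpLie c δ) (i : Γ) (x : L.V i) : Hom.f (𝟙 L) i x = x := rfl

@[simp]
theorem comp_f {L M N : OpLie c δ} (f : L ⟶ M) (g : M ⟶ N) (i : Γ) (x : L.V i) :
    Hom.f (f ≫ g) i x = g.f i (f.f i x) := rfl

theorem hom_ext {L M : OpLie c δ} {f g : L ⟶ M} (h : ∀ i (x : L.V i), f.f i x = g.f i x) :
    f = g :=
  Hom.ext (funext fun i => LinearMap.ext (h i))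

theorem hom_br {L M : OpLie c δ} (f : L ⟶ M) (i j k : Γ) (h : i + j = k) (x : L.V i)
    (y : L.V j) : f.f k (L.br i j k h x y) = M.br i j k h (f.f i x) (f.f j y) :=
  Hom.map_br f i j k h x y

theorem hom_op {L M : OpLie c δ} (f : L ⟶ M) (ω : Ω) (i k : Γ) (h : δ ω + i = k) (x : L.V i) :
    f.f k (L.op ω i k h x) = M.op ω i k h (f.f i x) :=
  Hom.map_op f ω i k h x

variable (L : OpLie c δ)

/-- The homogeneous elements and the operators, which all act by derivations. -/
def Letter : Type max u w := (Σ i, L.V i) ⊕ Ω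

variable {L}

/-- The letter given by a homogeneous element. -/
def elt {i : Γ} (b : L.V i) : L.Letter := Sum.inl ⟨i, b⟩

variable (L) in
/-- The letter given by an operator. -/
def opr (ω : Ω) : L.Letter := Sum.inr ω

/-- The degree of a letter. -/
def Letter.dg : L.Letter → Γ := Sum.elim Sigma.fst δ

variable (L) in
theorem dg_opr (ω : Ω) : (L.opr ω).dg = δ ω := rfl

/-- The action of letters. -/
def act (a : L.Letter) (i k : Γ) (h : a.dg + i = k) : L.V i →ₗ[R] L.V k :=
  match a, h with
  | Sum.inl ⟨j, b⟩, h => L.br j i k h b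
  | Sum.inr ω, h => L.op ω i k h

/-- The Jacobi identity and the derivation rule for operators become a single statement about
letters. -/
theorem act_br (a : L.Letter) (i j k i' j' m : Γ) (h : i + j = k) (hk : a.dg + k = m)
    (hi : a.dg + i = i') (hj : a.dg + j = j') (h₁ : i' + j = m) (h₂ : i + j' = m) (x : L.V i)
    (y : L.V j) :
    act a k m hk (L.br i j k h x y) =
      L.br i' j m h₁ (act a i i' hi x) y + c.e a.dg i • L.br i j' m h₂ x (act a j j' hj y) := by
  rcases a with ⟨l, b⟩ | ω
  · exact L.jac l i j i' k j' m hi h hj hk h₁ h₂ b x y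
  · exact L.op_br ω i j k i' j' m h hk hi hj h₁ h₂ x y

variable {M : OpLie c δ} (f : L ⟶ M)

/-- The action of morphisms on letters. -/
def Letter.map : L.Letter → M.Letter := Sum.map (Sigma.map id fun i => f.f i) id

theorem Letter.dg_map (a : L.Letter) : (a.map f).dg = a.dg := by
  rcases a with ⟨l, b⟩ | ω <;> rfl

theorem hom_act (a : L.Letter) (i k : Γ) (h : a.dg + i = k) (x : L.V i) :
    f.f k (act a i k h x) = act (a.map f) i k ((congrArg (· + i) (a.dg_map f)).trans h) (f.f i x) := by
  rcases a with ⟨l, b⟩ | ω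
  · exact hom_br f l i k h b x
  · exact hom_op f ω i k h x

end OpLie

/-- Graded Lie algebras on which a Lie algebra with operators acts by derivations. -/
structure LieAction (B : OpLie c δ) extends GLie c where
  act (a : B.Letter) (i k : Γ) (h : a.dg + i = k) : V i →ₗ[R] V k
  act_br (a : B.Letter) (i j k i' j' m : Γ) (h : i + j = k) (hk : a.dg + k = m)
    (hi : a.dg + i = i') (hj : a.dg + j = j') (h₁ : i' + j = m) (h₂ : i + j' = m) (x : V i)
    (y : V j) : act a k m hk (br i j k h x y) =
      br i' j m h₁ (act a i i' hi x) y + c.e a.dg i • br i j' m h₂ x (act a j j' hj y)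
  act_add (l i k : Γ) (h : l + i = k) (b b' : B.V l) (x : V i) :
    act (OpLie.elt (b + b')) i k h x = act (OpLie.elt b) i k h x + act (OpLie.elt b') i k h x
  act_smul (l i k : Γ) (h : l + i = k) (r : R) (b : B.V l) (x : V i) :
    act (OpLie.elt (r • b)) i k h x = r • act (OpLie.elt b) i k h x
  act_act (a : B.Letter) (l m i ai li k : Γ) (hm : a.dg + l = m) (hk : m + i = k)
    (hai : a.dg + i = ai) (hli : l + i = li) (h₁ : a.dg + li = k) (h₂ : l + ai = k)
    (b : B.V l) (x : V i) : act (OpLie.elt (OpLie.act a l m hm b)) i k hk x =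
      act a li k h₁ (act (OpLie.elt b) i li hli x) -
        c.e a.dg l • act (OpLie.elt b) ai k h₂ (act a i ai hai x)
  op_op (ω : Ω) (i j k : Γ) (hi : δ ω + i = j) (hj : δ ω + j = k) (x : V i) :
    act (B.opr ω) j k hj (act (B.opr ω) i j hi x) = 0

/-! ### Semidirect products -/

namespace LieAction

variable {B : OpLie c δ} (G : LieAction B)

/-- The action of elements of `B`, as a bilinear map. -/
def actₗ (i j k : Γ) (h : i + j = k) : B.V i →ₗ[R] G.V j →ₗ[R] G.V k :=
  LinearMap.mk₂ R (fun b x => G.act (OpLie.elt b) j k h x)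
    (fun _ _ _ => G.act_add ..) (fun _ _ _ => G.act_smul ..)
    (fun _ _ _ => map_add _ _ _) (fun _ _ _ => map_smul _ _ _)

/-- The bracket of the semidirect product. -/
def sdBr (i j k : Γ) (h : i + j = k) :
    (B.V i × G.V i) →ₗ[R] (B.V j × G.V j) →ₗ[R] (B.V k × G.V k) :=
  LinearMap.mk₂ R (fun x y => (B.br i j k h x.1 y.1, G.actₗ i j k h x.1 y.2 -
      c.e i j • G.actₗ j i k ((add_comm j i).trans h) y.1 x.2 + G.br i j k h x.2 y.2))
    (fun _ _ _ => Prod.ext (by simp) (by simp; abel))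
    (fun _ _ _ => Prod.ext (by simp) (by simp [smul_sub, smul_comm (c.e i j)]))
    (fun _ _ _ => Prod.ext (by simp) (by simp; abel))
    (fun _ _ _ => Prod.ext (by simp) (by simp [smul_sub, smul_comm (c.e i j)]))

theorem sdBr_fst (i j k : Γ) (h : i + j = k) (x : B.V i × G.V i) (y : B.V j × G.V j) :
    (G.sdBr i j k h x y).1 = B.br i j k h x.1 y.1 := rfl

theorem sdBr_snd (i j k : Γ) (h : i + j = k) (h' : j + i = k) (x : B.V i × G.V i)
    (y : B.V j × G.V j) :
    (G.sdBr i j k h x y).2 = G.actₗ i j k h x.1 y.2 - c.e i j • G.actₗ j i k h' y.1 x.2 +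
      G.br i j k h x.2 y.2 := rfl

theorem actₗ_br (i j k l li lj m : Γ) (h : i + j = k) (hk : l + k = m)
    (hi : l + i = li) (hj : l + j = lj) (h₁ : li + j = m) (h₂ : i + lj = m) (b : B.V l) (x : G.V i)
    (y : G.V j) : G.actₗ l k m hk b (G.br i j k h x y) =
      G.br li j m h₁ (G.actₗ l i li hi b x) y + c.e l i • G.br i lj m h₂ x (G.actₗ l j lj hj b y) :=
  G.act_br (OpLie.elt b) i j k li lj m h hk hi hj h₁ h₂ x y

/-- The case of `act_act` in which the letter is an element of `B`; operators are treated in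
`act_opr_actₗ`. -/
theorem actₗ_actₗ (i j l ij jl il n : Γ) (hij : i + j = ij) (hjl : j + l = jl) (hil : i + l = il)
    (h₁ : i + jl = n) (h₂ : ij + l = n) (h₃ : j + il = n) (a : B.V i) (b : B.V j) (x : G.V l) :
    G.actₗ i jl n h₁ a (G.actₗ j l jl hjl b x) = G.actₗ ij l n h₂ (B.br i j ij hij a b) x +
      c.e i j • G.actₗ j il n h₃ b (G.actₗ i l il hil a x) :=
  eq_add_of_sub_eq (G.act_act (OpLie.elt a) j ij l il jl n hij h₂ hil hjl h₁ h₃ b x).symm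

theorem sd_skew (i j k : Γ) (h : i + j = k) (h' : j + i = k) (x : B.V i × G.V i)
    (y : B.V j × G.V j) : G.sdBr i j k h x y = -(c.e i j • G.sdBr j i k h' y x) := by
  refine Prod.ext (B.skew i j k h h' _ _) ?_
  rw [Prod.snd_neg, Prod.smul_snd, sdBr_snd G i j k h h', sdBr_snd G j i k h' h,
    G.skew i j k h h' x.2 y.2, smul_add, smul_sub, smul_smul, c.e_mul_e]
  module

/-- In the second component everything is expanded by trilinearity. Terms with two entries from `B`
are handled by `actₗ_actₗ`, those with one by `actₗ_br`, and the term with none by the Jacobi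
identity of `G`. -/
theorem sd_jac (i j l ij jl il n : Γ) (hij : i + j = ij) (hjl : j + l = jl) (hil : i + l = il)
    (h₁ : i + jl = n) (h₂ : ij + l = n) (h₃ : j + il = n) (x : B.V i × G.V i)
    (y : B.V j × G.V j) (z : B.V l × G.V l) :
    G.sdBr i jl n h₁ x (G.sdBr j l jl hjl y z) = G.sdBr ij l n h₂ (G.sdBr i j ij hij x y) z +
      c.e i j • G.sdBr j il n h₃ y (G.sdBr i l il hil x z) := by
  refine Prod.ext (B.jac i j l ij jl il n hij hjl hil h₁ h₂ h₃ _ _ _) ?_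
  have hji : j + i = ij := (add_comm j i).trans hij
  have hlj : l + j = jl := (add_comm l j).trans hjl
  have hli : l + i = il := (add_comm l i).trans hil
  have h₁' : jl + i = n := (add_comm jl i).trans h₁
  have h₂' : l + ij = n := (add_comm l ij).trans h₂
  have h₃' : il + j = n := (add_comm il j).trans h₃
  obtain ⟨a, f⟩ := x
  obtain ⟨a', f'⟩ := y
  obtain ⟨a'', f''⟩ := z
  rw [Prod.snd_add, Prod.smul_snd, sdBr_snd G i jl n h₁ h₁', sdBr_snd G j l jl hjl hlj,
    sdBr_snd G ij l n h₂ h₂', sdBr_snd G i j ij hij hji, sdBr_snd G j il n h₃ h₃',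
    sdBr_snd G i l il hil hli]
  simp only [sdBr_fst, map_add, map_sub, map_smul, LinearMap.add_apply, LinearMap.sub_apply,
    LinearMap.smul_apply]
  rw [G.actₗ_actₗ i j l ij jl il n hij hjl hil h₁ h₂ h₃ a a' f'',
    G.actₗ_actₗ i l j il jl ij n hil hlj hij h₁ h₃' h₂' a a'' f',
    G.actₗ_actₗ j l i jl il ij n hjl hli hji h₃ h₁' h₂' a' a'' f,
    G.actₗ_br j l jl i ij il n hjl h₁ hij hil h₂ h₃ a f' f'',
    G.actₗ_br i l il j ij jl n hil h₃ hji hjl h₂ h₁ a' f f'',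
    G.actₗ_br i j ij l il jl n hij h₂' hli hlj h₃' h₁ a'' f f',
    G.jac i j l ij jl il n hij hjl hil h₁ h₂ h₃ f f' f'',
    G.skew il j n h₃' h₃ _ f']
  simp only [c.e_left hij, c.e_right _ hjl, c.e_right _ hil, c.e_left hil]
  -- The discrepancies are terms in which two entries were exchanged twice, each with a factor of
  -- the form ε(a,b)ε(b,a) = 1.
  linear_combination (norm := module) (c.e j l * c.e_mul_e i j) • G.actₗ il j n h₃' (B.br i l il hil a a'') f' +
    (c.e j l * c.e_mul_e i l) • G.br i jl n h₁ f (G.actₗ l j jl hlj a'' f') -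
    (c.e i l * c.e i j * c.e_mul_e j l) • G.br j il n h₃ f' (G.actₗ l i il hli a'' f) -
    (c.e_mul_e i j) • G.br i jl n h₁ f (G.actₗ j l jl hjl a' f'')

theorem act_opr_actₗ (ω : Ω) (i j k i' j' m : Γ) (h : i + j = k) (hk : δ ω + k = m)
    (hi : δ ω + i = i') (hj : δ ω + j = j') (h₁ : i' + j = m) (h₂ : i + j' = m) (b : B.V i)
    (x : G.V j) : G.act (B.opr ω) k m hk (G.actₗ i j k h b x) =
      G.actₗ i' j m h₁ (B.op ω i i' hi b) x +
        c.e (δ ω) i • G.actₗ i j' m h₂ b (G.act (B.opr ω) j j' hj x) :=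
  eq_add_of_sub_eq (G.act_act (B.opr ω) i i' j j' k m hi h₁ hj h hk h₂ b x).symm

/-- The semidirect product. -/
def semidirect : OpLie c δ where
  V i := B.V i × G.V i
  br := G.sdBr
  skew := G.sd_skew
  jac := G.sd_jac
  op ω i k h := (B.op ω i k h).prodMap (G.act (B.opr ω) i k h)
  op_br ω i j k i' j' m h hk hi hj h₁ h₂ x y := by
    refine Prod.ext (B.op_br ω i j k i' j' m h hk hi hj h₁ h₂ _ _) ?_
    have h' : j + i = k := (add_comm j i).trans h
    have h₁' : j + i' = m := (add_comm j i').trans h₁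
    have h₂' : j' + i = m := (add_comm j' i).trans h₂
    rw [LinearMap.prodMap_apply, Prod.snd_add, Prod.smul_snd, sdBr_snd G i j k h h',
      sdBr_snd G i' j m h₁ h₁', sdBr_snd G i j' m h₂ h₂']
    simp only [LinearMap.prodMap_apply, map_add, map_sub, map_smul]
    rw [G.act_opr_actₗ ω i j k i' j' m h hk hi hj h₁ h₂,
      G.act_opr_actₗ ω j i k j' i' m h' hk hj hi h₂' h₁',
      G.act_br (B.opr ω) i j k i' j' m h hk hi hj h₁ h₂]
    simp only [c.e_left hi, c.e_right _ hj, OpLie.dg_opr]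
    linear_combination (norm := module) (c.e i j * c.e_mul_e (δ ω) i) • G.actₗ j' i m h₂' (B.op ω j j' hj y.1) x.2
  op_op ω i j k hi hj x := Prod.ext (B.op_op ω i j k hi hj _) (G.op_op ω i j k hi hj _)

/-- The semidirect product, as a point over `B`. -/
def point : Pt B where
  A := G.semidirect
  p := ⟨fun _ => LinearMap.fst R _ _, fun _ _ _ _ _ _ => rfl, fun _ _ _ _ _ => rfl⟩
  s := ⟨fun _ => LinearMap.inl R _ _, fun i j k h x y => Prod.ext rfl <| Eq.symm <|
      (G.sdBr_snd i j k h ((add_comm j i).trans h) (x, 0) (y, 0)).trans (by simp; rfl),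
    fun ω i k h _ => Prod.ext rfl (map_zero (G.act (B.opr ω) i k h)).symm⟩
  sp := rfl

end LieAction

end Operators

end InternalLie

namespace InternalLie

/-! ### The Lie algebra of functions on words -/

section Words

variable {Γ : Type w} [AddCommGroup Γ] {R : Type u} [CommRing R]

/-- The degree of a word. -/
def wordDeg {A : Type*} (dg : A → Γ) (l : List A) : Γ := (l.map dg).sum

theorem wordDeg_cons {A : Type*} (dg : A → Γ) (a : A) (l : List A) :
    wordDeg dg (a :: l) = dg a + wordDeg dg l := by
  rw [wordDeg, wordDeg, List.map_cons, List.sum_cons]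

theorem wordDeg_cons_add {A : Type*} {dg : A → Γ} {a : A} {i k m : Γ} {l : List A}
    (h : dg a + i = k) (hm : wordDeg dg l + k = m) : wordDeg dg (a :: l) + i = m := by
  rw [wordDeg_cons, ← hm, ← h]
  abel

variable {c : CommutationFactor Γ R} (K : GLie.{u} c) {A : Type*} [Small.{u} Γ] [Small.{u} A]
  (dg : A → Γ)

/-- The functions of degree `i` on words. -/
def WFun (i : Γ) : Type u :=
  Shrink.{u} (∀ p : {p : List A × Γ // wordDeg dg p.1 + i = p.2}, K.V p.1.2)

namespace WFun

noncomputable instance (i : Γ) : AddCommGroup (WFun K dg i) :=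
  inferInstanceAs (AddCommGroup (Shrink.{u} _))

noncomputable instance (i : Γ) : Module R (WFun K dg i) :=
  inferInstanceAs (Module R (Shrink.{u} _))

variable {K dg}

/-- The value at a word. -/
noncomputable def app (l : List A) (i k : Γ) (h : wordDeg dg l + i = k) :
    WFun K dg i →ₗ[R] K.V k :=
  smallProj (M := fun p : {p : List A × Γ // wordDeg dg p.1 + i = p.2} => K.V p.1.2) ⟨(l, k), h⟩

/-- The function with given values. -/
noncomputable def mk (i : Γ) (f : ∀ (l : List A) (k : Γ), wordDeg dg l + i = k → K.V k) :
    WFun K dg i :=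
  smallMk R fun p : {p : List A × Γ // wordDeg dg p.1 + i = p.2} => f p.1.1 p.1.2 p.2

@[simp]
theorem app_mk (i : Γ) (f : ∀ (l : List A) (k : Γ), wordDeg dg l + i = k → K.V k) (l : List A)
    (k : Γ) (h : wordDeg dg l + i = k) : app l i k h (mk i f) = f l k h :=
  smallProj_smallMk (R := R)
    (fun p : {p : List A × Γ // wordDeg dg p.1 + i = p.2} => f p.1.1 p.1.2 p.2) ⟨(l, k), h⟩

theorem ext {i : Γ} {f g : WFun K dg i}
    (h : ∀ (l : List A) (k : Γ) (hk : wordDeg dg l + i = k), app l i k hk f = app l i k hk g) :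
    f = g :=
  small_ext R fun p => h p.1.1 p.1.2 p.2

/-- The function with given values, as a linear map. -/
noncomputable def mkₗ {M : Type*} [AddCommGroup M] [Module R M] (i : Γ)
    (f : ∀ (l : List A) (k : Γ), wordDeg dg l + i = k → (M →ₗ[R] K.V k)) : M →ₗ[R] WFun K dg i where
  toFun m := mk i fun l k h => f l k h m
  map_add' _ _ := ext fun l k h => by simp
  map_smul' _ _ := ext fun l k h => by simp

@[simp]
theorem app_mkₗ {M : Type*} [AddCommGroup M] [Module R M] (i : Γ)
    (f : ∀ (l : List A) (k : Γ), wordDeg dg l + i = k → (M →ₗ[R] K.V k)) (l : List A)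
    (k : Γ) (h : wordDeg dg l + i = k) (m : M) : app l i k h (mkₗ i f m) = f l k h m :=
  app_mk i (fun l k h => f l k h m) l k h

/-- The action of letters on functions on words. -/
noncomputable def act (a : A) (i k : Γ) (h : dg a + i = k) : WFun K dg i →ₗ[R] WFun K dg k :=
  -- The head of a word acts first: translating by `a` prepends `a` to the word.
  mkₗ k fun l m hm => app (a :: l) i m (wordDeg_cons_add h hm)

theorem app_act (a : A) (i k m : Γ) (h : dg a + i = k) (l : List A) (hm : wordDeg dg l + k = m)
    (h' : wordDeg dg (a :: l) + i = m) (f : WFun K dg i) :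
    app l k m hm (act a i k h f) = app (a :: l) i m h' f :=
  app_mkₗ k (fun l m hm => app (a :: l) i m (wordDeg_cons_add h hm)) l m hm f

theorem app_cons (a : A) (i m : Γ) (l : List A) (h : wordDeg dg (a :: l) + i = m)
    (f : WFun K dg i) : app (a :: l) i m h f =
      app l (dg a + i) m (by rw [← h, wordDeg_cons]; abel) (act a i _ rfl f) :=
  (app_act ..).symm

/-- The bracket of functions at a word. -/
noncomputable def brAt : ∀ (l : List A) (i j k : Γ), wordDeg dg l + (i + j) = k →
    (WFun K dg i →ₗ[R] WFun K dg j →ₗ[R] K.V k)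
  | [], i, j, k, h => (K.br i j k ((zero_add _).symm.trans h)).compl₁₂
      (app [] i i (zero_add i)) (app [] j j (zero_add j))
  -- The recursion forces letters to act by derivations; it is convolution for the coproduct on
  -- words in which letters are primitive.
  | a :: l, i, j, k, h =>
      (brAt l (dg a + i) j k (by rw [← h, wordDeg_cons]; abel)).compl₁₂ (act a i _ rfl)
          LinearMap.id +
        c.e (dg a) i • (brAt l i (dg a + j) k (by rw [← h, wordDeg_cons]; abel)).compl₁₂
          LinearMap.id (act a j _ rfl)

/-- The bracket of functions on words. -/
noncomputable def br (i j k : Γ) (h : i + j = k) :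
    WFun K dg i →ₗ[R] WFun K dg j →ₗ[R] WFun K dg k :=
  LinearMap.mk₂ R (fun f g => mk k fun l m hm => brAt l i j m (by rw [h, hm]) f g)
    (fun _ _ _ => ext fun _ _ _ => by simp) (fun _ _ _ => ext fun _ _ _ => by simp)
    (fun _ _ _ => ext fun _ _ _ => by simp) (fun _ _ _ => ext fun _ _ _ => by simp)

theorem app_br (i j k : Γ) (h : i + j = k) (f : WFun K dg i) (g : WFun K dg j) (l : List A) (m : Γ)
    (hm : wordDeg dg l + k = m) (hm' : wordDeg dg l + (i + j) = m) :
    app l k m hm (br i j k h f g) = brAt l i j m hm' f g :=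
  app_mk k (fun l m hm => brAt l i j m (by rw [h, hm]) f g) l m hm

theorem app_nil_br (i j k : Γ) (h : i + j = k) (f : WFun K dg i) (g : WFun K dg j) :
    app [] k k (zero_add k) (br i j k h f g) =
      K.br i j k h (app [] i i (zero_add i) f) (app [] j j (zero_add j) g) :=
  app_br i j k h f g [] k _ (by rw [h]; exact zero_add k)

/-- Together with `app_nil_br` this characterises the bracket, and the later inductions rest on
these two rules. -/
theorem act_br (a : A) (i j k i' j' m : Γ) (h : i + j = k) (hk : dg a + k = m)
    (hi : dg a + i = i') (hj : dg a + j = j') (h₁ : i' + j = m) (h₂ : i + j' = m)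
    (f : WFun K dg i) (g : WFun K dg j) :
    act a k m hk (br i j k h f g) =
      br i' j m h₁ (act a i i' hi f) g + c.e (dg a) i • br i j' m h₂ f (act a j j' hj g) := by
  subst hi hj
  refine ext fun l n hn => ?_
  have h₃ : wordDeg dg l + (dg a + i + j) = n := by rw [h₁, hn]
  have h₄ : wordDeg dg l + (i + (dg a + j)) = n := by rw [h₂, hn]
  have h₅ : wordDeg dg (a :: l) + k = n := wordDeg_cons_add hk hn
  rw [app_act a k m n hk l hn h₅, map_add, map_smul, app_br _ _ m h₁ _ _ l n hn h₃,
    app_br _ _ m h₂ _ _ l n hn h₄, app_br i j k h f g (a :: l) n h₅ (by rw [h, h₅])]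
  rfl

/-- Induction on the word: the value at a :: l is the value at l of the translate by a, and `act_br`
expands that translate into brackets of other functions. Hence degrees and functions are quantified
inside the induction. -/
theorem skew (i j k : Γ) (h : i + j = k) (h' : j + i = k) (f : WFun K dg i) (g : WFun K dg j) :
    br i j k h f g = -(c.e i j • br j i k h' g f) := by
  suffices ∀ (l : List A) (i j k m : Γ) (h : i + j = k) (h' : j + i = k) (hm : wordDeg dg l + k = m)
      (f : WFun K dg i) (g : WFun K dg j),
      app l k m hm (br i j k h f g) = -(c.e i j • app l k m hm (br j i k h' g f)) from
    ext fun l m hm => by rw [this l i j k m h h' hm f g, map_neg, map_smul]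
  intro l
  induction l with
  | nil =>
    intro i j k m h h' hm f g
    obtain rfl : k = m := (zero_add k).symm.trans hm
    rw [app_nil_br, app_nil_br, K.skew i j k h h']
  | cons a l ih =>
    intro i j k m h h' hm f g
    obtain ⟨k', hk⟩ : ∃ k', dg a + k = k' := ⟨_, rfl⟩
    have hm' : wordDeg dg l + k' = m := by rw [← hm, wordDeg_cons, ← hk]; abel
    have h₁ : dg a + i + j = k' := by rw [add_assoc, h, hk]
    have h₂ : i + (dg a + j) = k' := by rw [← hk, ← h]; abel
    have h₁' : j + (dg a + i) = k' := (add_comm _ _).trans h₁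
    have h₂' : dg a + j + i = k' := (add_comm _ _).trans h₂
    rw [← app_act a k k' m hk l hm' hm, ← app_act a k k' m hk l hm' hm,
      act_br a i j k _ _ k' h hk rfl rfl h₁ h₂, act_br a j i k _ _ k' h' hk rfl rfl h₂' h₁',
      map_add, map_add, map_smul, map_smul, ih _ _ k' m h₁ h₁' hm', ih _ _ k' m h₂ h₂' hm']
    simp only [c.e_left (k := dg a + i) rfl, c.e_right _ (k := dg a + j) rfl]
    -- The bracket of f with the translate of g acquires the surplus factor ε(a,i)ε(i,a) = 1; the
    -- other term matches exactly.
    linear_combination (norm := module)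
      -(c.e i j * c.e_mul_e (dg a) i) • app l k' m hm' (br _ _ _ h₂' (act a j _ rfl g) f)

theorem jac (i j l ij jl il n : Γ) (hij : i + j = ij) (hjl : j + l = jl) (hil : i + l = il)
    (h₁ : i + jl = n) (h₂ : ij + l = n) (h₃ : j + il = n) (x : WFun K dg i) (y : WFun K dg j)
    (z : WFun K dg l) :
    br i jl n h₁ x (br j l jl hjl y z) =
      br ij l n h₂ (br i j ij hij x y) z + c.e i j • br j il n h₃ y (br i l il hil x z) := by
  suffices ∀ (s : List A) (i j l ij jl il n m : Γ) (hij : i + j = ij) (hjl : j + l = jl)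
      (hil : i + l = il) (h₁ : i + jl = n) (h₂ : ij + l = n) (h₃ : j + il = n)
      (hm : wordDeg dg s + n = m) (x : WFun K dg i) (y : WFun K dg j) (z : WFun K dg l),
      app s n m hm (br i jl n h₁ x (br j l jl hjl y z)) =
        app s n m hm (br ij l n h₂ (br i j ij hij x y) z) +
          c.e i j • app s n m hm (br j il n h₃ y (br i l il hil x z)) from
    ext fun s m hm => by
      rw [this s i j l ij jl il n m hij hjl hil h₁ h₂ h₃ hm, map_add, map_smul]
  intro s
  induction s with
  | nil =>
    intro i j l ij jl il n m hij hjl hil h₁ h₂ h₃ hm x y z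
    obtain rfl : n = m := (zero_add n).symm.trans hm
    simp only [app_nil_br]
    exact K.jac i j l ij jl il n hij hjl hil h₁ h₂ h₃ _ _ _
  | cons a s ih =>
    intro i j l ij jl il n m hij hjl hil h₁ h₂ h₃ hm x y z
    obtain ⟨n', hn⟩ : ∃ n', dg a + n = n' := ⟨_, rfl⟩
    have hm' : wordDeg dg s + n' = m := by rw [← hm, wordDeg_cons, ← hn]; abel
    obtain ⟨i', hi⟩ : ∃ i', dg a + i = i' := ⟨_, rfl⟩
    obtain ⟨j', hj⟩ : ∃ j', dg a + j = j' := ⟨_, rfl⟩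
    obtain ⟨l', hl⟩ : ∃ l', dg a + l = l' := ⟨_, rfl⟩
    obtain ⟨ij', hij'⟩ : ∃ t, dg a + ij = t := ⟨_, rfl⟩
    obtain ⟨jl', hjl'⟩ : ∃ t, dg a + jl = t := ⟨_, rfl⟩
    obtain ⟨il', hil'⟩ : ∃ t, dg a + il = t := ⟨_, rfl⟩
    have a₁ : i' + jl = n' := by rw [← hi, ← hn, ← h₁]; abel
    have a₂ : i + jl' = n' := by rw [← hjl', ← hn, ← h₁]; abel
    have a₃ : ij' + l = n' := by rw [← hij', ← hn, ← h₂]; abel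
    have a₄ : ij + l' = n' := by rw [← hl, ← hn, ← h₂]; abel
    have a₅ : j' + il = n' := by rw [← hj, ← hn, ← h₃]; abel
    have a₆ : j + il' = n' := by rw [← hil', ← hn, ← h₃]; abel
    have b₁ : i' + j = ij' := by rw [← hi, ← hij', ← hij]; abel
    have b₂ : i + j' = ij' := by rw [← hj, ← hij', ← hij]; abel
    have b₃ : j' + l = jl' := by rw [← hj, ← hjl', ← hjl]; abel
    have b₄ : j + l' = jl' := by rw [← hl, ← hjl', ← hjl]; abel
    have b₅ : i' + l = il' := by rw [← hi, ← hil', ← hil]; abel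
    have b₆ : i + l' = il' := by rw [← hl, ← hil', ← hil]; abel
    rw [← app_act a n n' m hn s hm' hm, ← app_act a n n' m hn s hm' hm,
      ← app_act a n n' m hn s hm' hm,
      act_br a i jl n i' jl' n' h₁ hn hi hjl' a₁ a₂, act_br a j l jl j' l' jl' hjl hjl' hj hl b₃ b₄,
      act_br a ij l n ij' l' n' h₂ hn hij' hl a₃ a₄, act_br a i j ij i' j' ij' hij hij' hi hj b₁ b₂,
      act_br a j il n j' il' n' h₃ hn hj hil' a₅ a₆, act_br a i l il i' l' il' hil hil' hi hl b₅ b₆]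
    simp only [map_add, map_smul, LinearMap.add_apply, LinearMap.smul_apply]
    -- The letter falls on each of the three entries in turn, and each resulting triple satisfies
    -- the identity at the shorter word.
    rw [ih i' j l ij' jl il' n' m b₁ hjl b₅ a₁ a₃ a₆ hm',
      ih i j' l ij' jl' il n' m b₂ b₃ hil a₂ a₃ a₅ hm',
      ih i j l' ij jl' il' n' m hij b₄ b₆ a₂ a₄ a₆ hm']
    simp only [c.e_left hi, c.e_right _ hj, c.e_right _ hij]
    linear_combination (norm := module)
      (c.e i j * c.e_mul_e (dg a) i) • app s n' m hm' (br _ _ _ a₅ (act a j j' hj y)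
        (br _ _ _ hil x z))

end WFun

end Words

end InternalLie

namespace InternalLie

/-! ### The cofree action -/

section Cofree

variable {Γ : Type w} [AddCommGroup Γ] {R : Type u} [CommRing R] {Ω : Type}
  {c : CommutationFactor Γ R} {δ : Ω → Γ}

/-- Keeps functions on words in `B` inside the universe `u`. -/
instance OpLie.small_letter [Small.{u} Γ] (B : OpLie c δ) : Small.{u} B.Letter :=
  have : Small.{u} Ω := small_lift Ω
  inferInstanceAs (Small.{u} ((Σ i, B.V i) ⊕ Ω))

open OpLie (elt opr)

open WFun (app)

variable [Small.{u} Γ] {B E : OpLie c δ} (q : E ⟶ B) (K : LieAction E)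

/-- The functions on words in `B` satisfying the relations of an action in first position, whose
evaluation at the empty word is compatible with the action of `E`. -/
structure IsRel (i : Γ) (f : WFun K.toGLie (OpLie.Letter.dg (L := B)) i) : Prop where
  act_add (l k : Γ) (h : l + i = k) (b b' : B.V l) :
    WFun.act (elt (b + b')) i k h f = WFun.act (elt b) i k h f + WFun.act (elt b') i k h f
  act_smul (l k : Γ) (h : l + i = k) (r : R) (b : B.V l) :
    WFun.act (elt (r • b)) i k h f = r • WFun.act (elt b) i k h f
  act_act (a : B.Letter) (l m ai li k : Γ) (hm : a.dg + l = m) (hk : m + i = k)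
    (hai : a.dg + i = ai) (hli : l + i = li) (h₁ : a.dg + li = k) (h₂ : l + ai = k)
    (b : B.V l) : WFun.act (elt (OpLie.act a l m hm b)) i k hk f =
      WFun.act a li k h₁ (WFun.act (elt b) i li hli f) -
        c.e a.dg l • WFun.act (elt b) ai k h₂ (WFun.act a i ai hai f)
  op_op (ω : Ω) (j k : Γ) (hi : δ ω + i = j) (hj : δ ω + j = k) :
    WFun.act (B.opr ω) j k hj (WFun.act (B.opr ω) i j hi f) = 0
  -- Imposed on all translates of f, as happens in `good`, this says that a final letter q(a) of a
  -- word can be taken out of f as the action of a on K.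
  ev (a : E.Letter) (k : Γ) (h : a.dg + i = k) (h' : (a.map q).dg + i = k) :
    app [] k k (zero_add k) (WFun.act (a.map q) i k h' f) = K.act a i k h (app [] i i (zero_add i) f)

/-- The submodule of functions satisfying the relations. -/
noncomputable def relSub (i : Γ) : Submodule R (WFun K.toGLie (OpLie.Letter.dg (L := B)) i) where
  carrier := {f | IsRel q K i f}
  zero_mem' := by
    constructor <;> intros <;> simp
  add_mem' {f g} hf hg := by
    constructor <;> intros
    · simp only [map_add, hf.act_add, hg.act_add]
      abel
    · simp only [map_add, hf.act_smul, hg.act_smul, smul_add]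
    · rename_i a l m ai li k hm hk hai hli h₁ h₂ b
      simp only [map_add, smul_add]
      rw [hf.act_act a l m ai li k hm hk hai hli h₁ h₂, hg.act_act a l m ai li k hm hk hai hli h₁ h₂]
      abel
    · simp only [map_add, hf.op_op, hg.op_op, add_zero]
    · simp only [map_add]
      rw [hf.ev, hg.ev]
  smul_mem' r f hf := by
    constructor <;> intros
    · simp only [map_smul, hf.act_add, smul_add]
    · simp only [map_smul, hf.act_smul, smul_comm r]
    · rename_i a l m ai li k hm hk hai hli h₁ h₂ b
      simp only [map_smul]
      rw [hf.act_act a l m ai li k hm hk hai hli h₁ h₂, smul_sub, smul_comm r]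
    · simp only [map_smul, hf.op_op, smul_zero]
    · simp only [map_smul]
      rw [hf.ev]

/-- The families of submodules stable under the action of letters whose elements satisfy the
relations. -/
def IsStable (S : ∀ i, Submodule R (WFun K.toGLie (OpLie.Letter.dg (L := B)) i)) : Prop :=
  (∀ a i k h, S i ≤ (S k).comap (WFun.act a i k h)) ∧ ∀ i, S i ≤ relSub q K i

/-- The largest stable family of submodules. -/
noncomputable def good : ∀ i, Submodule R (WFun K.toGLie (OpLie.Letter.dg (L := B)) i) :=
  sSup {S | IsStable q K S}

theorem le_good {S : ∀ i, Submodule R (WFun K.toGLie (OpLie.Letter.dg (L := B)) i)}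
    (hS : IsStable q K S) (i : Γ) : S i ≤ good q K i :=
  le_sSup (a := S) (s := {S | IsStable q K S}) hS i

/-- The elements all of whose translates by a letter lie in `good` form a family containing every
stable family, hence containing their supremum. -/
theorem isStable_good : IsStable q K (good q K) := by
  constructor
  · intro a i k h
    have : good q K ≤ fun i => ⨅ (k) (h : a.dg + i = k), (good q K k).comap (WFun.act a i k h) :=
      sSup_le fun S hS i => le_iInf fun k => le_iInf fun h =>
        (hS.1 a i k h).trans (Submodule.comap_mono (le_good q K hS k))
    exact (this i).trans ((iInf_le _ k).trans (iInf_le _ h))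
  · have : good q K ≤ relSub q K := sSup_le fun S hS => hS.2
    exact this

variable {q K}

theorem act_mem_good (a : B.Letter) (i k : Γ) (h : a.dg + i = k)
    {f : WFun K.toGLie (OpLie.Letter.dg (L := B)) i} (hf : f ∈ good q K i) :
    WFun.act a i k h f ∈ good q K k :=
  (isStable_good q K).1 a i k h hf

theorem isRel_of_mem_good {i : Γ} {f : WFun K.toGLie (OpLie.Letter.dg (L := B)) i}
    (hf : f ∈ good q K i) : IsRel q K i f :=
  (isStable_good q K).2 i hf

/-- Each relation passes to brackets because letters act by derivations on functions, and letters of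
`E` do so on `K`. -/
theorem IsRel.br (hδ : ∀ ω, c.e (δ ω) (δ ω) = -1) (i j k : Γ) (h : i + j = k)
    {f : WFun K.toGLie (OpLie.Letter.dg (L := B)) i} {g : WFun K.toGLie (OpLie.Letter.dg (L := B)) j}
    (hf : IsRel q K i f) (hg : IsRel q K j g) : IsRel q K k (WFun.br i j k h f g) where
  act_add l m hm b b' := by
    obtain ⟨i', hi⟩ : ∃ t, l + i = t := ⟨_, rfl⟩
    obtain ⟨j', hj⟩ : ∃ t, l + j = t := ⟨_, rfl⟩
    have h₁ : i' + j = m := by rw [← hi, add_assoc, h, hm]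
    have h₂ : i + j' = m := by rw [← hj, ← hm, ← h]; abel
    rw [WFun.act_br _ i j k i' j' m h hm hi hj h₁ h₂,
      WFun.act_br _ i j k i' j' m h hm hi hj h₁ h₂,
      WFun.act_br _ i j k i' j' m h hm hi hj h₁ h₂, hf.act_add, hg.act_add]
    simp only [map_add, LinearMap.add_apply]
    change _ + c.e l i • _ = _ + c.e l i • _ + (_ + c.e l i • _)
    module
  act_smul l m hm r b := by
    obtain ⟨i', hi⟩ : ∃ t, l + i = t := ⟨_, rfl⟩
    obtain ⟨j', hj⟩ : ∃ t, l + j = t := ⟨_, rfl⟩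
    have h₁ : i' + j = m := by rw [← hi, add_assoc, h, hm]
    have h₂ : i + j' = m := by rw [← hj, ← hm, ← h]; abel
    rw [WFun.act_br _ i j k i' j' m h hm hi hj h₁ h₂,
      WFun.act_br _ i j k i' j' m h hm hi hj h₁ h₂, hf.act_smul, hg.act_smul]
    simp only [map_smul, LinearMap.smul_apply]
    change _ + c.e l i • _ = r • (_ + c.e l i • _)
    module
  act_act a l m ai li n hm hk hai hli h₁ h₂ b := by
    obtain ⟨i₁, hi₁⟩ : ∃ t, a.dg + i = t := ⟨_, rfl⟩
    obtain ⟨j₁, hj₁⟩ : ∃ t, a.dg + j = t := ⟨_, rfl⟩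
    obtain ⟨i₂, hi₂⟩ : ∃ t, l + i = t := ⟨_, rfl⟩
    obtain ⟨j₂, hj₂⟩ : ∃ t, l + j = t := ⟨_, rfl⟩
    obtain ⟨i₃, hi₃⟩ : ∃ t, m + i = t := ⟨_, rfl⟩
    obtain ⟨j₃, hj₃⟩ : ∃ t, m + j = t := ⟨_, rfl⟩
    have a₁ : i₁ + j = ai := by rw [← hi₁, ← hai, ← h]; abel
    have a₂ : i + j₁ = ai := by rw [← hj₁, ← hai, ← h]; abel
    have a₃ : i₂ + j = li := by rw [← hi₂, ← hli, ← h]; abel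
    have a₄ : i + j₂ = li := by rw [← hj₂, ← hli, ← h]; abel
    have a₅ : i₃ + j = n := by rw [← hi₃, ← hk, ← h]; abel
    have a₆ : i + j₃ = n := by rw [← hj₃, ← hk, ← h]; abel
    have a₇ : a.dg + i₂ = i₃ := by rw [← hi₃, ← hm, ← hi₂]; abel
    have a₈ : a.dg + j₂ = j₃ := by rw [← hj₃, ← hm, ← hj₂]; abel
    have a₉ : l + i₁ = i₃ := by rw [← hi₃, ← hm, ← hi₁]; abel
    have a₁₀ : l + j₁ = j₃ := by rw [← hj₃, ← hm, ← hj₁]; abel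
    have a₁₁ : i₁ + j₂ = n := by rw [← a₅, ← a₉, ← hj₂]; abel
    have a₁₂ : i₂ + j₁ = n := by rw [← a₅, ← a₇, ← hj₁]; abel
    rw [WFun.act_br _ i j k i₃ j₃ n h hk hi₃ hj₃ a₅ a₆,
      WFun.act_br _ i j k i₂ j₂ li h hli hi₂ hj₂ a₃ a₄,
      WFun.act_br _ i j k i₁ j₁ ai h hai hi₁ hj₁ a₁ a₂,
      hf.act_act a l m i₁ i₂ i₃ hm hi₃ hi₁ hi₂ a₇ a₉, hg.act_act a l m j₁ j₂ j₃ hm hj₃ hj₁ hj₂ a₈ a₁₀]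
    simp only [map_add, map_sub, map_smul, LinearMap.sub_apply, LinearMap.smul_apply]
    rw [WFun.act_br a i₂ j li i₃ j₁ n a₃ h₁ a₇ hj₁ a₅ a₁₂, WFun.act_br a i j₂ li i₁ j₃ n a₄ h₁ hi₁ a₈ a₁₁ a₆,
      WFun.act_br (elt b) i₁ j ai i₃ j₂ n a₁ h₂ a₉ hj₂ a₅ a₁₁,
      WFun.act_br (elt b) i j₁ ai i₂ j₃ n a₂ h₂ hi₂ a₁₀ a₁₂ a₆]
    change _ + c.e m i • _ = _ + c.e l i • _ - c.e a.dg l • (_ + c.e l i₁ • _ + _ • (_ + c.e l i • _))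
    simp only [c.e_left hm, c.e_right _ hi₂, c.e_right _ hi₁]
    linear_combination (norm := module) (c.e l i * c.e_mul_e a.dg l) •
      WFun.br i₁ j₂ n a₁₁ (WFun.act a i i₁ hi₁ f) (WFun.act (elt b) j j₂ hj₂ g)
  op_op ω m n hm hn := by
    obtain ⟨i₁, hi₁⟩ : ∃ t, δ ω + i = t := ⟨_, rfl⟩
    obtain ⟨j₁, hj₁⟩ : ∃ t, δ ω + j = t := ⟨_, rfl⟩
    obtain ⟨i₂, hi₂⟩ : ∃ t, δ ω + i₁ = t := ⟨_, rfl⟩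
    obtain ⟨j₂, hj₂⟩ : ∃ t, δ ω + j₁ = t := ⟨_, rfl⟩
    have a₁ : i₁ + j = m := by rw [← hi₁, ← hm, ← h]; abel
    have a₂ : i + j₁ = m := by rw [← hj₁, ← hm, ← h]; abel
    have a₃ : i₂ + j = n := by rw [← hi₂, ← hn, ← a₁]; abel
    have a₄ : i₁ + j₁ = n := by rw [← hj₁, ← hn, ← a₁]; abel
    have a₅ : i + j₂ = n := by rw [← hj₂, ← hn, ← a₂]; abel
    rw [WFun.act_br (B.opr ω) i j k i₁ j₁ m h hm hi₁ hj₁ a₁ a₂, map_add, map_smul,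
      WFun.act_br (B.opr ω) i₁ j m i₂ j₁ n a₁ hn hi₂ hj₁ a₃ a₄,
      WFun.act_br (B.opr ω) i j₁ m i₁ j₂ n a₂ hn hi₁ hj₂ a₄ a₅, hf.op_op, hg.op_op]
    simp only [map_zero, LinearMap.zero_apply]
    change _ + c.e (δ ω) i₁ • _ + c.e (δ ω) i • (_ + c.e (δ ω) i • _) = _
    -- Applying ω twice leaves the cross term with coefficient ε(δω, δω + i) + ε(δω, i), which
    -- vanishes exactly because ε(δω, δω) = -1.
    rw [c.e_right _ hi₁, hδ]
    module
  ev a m hm hm' := by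
    have hi' : (a.map q).dg + i = a.dg + i := by rw [a.dg_map]
    have hj' : (a.map q).dg + j = a.dg + j := by rw [a.dg_map]
    have h₁ : a.dg + i + j = m := by rw [add_assoc, h, hm]
    have h₂ : i + (a.dg + j) = m := by rw [← hm, ← h]; abel
    rw [WFun.act_br _ i j k (a.dg + i) (a.dg + j) m h hm' hi' hj' h₁ h₂, WFun.app_nil_br, map_add,
      map_smul, WFun.app_nil_br, WFun.app_nil_br, hf.ev a _ rfl, hg.ev a _ rfl, a.dg_map,
      K.act_br a i j k _ _ m h hm rfl rfl h₁ h₂]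

/-- The spans of brackets of members of `good` form a stable family, by the derivation rule and
`IsRel.br`; maximality places them inside `good`. -/
theorem br_mem_good (hδ : ∀ ω, c.e (δ ω) (δ ω) = -1) (i j k : Γ) (h : i + j = k)
    {f : WFun K.toGLie (OpLie.Letter.dg (L := B)) i} {g : WFun K.toGLie (OpLie.Letter.dg (L := B)) j}
    (hf : f ∈ good q K i) (hg : g ∈ good q K j) : WFun.br i j k h f g ∈ good q K k := by
  refine le_good q K (S := fun k => Submodule.span R {x | ∃ (i j : Γ) (h : i + j = k),
    ∃ f ∈ good q K i, ∃ g ∈ good q K j, WFun.br i j k h f g = x}) ⟨fun a k m hm => ?_, fun k => ?_⟩ k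
    (Submodule.subset_span ⟨i, j, h, f, hf, g, hg, rfl⟩)
  · refine Submodule.span_le.2 ?_
    rintro _ ⟨i, j, h, f, hf, g, hg, rfl⟩
    have h₁ : a.dg + i + j = m := by rw [add_assoc, h, hm]
    have h₂ : i + (a.dg + j) = m := by rw [← hm, ← h]; abel
    rw [SetLike.mem_coe, Submodule.mem_comap,
      WFun.act_br _ i j k _ _ m h hm rfl rfl h₁ h₂]
    exact add_mem (Submodule.subset_span ⟨_, _, h₁, _, act_mem_good _ _ _ _ hf, _, hg, rfl⟩)
      (Submodule.smul_mem _ _ (Submodule.subset_span ⟨_, _, h₂, _, hf, _, act_mem_good _ _ _ _ hg, rfl⟩))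
  · refine Submodule.span_le.2 ?_
    rintro _ ⟨i, j, h, f, hf, g, hg, rfl⟩
    exact (isRel_of_mem_good hf).br hδ i j k h (isRel_of_mem_good hg)

variable (q K)

/-- The cofree action of `B` on an action of `E` along `q`. -/
noncomputable def cofree (hδ : ∀ ω, c.e (δ ω) (δ ω) = -1) : LieAction B where
  V i := good q K i
  br i j k h := LinearMap.mk₂ R (fun f g => ⟨WFun.br i j k h f.1 g.1, br_mem_good hδ i j k h f.2 g.2⟩)
    (fun _ _ _ => Subtype.ext (by simp)) (fun _ _ _ => Subtype.ext (by simp))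
    (fun _ _ _ => Subtype.ext (by simp)) (fun _ _ _ => Subtype.ext (by simp))
  skew i j k h h' f g := Subtype.ext (WFun.skew i j k h h' f.1 g.1)
  jac i j l ij jl il n hij hjl hil h₁ h₂ h₃ x y z :=
    Subtype.ext (WFun.jac i j l ij jl il n hij hjl hil h₁ h₂ h₃ x.1 y.1 z.1)
  act a i k h := (WFun.act a i k h).restrict fun _ => act_mem_good a i k h
  act_br a i j k i' j' m h hk hi hj h₁ h₂ x y :=
    Subtype.ext (WFun.act_br a i j k i' j' m h hk hi hj h₁ h₂ x.1 y.1)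
  act_add l i k h b b' x := Subtype.ext ((isRel_of_mem_good x.2).act_add l k h b b')
  act_smul l i k h r b x := Subtype.ext ((isRel_of_mem_good x.2).act_smul l k h r b)
  act_act a l m i ai li k hm hk hai hli h₁ h₂ b x :=
    Subtype.ext ((isRel_of_mem_good x.2).act_act a l m ai li k hm hk hai hli h₁ h₂ b)
  op_op ω i j k hi hj x := Subtype.ext ((isRel_of_mem_good x.2).op_op ω j k hi hj)

end Cofree

end InternalLie

namespace InternalLie

namespace WFun

/-! ### Coinduction for functions on words -/

variable {Γ : Type w} [AddCommGroup Γ] {R : Type u} [CommRing R] {c : CommutationFactor Γ R}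
  {K : GLie.{u} c} {A : Type*} [Small.{u} Γ] [Small.{u} A] {dg : A → Γ}
  {V : Γ → Type*} [∀ i, AddCommGroup (V i)] [∀ i, Module R (V i)]
  (T : ∀ (a : A) (i k : Γ), dg a + i = k → (V i →ₗ[R] V k)) (θ : ∀ i, V i →ₗ[R] K.V i)

/-- The value at a word of the function induced by an action of letters. -/
noncomputable def liftAt : ∀ (l : List A) (i k : Γ), wordDeg dg l + i = k → (V i →ₗ[R] K.V k)
  | [], i, _, h => ((zero_add i).symm.trans h) ▸ θ i
  | a :: l, i, k, h => liftAt l (dg a + i) k (by rw [← h, wordDeg_cons]; abel) ∘ₗ T a i _ rfl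

/-- The functions on words induced by an action of letters. -/
noncomputable def lift (i : Γ) : V i →ₗ[R] WFun K dg i := mkₗ i fun l k h => liftAt T θ l i k h

/-- The induced function sends a word w to θ(w · x), so translating it by a letter amounts to
letting that letter act on x. -/
theorem act_lift (a : A) (i k : Γ) (h : dg a + i = k) (x : V i) :
    act a i k h (lift T θ i x) = lift T θ k (T a i k h x) := by
  subst h
  refine ext fun l m hm => ?_
  rw [app_act a i _ m rfl l hm (wordDeg_cons_add rfl hm), lift, lift, app_mkₗ, app_mkₗ]
  rfl

theorem app_nil_lift (i : Γ) (x : V i) : app [] i i (zero_add i) (lift T θ i x) = θ i x :=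
  app_mkₗ i (fun l k h => liftAt T θ l i k h) [] i (zero_add i) x

variable {T θ}

/-- The couniversal property of functions on words: the value of an equivariant map at a :: l is its
value at l on a translate, so the values at the empty word determine everything. -/
theorem lift_unique (g : ∀ i, V i → WFun K dg i)
    (hT : ∀ a i k h (x : V i), act a i k h (g i x) = g k (T a i k h x))
    (hθ : ∀ i (x : V i), app [] i i (zero_add i) (g i x) = θ i x) (i : Γ) (x : V i) :
    g i x = lift T θ i x := by
  suffices ∀ (l : List A) (i k : Γ) (h : wordDeg dg l + i = k) (x : V i),
      app l i k h (g i x) = app l i k h (lift T θ i x) from ext fun l k h => this l i k h x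
  intro l
  induction l with
  | nil =>
    intro i k h x
    obtain rfl : i = k := (zero_add i).symm.trans h
    rw [hθ, app_nil_lift]
  | cons a l ih =>
    intro i k h x
    rw [app_cons, app_cons, hT, act_lift, ih]

theorem lift_eq_zero (S : ∀ i, Set (V i)) (hT : ∀ a i k h, ∀ x ∈ S i, T a i k h x ∈ S k)
    (hθ : ∀ i, ∀ x ∈ S i, θ i x = 0) (i : Γ) (x : V i) (hx : x ∈ S i) : lift T θ i x = 0 := by
  suffices ∀ (l : List A) (i k : Γ) (h : wordDeg dg l + i = k), ∀ x ∈ S i,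
      app l i k h (lift T θ i x) = 0 from ext fun l k h => by rw [this l i k h x hx, map_zero]
  intro l
  induction l with
  | nil =>
    intro i k h x hx
    obtain rfl : i = k := (zero_add i).symm.trans h
    rw [app_nil_lift, hθ i x hx]
  | cons a l ih =>
    intro i k h x hx
    rw [app_cons, act_lift, ih _ _ _ _ (hT _ _ _ _ x hx)]

/-- Only the derivation rule is asked of β, not the Lie axioms or bilinearity, which leaves room for
the modified bracket of `wordLift_br`. -/
theorem lift_br (β : ∀ i j k : Γ, i + j = k → V i → V j → V k)
    (hT : ∀ (a : A) (i j k i' j' m : Γ) (h : i + j = k) (hk : dg a + k = m)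
      (hi : dg a + i = i') (hj : dg a + j = j') (h₁ : i' + j = m) (h₂ : i + j' = m) (x : V i)
      (y : V j), T a k m hk (β i j k h x y) =
        β i' j m h₁ (T a i i' hi x) y + c.e (dg a) i • β i j' m h₂ x (T a j j' hj y))
    (hθ : ∀ i j k h x y, θ k (β i j k h x y) = K.br i j k h (θ i x) (θ j y))
    (i j k : Γ) (h : i + j = k) (x : V i) (y : V j) :
    lift T θ k (β i j k h x y) = br i j k h (lift T θ i x) (lift T θ j y) := by
  suffices ∀ (l : List A) (i j k m : Γ) (h : i + j = k) (hm : wordDeg dg l + k = m) (x : V i)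
      (y : V j), app l k m hm (lift T θ k (β i j k h x y)) =
        app l k m hm (br i j k h (lift T θ i x) (lift T θ j y)) from
    ext fun l m hm => this l i j k m h hm x y
  intro l
  induction l with
  | nil =>
    intro i j k m h hm x y
    obtain rfl : k = m := (zero_add k).symm.trans hm
    rw [app_nil_lift, app_nil_br, app_nil_lift, app_nil_lift, hθ]
  | cons a l ih =>
    intro i j k m h hm x y
    have h₁ : dg a + i + j = dg a + k := by rw [add_assoc, h]
    have h₂ : i + (dg a + j) = dg a + k := by rw [← h]; abel
    rw [app_cons, app_cons, act_lift, hT a i j k _ _ _ h rfl rfl rfl h₁ h₂,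
      act_br a i j k _ _ _ h rfl rfl rfl h₁ h₂]
    simp only [map_add, map_smul, ih, act_lift]

end WFun

/-! ### Kernels of points -/

section Kernel

variable {Γ : Type w} [AddCommGroup Γ] {R : Type u} [CommRing R] {Ω : Type}
  {c : CommutationFactor Γ R} {δ : Ω → Γ}

namespace OpLie

variable {L M N : OpLie c δ}

/-- The degree of a letter occurs in the type of the degree hypothesis, so equal letters cannot
simply be rewritten. -/
theorem act_congr {a a' : L.Letter} (ha : a = a') (i k : Γ) (h : a.dg + i = k)
    (h' : a'.dg + i = k) (x : L.V i) : act a i k h x = act a' i k h' x := by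
  subst ha
  rfl

theorem Letter.map_map (f : L ⟶ M) (g : M ⟶ N) (a : L.Letter) :
    (a.map f).map g = a.map (f ≫ g) := by
  rcases a with ⟨l, b⟩ | ω <;> rfl

theorem Letter.map_id (a : L.Letter) : a.map (𝟙 L) = a := by
  rcases a with ⟨l, b⟩ | ω <;> rfl

/-- `act_br` rearranged into the shape of `LieAction.act_act`. -/
theorem br_act (a : L.Letter) (l m i ai li k : Γ) (hm : a.dg + l = m) (hk : m + i = k)
    (hai : a.dg + i = ai) (hli : l + i = li) (h₁ : a.dg + li = k) (h₂ : l + ai = k)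
    (b : L.V l) (x : L.V i) : L.br m i k hk (act a l m hm b) x =
      act a li k h₁ (L.br l i li hli b x) - c.e a.dg l • L.br l ai k h₂ b (act a i ai hai x) :=
  eq_sub_of_add_eq (act_br a l i li m ai k hli h₁ hm hai hk h₂ b x).symm

end OpLie

variable {E : OpLie c δ} (Y : Pt E)

theorem Pt.sp_apply (i : Γ) (x : E.V i) : OpLie.Hom.f Y.p i (OpLie.Hom.f Y.s i x) = x :=
  congrArg (fun f : E ⟶ E => OpLie.Hom.f f i x) Y.sp

theorem Pt.map_s_map_p (a : E.Letter) : (a.map Y.s).map Y.p = a := by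
  rw [OpLie.Letter.map_map, Y.sp, OpLie.Letter.map_id]

theorem Pt.p_act (a : E.Letter) (i k : Γ) (h : (a.map Y.s).dg + i = k) (h' : a.dg + i = k)
    (x : Y.A.V i) :
    OpLie.Hom.f Y.p k (OpLie.act (a.map Y.s) i k h x) = OpLie.act a i k h' (OpLie.Hom.f Y.p i x) := by
  rw [OpLie.hom_act]
  exact OpLie.act_congr (Y.map_s_map_p a) ..

/-- The kernel of a point, with its action of the base. -/
def Pt.kernel : LieAction E where
  V i := LinearMap.ker (OpLie.Hom.f Y.p i)
  br i j k h := LinearMap.mk₂ R (fun x y => ⟨Y.A.br i j k h x.1 y.1, by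
      rw [LinearMap.mem_ker, OpLie.hom_br, LinearMap.mem_ker.1 x.2, map_zero,
        LinearMap.zero_apply]⟩)
    (fun _ _ _ => Subtype.ext (by simp)) (fun _ _ _ => Subtype.ext (by simp))
    (fun _ _ _ => Subtype.ext (by simp)) (fun _ _ _ => Subtype.ext (by simp))
  skew i j k h h' f g := Subtype.ext (Y.A.skew i j k h h' f.1 g.1)
  jac i j l ij jl il n hij hjl hil h₁ h₂ h₃ x y z :=
    Subtype.ext (Y.A.jac i j l ij jl il n hij hjl hil h₁ h₂ h₃ x.1 y.1 z.1)
  act a i k h := (OpLie.act (a.map Y.s) i k ((congrArg (· + i) (a.dg_map Y.s)).trans h)).restrict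
    fun x hx => by
      rw [LinearMap.mem_ker, Y.p_act a i k _ h, LinearMap.mem_ker.1 hx, map_zero]
  act_br a i j k i' j' m h hk hi hj h₁ h₂ x y := Subtype.ext <|
    (OpLie.act_br (a.map Y.s) i j k i' j' m h (by rw [a.dg_map, hk]) (by rw [a.dg_map, hi])
      (by rw [a.dg_map, hj]) h₁ h₂ x.1 y.1).trans (by rcases a with ⟨_, _⟩ | _ <;> rfl)
  act_add l i k h b b' x := Subtype.ext <|
    (congrArg (fun t => Y.A.br l i k h t x.1) (map_add (OpLie.Hom.f Y.s l) b b')).trans (by simp; rfl)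
  act_smul l i k h r b x := Subtype.ext <|
    (congrArg (fun t => Y.A.br l i k h t x.1) (map_smul (OpLie.Hom.f Y.s l) r b)).trans (by simp; rfl)
  act_act a l m i ai li k hm hk hai hli h₁ h₂ b x := Subtype.ext <|
    (congrArg (fun t => Y.A.br m i k hk t x.1) (OpLie.hom_act Y.s a l m hm b)).trans <|
      (OpLie.br_act (a.map Y.s) l m i ai li k (by rw [a.dg_map, hm]) hk (by rw [a.dg_map, hai]) hli
        (by rw [a.dg_map, h₁]) h₂ (OpLie.Hom.f Y.s l b) x.1).trans (by rcases a with ⟨_, _⟩ | _ <;> rfl)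
  op_op ω i j k hi hj x := Subtype.ext (Y.A.op_op ω i j k hi hj x.1)

end Kernel

end InternalLie

namespace InternalLie

/-! ### Limits of Lie algebras with operators -/

namespace OpLie

variable {Γ : Type w} [AddCommGroup Γ] {R : Type u} [CommRing R] {Ω : Type}
  {c : CommutationFactor Γ R} {δ : Ω → Γ}

variable (c δ) in
/-- The zero Lie algebra. -/
def zero : OpLie.{u} c δ where
  V _ := PUnit
  br _ _ _ _ := 0
  skew _ _ _ _ _ _ _ := rfl
  jac _ _ _ _ _ _ _ _ _ _ _ _ _ _ _ _ := rfl
  op _ _ _ _ := 0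
  op_br _ _ _ _ _ _ _ _ _ _ _ _ _ _ _ := rfl
  op_op _ _ _ _ _ _ _ := rfl

instance : HasTerminal (OpLie.{u} c δ) :=
  (IsTerminal.ofUniqueHom (Y := zero c δ)
    (fun L => (⟨fun _ => 0, fun _ _ _ _ _ _ => rfl, fun _ _ _ _ _ => rfl⟩ : Hom L (zero c δ)))
    (fun _ _ => hom_ext fun _ _ => rfl)).hasTerminal

variable {L M N : OpLie c δ} (f : L ⟶ N) (g : M ⟶ N)

/-- The fibre product. -/
def fibre : OpLie c δ where
  V i := LinearMap.eqLocus (f.f i ∘ₗ LinearMap.fst R (L.V i) (M.V i))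
    (g.f i ∘ₗ LinearMap.snd R (L.V i) (M.V i))
  br i j k h := LinearMap.mk₂ R
    (fun x y => ⟨(L.br i j k h x.1.1 y.1.1, M.br i j k h x.1.2 y.1.2), by
      change f.f k (L.br i j k h x.1.1 y.1.1) = g.f k (M.br i j k h x.1.2 y.1.2)
      rw [hom_br, hom_br, show f.f i x.1.1 = _ from x.2, show f.f j y.1.1 = _ from y.2]
      rfl⟩)
    (fun _ _ _ => Subtype.ext (by simp)) (fun _ _ _ => Subtype.ext (by simp))
    (fun _ _ _ => Subtype.ext (by simp)) (fun _ _ _ => Subtype.ext (by simp))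
  skew i j k h h' x y := Subtype.ext (Prod.ext (L.skew i j k h h' _ _) (M.skew i j k h h' _ _))
  jac i j l ij jl il n hij hjl hil h₁ h₂ h₃ x y z := Subtype.ext (Prod.ext
    (L.jac i j l ij jl il n hij hjl hil h₁ h₂ h₃ x.1.1 y.1.1 z.1.1)
    (M.jac i j l ij jl il n hij hjl hil h₁ h₂ h₃ x.1.2 y.1.2 z.1.2))
  op ω i k h := ((L.op ω i k h).prodMap (M.op ω i k h)).restrict fun x hx => by
    change f.f k (L.op ω i k h x.1) = g.f k (M.op ω i k h x.2)
    rw [hom_op, hom_op, show f.f i x.1 = _ from hx]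
    rfl
  op_br ω i j k i' j' m h hk hi hj h₁ h₂ x y := Subtype.ext (Prod.ext
    (L.op_br ω i j k i' j' m h hk hi hj h₁ h₂ x.1.1 y.1.1)
    (M.op_br ω i j k i' j' m h hk hi hj h₁ h₂ x.1.2 y.1.2))
  op_op ω i j k hi hj x := Subtype.ext (Prod.ext (L.op_op ω i j k hi hj x.1.1)
    (M.op_op ω i j k hi hj x.1.2))

/-- The first projection of the fibre product. -/
def fibreFst : fibre f g ⟶ L :=
  ⟨fun _ => LinearMap.fst R _ _ ∘ₗ Submodule.subtype _, fun _ _ _ _ _ _ => rfl, fun _ _ _ _ _ => rfl⟩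

/-- The second projection of the fibre product. -/
def fibreSnd : fibre f g ⟶ M :=
  ⟨fun _ => LinearMap.snd R _ _ ∘ₗ Submodule.subtype _, fun _ _ _ _ _ _ => rfl, fun _ _ _ _ _ => rfl⟩

theorem fibre_condition : fibreFst f g ≫ f = fibreSnd f g ≫ g :=
  hom_ext fun _ x => x.2

/-- The fibre product is a pullback. -/
def fibreIsLimit : IsLimit (PullbackCone.mk _ _ (fibre_condition f g)) :=
  PullbackCone.IsLimit.mk _
    (fun s => ⟨fun i => (LinearMap.prod (Hom.f s.fst i) (Hom.f s.snd i)).codRestrict _ fun x =>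
        congrArg (fun φ : s.pt ⟶ N => Hom.f φ i x) s.condition,
      fun i j k h x y => Subtype.ext (Prod.ext (hom_br s.fst i j k h x y) (hom_br s.snd i j k h x y)),
      fun ω i k h x => Subtype.ext (Prod.ext (hom_op s.fst ω i k h x) (hom_op s.snd ω i k h x))⟩)
    (fun _ => rfl) (fun _ => rfl)
    fun _ _ h₁ h₂ => hom_ext fun i x => Subtype.ext (Prod.ext
      (congrArg (fun φ => Hom.f φ i x) h₁)
      (congrArg (fun φ => Hom.f φ i x) h₂))

instance : HasPullbacks (OpLie.{u} c δ) :=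
  have {L M N : OpLie.{u} c δ} (f : L ⟶ N) (g : M ⟶ N) : HasLimit (cospan f g) :=
    ⟨⟨⟨_, fibreIsLimit f g⟩⟩⟩
  hasPullbacks_of_hasLimit_cospan _

instance : HasFiniteLimits (OpLie.{u} c δ) := hasFiniteLimits_of_hasTerminal_and_pullbacks

/-- The chosen pullback is only isomorphic to `fibre f g`. The comparison map φ has a left inverse,
hence is injective, and elements of `fibre f g` are pairs. -/
theorem pullback_hom_ext {i : Γ} {x y : (pullback f g).V i}
    (h₁ : Hom.f (pullback.fst f g) i x = Hom.f (pullback.fst f g) i y)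
    (h₂ : Hom.f (pullback.snd f g) i x = Hom.f (pullback.snd f g) i y) : x = y := by
  let φ : pullback f g ⟶ fibre f g :=
    PullbackCone.IsLimit.lift (fibreIsLimit f g) _ _ pullback.condition
  have hφ : φ ≫ pullback.lift (fibreFst f g) (fibreSnd f g) (fibre_condition f g) = 𝟙 _ := by
    apply pullback.hom_ext
    · rw [Category.assoc, pullback.lift_fst, Category.id_comp]
      exact PullbackCone.IsLimit.lift_fst (fibreIsLimit f g) _ _ _
    · rw [Category.assoc, pullback.lift_snd, Category.id_comp]
      exact PullbackCone.IsLimit.lift_snd (fibreIsLimit f g) _ _ _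
  have key (z : (pullback f g).V i) := congrArg (fun ψ => Hom.f ψ i z) hφ
  refine (key x).symm.trans (Eq.trans ?_ (key y))
  exact congrArg (Hom.f (pullback.lift (fibreFst f g) (fibreSnd f g) (fibre_condition f g)) i)
    (Subtype.ext (Prod.ext h₁ h₂) : Hom.f φ i x = Hom.f φ i y)

variable {f g} in
/-- The element of the pullback with given components. -/
noncomputable def pair {i : Γ} (x : L.V i) (y : M.V i) (h : f.f i x = g.f i y) :
    (pullback f g).V i :=
  Hom.f (pullback.lift (fibreFst f g) (fibreSnd f g) (fibre_condition f g)) i ⟨(x, y), h⟩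

variable {f g} in
@[simp]
theorem fst_pair {i : Γ} (x : L.V i) (y : M.V i) (h : f.f i x = g.f i y) :
    Hom.f (pullback.fst f g) i (pair x y h) = x :=
  congrArg (fun φ : fibre f g ⟶ L => Hom.f φ i ⟨(x, y), h⟩)
    (pullback.lift_fst _ _ (fibre_condition f g))

variable {f g} in
@[simp]
theorem snd_pair {i : Γ} (x : L.V i) (y : M.V i) (h : f.f i x = g.f i y) :
    Hom.f (pullback.snd f g) i (pair x y h) = y :=
  congrArg (fun φ : fibre f g ⟶ M => Hom.f φ i ⟨(x, y), h⟩)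
    (pullback.lift_snd _ _ (fibre_condition f g))

theorem pullback_condition_apply {i : Γ} (z : (pullback f g).V i) :
    f.f i (Hom.f (pullback.fst f g) i z) = g.f i (Hom.f (pullback.snd f g) i z) :=
  congrArg (fun φ : pullback f g ⟶ N => Hom.f φ i z) pullback.condition

end OpLie

end InternalLie

namespace InternalLie

/-! ### The right adjoint of change of base -/

section Adjoint

variable {Γ : Type w} [AddCommGroup Γ] {R : Type u} [CommRing R] {Ω : Type}
  {c : CommutationFactor Γ R} {δ : Ω → Γ} {B E : OpLie c δ}

open OpLie (elt opr pair fst_pair snd_pair pullback_hom_ext)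

namespace Pt

variable (Y : Pt E)

/-- The inclusion of the kernel of a point. -/
def ker (i : Γ) : Y.kernel.V i →ₗ[R] Y.A.V i := Submodule.subtype _

theorem p_ker (i : Γ) (x : Y.kernel.V i) : OpLie.Hom.f Y.p i (Y.ker i x) = 0 := x.2

theorem ker_br (i j k : Γ) (h : i + j = k) (x : Y.kernel.V i) (y : Y.kernel.V j) :
    Y.ker k (Y.kernel.br i j k h x y) = Y.A.br i j k h (Y.ker i x) (Y.ker j y) := rfl

theorem ker_act (a : E.Letter) (i k : Γ) (h : a.dg + i = k) (h' : (a.map Y.s).dg + i = k)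
    (x : Y.kernel.V i) :
    Y.ker k (Y.kernel.act a i k h x) = OpLie.act (a.map Y.s) i k h' (Y.ker i x) := rfl

theorem ker_injective (i : Γ) : Function.Injective (Y.ker i) := Subtype.val_injective

/-- The projection to the kernel of a point. -/
def π (i : Γ) : Y.A.V i →ₗ[R] Y.kernel.V i :=
  (LinearMap.id - OpLie.Hom.f Y.s i ∘ₗ OpLie.Hom.f Y.p i).codRestrict _ fun x => by
    change OpLie.Hom.f Y.p i (x - OpLie.Hom.f Y.s i (OpLie.Hom.f Y.p i x)) = 0
    rw [map_sub, Y.sp_apply, sub_self]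

theorem ker_π (i : Γ) (x : Y.A.V i) :
    Y.ker i (Y.π i x) = x - OpLie.Hom.f Y.s i (OpLie.Hom.f Y.p i x) := rfl

theorem π_s (i : Γ) (x : E.V i) : Y.π i (OpLie.Hom.f Y.s i x) = 0 :=
  Y.ker_injective i (by rw [ker_π, Y.sp_apply, sub_self, map_zero])

theorem π_act (a : E.Letter) (i k : Γ) (h : a.dg + i = k) (h' : (a.map Y.s).dg + i = k)
    (x : Y.A.V i) : Y.π k (OpLie.act (a.map Y.s) i k h' x) = Y.kernel.act a i k h (Y.π i x) :=
  Y.ker_injective k <| by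
    rw [ker_act _ _ _ _ _ h', ker_π, ker_π, map_sub, Y.p_act a i k h' h, OpLie.hom_act]

/-- Write x = s(p x) + x₀ and y = s(p y) + y₀. The argument of π on the left is then [x₀, y₀] - s[p
x, p y], and π kills the image of s. -/
theorem π_br (i j k : Γ) (h : i + j = k) (x : Y.A.V i) (y : Y.A.V j) :
    Y.π k (Y.A.br i j k h x y - Y.A.br i j k h (OpLie.Hom.f Y.s i (OpLie.Hom.f Y.p i x)) y -
        Y.A.br i j k h x (OpLie.Hom.f Y.s j (OpLie.Hom.f Y.p j y))) =
      Y.kernel.br i j k h (Y.π i x) (Y.π j y) :=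
  Y.ker_injective k <| by
    rw [ker_br]
    simp only [ker_π, map_sub, OpLie.hom_br, Y.sp_apply, LinearMap.sub_apply]
    abel

end Pt

variable (q : E ⟶ B)

/-- The section of the pullback of a point. -/
noncomputable def pullbackSection (X : Pt B) : E ⟶ pullback q X.p := ((changeOfBase q).obj X).s

theorem pullbackSection_fst (X : Pt B) : pullbackSection q X ≫ pullback.fst q X.p = 𝟙 E :=
  ((changeOfBase q).obj X).sp

theorem pullbackSection_snd (X : Pt B) : pullbackSection q X ≫ pullback.snd q X.p = q ≫ X.s :=
  pullback.lift_snd _ _ _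

/-! ### Morphisms of points out of a pullback, restricted to kernels. -/

section KernelMap

variable {q} {Y : Pt E} {X : Pt B} (φ : pullback q X.p ⟶ Y.A) (hp : φ ≫ Y.p = pullback.fst q X.p)

theorem map_zero_eq_p_ker (q : E ⟶ B) {i : Γ} (u : X.kernel.V i) :
    q.f i 0 = OpLie.Hom.f X.p i (X.ker i u) := by
  rw [map_zero, X.p_ker]

/-- The map induced on kernels by a morphism of points out of a pullback. -/
noncomputable def kernelMap (i : Γ) : X.kernel.V i →ₗ[R] Y.kernel.V i where
  toFun u := ⟨φ.f i (pair 0 (X.ker i u) (map_zero_eq_p_ker q u)),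
    (congrArg (fun ψ => OpLie.Hom.f ψ i (pair 0 (X.ker i u) (map_zero_eq_p_ker q u))) hp).trans
      (fst_pair _ _ _)⟩
  map_add' u v := Subtype.ext <| by
    change φ.f i _ = φ.f i _ + φ.f i _
    rw [← map_add]
    congr 1
    apply pullback_hom_ext <;> simp only [map_add, fst_pair, snd_pair, add_zero]
  map_smul' r u := Subtype.ext <| by
    change φ.f i _ = r • φ.f i _
    rw [← map_smul]
    congr 1
    apply pullback_hom_ext <;> simp only [map_smul, fst_pair, snd_pair, smul_zero]

theorem ker_kernelMap (i : Γ) (u : X.kernel.V i) :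
    Y.ker i (kernelMap φ hp i u) = φ.f i (pair 0 (X.ker i u) (map_zero_eq_p_ker q u)) := rfl

theorem kernelMap_br (i j k : Γ) (h : i + j = k) (x : X.kernel.V i) (y : X.kernel.V j) :
    kernelMap φ hp k (X.kernel.br i j k h x y) =
      Y.kernel.br i j k h (kernelMap φ hp i x) (kernelMap φ hp j y) :=
  Y.ker_injective k <| by
    rw [Y.ker_br, ker_kernelMap, ker_kernelMap, ker_kernelMap, ← OpLie.hom_br]
    congr 1
    apply pullback_hom_ext
    · rw [OpLie.hom_br, fst_pair, fst_pair, map_zero, LinearMap.zero_apply]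
    · rw [OpLie.hom_br, snd_pair, snd_pair, snd_pair, X.ker_br]

/-- Compatibility of φ with sections turns the action of a letter of `E` on `Y` into its action on
the pullback, which on the component in `X` is the action of its image under q. -/
theorem kernelMap_act (hs : pullbackSection q X ≫ φ = Y.s) (a : E.Letter) (i k : Γ)
    (h : a.dg + i = k) (h' : (a.map q).dg + i = k) (x : X.kernel.V i) :
    kernelMap φ hp k (X.kernel.act (a.map q) i k h' x) =
      Y.kernel.act a i k h (kernelMap φ hp i x) :=
  Y.ker_injective k <| by
    have d₁ : (a.map Y.s).dg + i = k := by rw [a.dg_map, h]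
    have d₂ : ((a.map q).map X.s).dg + i = k := by rw [OpLie.Letter.dg_map, h']
    have d₃ : (a.map (pullbackSection q X)).dg + i = k := by rw [a.dg_map, h]
    have e₁ := OpLie.hom_act φ (a.map (pullbackSection q X)) i k d₃
      (pair 0 (X.ker i x) (map_zero_eq_p_ker q x))
    rw [OpLie.act_congr ((OpLie.Letter.map_map _ _ a).trans (by rw [hs])) i k _ d₁] at e₁
    rw [Y.ker_act a i k h d₁, ker_kernelMap, ker_kernelMap, ← e₁]
    congr 1
    apply pullback_hom_ext
    · rw [fst_pair, OpLie.hom_act, fst_pair, map_zero]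
    · rw [snd_pair, X.ker_act _ _ _ _ d₂, OpLie.hom_act, snd_pair]
      refine OpLie.act_congr ?_ ..
      rw [OpLie.Letter.map_map, OpLie.Letter.map_map, pullbackSection_snd]

/-- The pullback splits as the image of its section plus the kernel of `X.p`, so a morphism of
points out of it is determined by its `kernelMap`. -/
theorem eq_section_add_pair {i : Γ} (z : (pullback q X.p).V i) :
    z = OpLie.Hom.f (pullbackSection q X) i (OpLie.Hom.f (pullback.fst q X.p) i z) +
      pair 0 (X.ker i (X.π i (OpLie.Hom.f (pullback.snd q X.p) i z))) (map_zero_eq_p_ker q _) := by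
  apply pullback_hom_ext
  · rw [map_add, ← OpLie.comp_f (pullbackSection q X), pullbackSection_fst, fst_pair, OpLie.id_f,
      add_zero]
  · rw [map_add, ← OpLie.comp_f (pullbackSection q X), pullbackSection_snd, snd_pair, OpLie.comp_f,
      X.ker_π, OpLie.pullback_condition_apply, add_sub_cancel]

end KernelMap

/-! The counit. -/

variable [Small.{u} Γ] (Y : Pt E) (hδ : ∀ ω, c.e (δ ω) (δ ω) = -1)

/-- The underlying function on words. -/
noncomputable def cofreeι (i : Γ) : (cofree q Y.kernel hδ).V i →ₗ[R]
    WFun Y.kernel.toGLie (OpLie.Letter.dg (L := B)) i := Submodule.subtype _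

theorem cofreeι_injective (i : Γ) : Function.Injective (cofreeι q Y hδ i) := Subtype.val_injective

theorem cofreeι_act (a : B.Letter) (i k : Γ) (h : a.dg + i = k) (x : (cofree q Y.kernel hδ).V i) :
    cofreeι q Y hδ k ((cofree q Y.kernel hδ).act a i k h x) =
      WFun.act a i k h (cofreeι q Y hδ i x) := rfl

theorem isRel_cofreeι (i : Γ) (x : (cofree q Y.kernel hδ).V i) :
    IsRel q Y.kernel i (cofreeι q Y hδ i x) :=
  isRel_of_mem_good x.2

/-- Evaluation at the empty word. -/
noncomputable def cofreeEv (i : Γ) : (cofree q Y.kernel hδ).V i →ₗ[R] Y.A.V i :=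
  Y.ker i ∘ₗ WFun.app [] i i (zero_add i) ∘ₗ cofreeι q Y hδ i

theorem cofreeEv_br (i j k : Γ) (h : i + j = k) (x : (cofree q Y.kernel hδ).V i)
    (y : (cofree q Y.kernel hδ).V j) :
    cofreeEv q Y hδ k ((cofree q Y.kernel hδ).br i j k h x y) =
      Y.A.br i j k h (cofreeEv q Y hδ i x) (cofreeEv q Y hδ j y) :=
  (congrArg (Y.ker k) (WFun.app_nil_br ..)).trans (Y.ker_br ..)

theorem cofreeEv_act (a : E.Letter) (i k : Γ) (h : (a.map q).dg + i = k)
    (h' : (a.map Y.s).dg + i = k) (x : (cofree q Y.kernel hδ).V i) :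
    cofreeEv q Y hδ k ((cofree q Y.kernel hδ).act (a.map q) i k h x) =
      OpLie.act (a.map Y.s) i k h' (cofreeEv q Y hδ i x) :=
  have h'' : a.dg + i = k := by rw [← h, a.dg_map]
  (congrArg (Y.ker k) ((isRel_cofreeι q Y hδ i x).ev a k h'' h)).trans (Y.ker_act _ _ _ _ h' _)

theorem p_cofreeEv (i : Γ) (x : (cofree q Y.kernel hδ).V i) :
    OpLie.Hom.f Y.p i (cofreeEv q Y hδ i x) = 0 := Y.p_ker ..

end Adjoint

end InternalLie

namespace InternalLie

/-! ### The counit and its couniversal property. -/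

section Couniversal

variable {Γ : Type w} [AddCommGroup Γ] {R : Type u} [CommRing R] {Ω : Type}
  {c : CommutationFactor Γ R} {δ : Ω → Γ} {B E : OpLie c δ}

open OpLie (elt opr pair fst_pair snd_pair pullback_hom_ext)

namespace LieAction

variable (G : LieAction B)

/-- The projection of the semidirect product to the second component. -/
def snd (i : Γ) : G.point.A.V i →ₗ[R] G.V i := LinearMap.snd R _ _

theorem point_ext {i : Γ} {x y : G.point.A.V i}
    (h₁ : OpLie.Hom.f G.point.p i x = OpLie.Hom.f G.point.p i y) (h₂ : G.snd i x = G.snd i y) :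
    x = y :=
  Prod.ext h₁ h₂

theorem snd_br (i j k : Γ) (h : i + j = k) (h' : j + i = k) (x : G.point.A.V i)
    (y : G.point.A.V j) : G.snd k (G.point.A.br i j k h x y) =
      G.act (elt (OpLie.Hom.f G.point.p i x)) j k h (G.snd j y) -
        c.e i j • G.act (elt (OpLie.Hom.f G.point.p j y)) i k h' (G.snd i x) +
        G.br i j k h (G.snd i x) (G.snd j y) := rfl

theorem snd_op (ω : Ω) (i k : Γ) (h : δ ω + i = k) (x : G.point.A.V i) :
    G.snd k (G.point.A.op ω i k h x) = G.act (B.opr ω) i k h (G.snd i x) := rfl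

theorem snd_s (i : Γ) (b : B.V i) : G.snd i (OpLie.Hom.f G.point.s i b) = 0 := rfl

theorem snd_act (a : B.Letter) (i k : Γ) (h : (a.map G.point.s).dg + i = k) (h' : a.dg + i = k)
    (x : G.point.A.V i) :
    G.snd k (OpLie.act (a.map G.point.s) i k h x) = G.act a i k h' (G.snd i x) := by
  rcases a with ⟨l, b⟩ | ω
  · refine (G.snd_br l i k h' ((add_comm i l).trans h') (OpLie.Hom.f G.point.s l b) x).trans ?_
    rw [snd_s, map_zero, map_zero, LinearMap.zero_apply, smul_zero, sub_zero, add_zero]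
    rfl
  · exact G.snd_op ω i k h' x

end LieAction

/-- The action of letters on a point. -/
abbrev Pt.letterAct (X : Pt B) (a : B.Letter) (i k : Γ) (h : a.dg + i = k) : X.A.V i →ₗ[R] X.A.V k :=
  OpLie.act (a.map X.s) i k ((congrArg (· + i) (a.dg_map X.s)).trans h)

theorem Pt.s_p_act (X : Pt B) (a : B.Letter) (i k : Γ) (h : (a.map X.s).dg + i = k) (x : X.A.V i) :
    OpLie.Hom.f X.s k (OpLie.Hom.f X.p k (OpLie.act (a.map X.s) i k h x)) =
      OpLie.act (a.map X.s) i k h (OpLie.Hom.f X.s i (OpLie.Hom.f X.p i x)) := by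
  rw [X.p_act a i k h (by rw [← h, a.dg_map]), OpLie.hom_act]

variable [Small.{u} Γ] (q : E ⟶ B) (Y : Pt E) (hδ : ∀ ω, c.e (δ ω) (δ ω) = -1)

/-- The underlying morphism of the counit. -/
noncomputable def counit : pullback q (cofree q Y.kernel hδ).point.p ⟶ Y.A :=
  OpLie.Hom.mk (fun i => OpLie.Hom.f Y.s i ∘ₗ OpLie.Hom.f (pullback.fst q _) i +
      cofreeEv q Y hδ i ∘ₗ (cofree q Y.kernel hδ).snd i ∘ₗ OpLie.Hom.f (pullback.snd q _) i)
    (fun i j k h x y => by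
      have h' : j + i = k := (add_comm j i).trans h
      simp only [LinearMap.add_apply, LinearMap.comp_apply, OpLie.hom_br]
      rw [LieAction.snd_br _ i j k h h', ← OpLie.pullback_condition_apply,
        ← OpLie.pullback_condition_apply]
      simp only [map_add, map_sub, map_smul, LinearMap.add_apply]
      -- By the pullback condition the elements of `B` acting here come from `E` along q, and for
      -- these evaluation at the empty word is equivariant.
      have e₁ := cofreeEv_act q Y hδ (elt (OpLie.Hom.f (pullback.fst q _) i x)) j k h h
        ((cofree q Y.kernel hδ).snd j (OpLie.Hom.f (pullback.snd q _) j y))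
      have e₂ := cofreeEv_act q Y hδ (elt (OpLie.Hom.f (pullback.fst q _) j y)) i k h' h'
        ((cofree q Y.kernel hδ).snd i (OpLie.Hom.f (pullback.snd q _) i x))
      refine (congrArg₂ _ rfl (congrArg₂ _ (congrArg₂ _ e₁ (congrArg _ e₂))
        (cofreeEv_br q Y hδ i j k h _ _))).trans ?_
      change _ + (Y.A.br i j k h (OpLie.Hom.f Y.s i _) _ -
        _ • Y.A.br j i k h' (OpLie.Hom.f Y.s j _) _ + _) = _
      rw [Y.A.skew j i k h' h, smul_neg, smul_smul, c.e_mul_e, one_smul]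
      abel)
    (fun ω i k h x => by
      simp only [LinearMap.add_apply, LinearMap.comp_apply, OpLie.hom_op, map_add]
      rw [LieAction.snd_op]
      exact congrArg _ (cofreeEv_act q Y hδ (E.opr ω) i k h h _))

theorem counit_apply (i : Γ) (z : (pullback q (cofree q Y.kernel hδ).point.p).V i) :
    OpLie.Hom.f (counit q Y hδ) i z = OpLie.Hom.f Y.s i (OpLie.Hom.f (pullback.fst q _) i z) +
      cofreeEv q Y hδ i ((cofree q Y.kernel hδ).snd i (OpLie.Hom.f (pullback.snd q _) i z)) := rfl

theorem counit_p : counit q Y hδ ≫ Y.p = pullback.fst q _ :=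
  OpLie.hom_ext fun i z => by
    rw [OpLie.comp_f, counit_apply, map_add, Y.sp_apply, p_cofreeEv, add_zero]

theorem s_counit : pullbackSection q _ ≫ counit q Y hδ = Y.s :=
  OpLie.hom_ext fun i x => by
    rw [OpLie.comp_f, counit_apply, ← OpLie.comp_f (pullbackSection q _),
      ← OpLie.comp_f (pullbackSection q _), pullbackSection_fst, pullbackSection_snd,
      OpLie.comp_f, LieAction.snd_s, map_zero, add_zero, OpLie.id_f]

/-! ### Transposition of a morphism of points out of a pullback. -/

section Lift

variable {q Y} {X : Pt B} (φ : pullback q X.p ⟶ Y.A) (hp : φ ≫ Y.p = pullback.fst q X.p)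

/-- The function on words given by an element of a point. -/
noncomputable def wordLift (i : Γ) :
    X.A.V i →ₗ[R] WFun Y.kernel.toGLie (OpLie.Letter.dg (L := B)) i :=
  -- Projecting with π before applying `kernelMap` defines the lift on all of `X.A`; it vanishes on
  -- the image of the section by `wordLift_s`.
  WFun.lift X.letterAct (fun i => kernelMap φ hp i ∘ₗ X.π i) i

theorem act_wordLift (a : B.Letter) (i k : Γ) (h : a.dg + i = k) (h' : (a.map X.s).dg + i = k)
    (x : X.A.V i) :
    WFun.act a i k h (wordLift φ hp i x) = wordLift φ hp k (OpLie.act (a.map X.s) i k h' x) :=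
  WFun.act_lift ..

theorem app_nil_wordLift (i : Γ) (x : X.A.V i) :
    WFun.app [] i i (zero_add i) (wordLift φ hp i x) = kernelMap φ hp i (X.π i x) :=
  WFun.app_nil_lift ..

theorem wordLift_s (i : Γ) (b : B.V i) : wordLift φ hp i (OpLie.Hom.f X.s i b) = 0 :=
  WFun.lift_eq_zero (fun i => Set.range (OpLie.Hom.f X.s i))
    (fun a i k h x hx => by
      obtain ⟨b, rfl⟩ := hx
      exact ⟨OpLie.act a i k h b, OpLie.hom_act X.s a i k h b⟩)
    (fun i x hx => by
      obtain ⟨b, rfl⟩ := hx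
      rw [LinearMap.comp_apply, X.π_s, map_zero]) i _ ⟨b, rfl⟩

/-- Subtracting the two mixed terms leaves the bracket of the kernel components up to an element of
the image of s. Letters still act by derivations on this modified bracket, and `Pt.π_br` gives its
value at the empty word. -/
theorem wordLift_br (i j k : Γ) (h : i + j = k) (x : X.A.V i) (y : X.A.V j) :
    wordLift φ hp k (X.A.br i j k h x y -
        X.A.br i j k h (OpLie.Hom.f X.s i (OpLie.Hom.f X.p i x)) y -
        X.A.br i j k h x (OpLie.Hom.f X.s j (OpLie.Hom.f X.p j y))) =
      WFun.br i j k h (wordLift φ hp i x) (wordLift φ hp j y) :=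
  WFun.lift_br (fun i j k h x y => X.A.br i j k h x y -
        X.A.br i j k h (OpLie.Hom.f X.s i (OpLie.Hom.f X.p i x)) y -
        X.A.br i j k h x (OpLie.Hom.f X.s j (OpLie.Hom.f X.p j y)))
    (fun a i j k i' j' m h hk hi hj h₁ h₂ x y => by
      have hk' : (a.map X.s).dg + k = m := by rw [a.dg_map, hk]
      have hi' : (a.map X.s).dg + i = i' := by rw [a.dg_map, hi]
      have hj' : (a.map X.s).dg + j = j' := by rw [a.dg_map, hj]
      rw [map_sub, map_sub, OpLie.act_br (a.map X.s) i j k i' j' m h hk' hi' hj' h₁ h₂,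
        OpLie.act_br (a.map X.s) i j k i' j' m h hk' hi' hj' h₁ h₂,
        OpLie.act_br (a.map X.s) i j k i' j' m h hk' hi' hj' h₁ h₂, X.s_p_act, X.s_p_act, a.dg_map]
      module)
    (fun i j k h x y => by
      rw [LinearMap.comp_apply, X.π_br, kernelMap_br]
      rfl) i j k h x y

/-- Translating the lift of x gives the lift of a translate of x, so the relations of an action are
inherited from `X.A`. Compatibility of φ with sections is needed only for `ev`. -/
theorem isRel_wordLift (hs : pullbackSection q X ≫ φ = Y.s) (i : Γ) (x : X.A.V i) :
    IsRel q Y.kernel i (wordLift φ hp i x) where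
  act_add l k h b b' := by
    rw [act_wordLift φ hp (elt (b + b')) i k h h, act_wordLift φ hp (elt b) i k h h,
      act_wordLift φ hp (elt b') i k h h, ← map_add]
    refine congrArg _ ((congrArg (fun t => X.A.br l i k h t x)
      (map_add (OpLie.Hom.f X.s l) b b')).trans ?_)
    rw [map_add]
    rfl
  act_smul l k h r b := by
    rw [act_wordLift φ hp (elt (r • b)) i k h h, act_wordLift φ hp (elt b) i k h h, ← map_smul]
    refine congrArg _ ((congrArg (fun t => X.A.br l i k h t x)
      (map_smul (OpLie.Hom.f X.s l) r b)).trans ?_)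
    rw [map_smul]
    rfl
  act_act a l m ai li k hm hk hai hli h₁ h₂ b := by
    have hai' : (a.map X.s).dg + i = ai := by rw [a.dg_map, hai]
    have h₁' : (a.map X.s).dg + li = k := by rw [a.dg_map, h₁]
    have hm' : (a.map X.s).dg + l = m := by rw [a.dg_map, hm]
    rw [act_wordLift φ hp (elt (OpLie.act a l m hm b)) i k hk hk,
      act_wordLift φ hp (elt b) i li hli hli, act_wordLift φ hp a i ai hai hai',
      act_wordLift φ hp a li k h₁ h₁', act_wordLift φ hp (elt b) ai k h₂ h₂, ← map_smul, ← map_sub]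
    refine congrArg _ ((congrArg (fun t => X.A.br m i k hk t x)
      (OpLie.hom_act X.s a l m hm b)).trans ?_)
    refine (OpLie.br_act (a.map X.s) l m i ai li k hm' hk hai' hli h₁' h₂
      (OpLie.Hom.f X.s l b) x).trans ?_
    rcases a with ⟨_, _⟩ | _ <;> rfl
  op_op ω j k hi hj := by
    rw [act_wordLift φ hp (B.opr ω) i j hi hi, act_wordLift φ hp (B.opr ω) j k hj hj]
    exact (congrArg _ (X.A.op_op ω i j k hi hj x)).trans (map_zero _)
  ev a k h h' := by
    have h'' : ((a.map q).map X.s).dg + i = k := by rw [OpLie.Letter.dg_map, h']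
    rw [act_wordLift φ hp (a.map q) i k h' h'', app_nil_wordLift, app_nil_wordLift,
      X.π_act _ i k h' h'', kernelMap_act φ hp hs a i k h h']

/-- The ranges of `wordLift` form a stable family, so maximality of `good` applies. -/
theorem wordLift_mem_good (hs : pullbackSection q X ≫ φ = Y.s) (i : Γ) (x : X.A.V i) :
    wordLift φ hp i x ∈ good q Y.kernel i := by
  refine le_good q Y.kernel (S := fun i => LinearMap.range (wordLift φ hp i)) ⟨?_, ?_⟩ i ⟨x, rfl⟩
  · rintro a i k h _ ⟨x, rfl⟩
    exact ⟨_, (act_wordLift φ hp a i k h (by rw [a.dg_map, h]) x).symm⟩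
  · rintro i _ ⟨x, rfl⟩
    exact isRel_wordLift φ hp hs i x

/-- The morphism to the semidirect product induced by a morphism out of a pullback. -/
noncomputable def transpose (hs : pullbackSection q X ≫ φ = Y.s) :
    X.A ⟶ (cofree q Y.kernel hδ).point.A :=
  OpLie.Hom.mk (fun i => LinearMap.prod (OpLie.Hom.f X.p i)
      ((wordLift φ hp i).codRestrict _ (wordLift_mem_good φ hp hs i)))
    (fun i j k h x y => by
      have h' : j + i = k := (add_comm j i).trans h
      refine LieAction.point_ext _ (OpLie.hom_br X.p i j k h x y) ?_
      rw [LieAction.snd_br _ i j k h h']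
      refine cofreeι_injective q Y hδ k ?_
      rw [map_add, map_sub, map_smul]
      change wordLift φ hp k _ = WFun.act (elt (OpLie.Hom.f X.p i x)) j k h (wordLift φ hp j y) -
        c.e i j • WFun.act (elt (OpLie.Hom.f X.p j y)) i k h' (wordLift φ hp i x) +
        WFun.br i j k h (wordLift φ hp i x) (wordLift φ hp j y)
      rw [act_wordLift φ hp (elt (OpLie.Hom.f X.p i x)) j k h h,
        act_wordLift φ hp (elt (OpLie.Hom.f X.p j y)) i k h' h', ← wordLift_br, map_sub, map_sub]
      change _ = wordLift φ hp k (X.A.br i j k h (OpLie.Hom.f X.s i _) y) -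
        c.e i j • wordLift φ hp k (X.A.br j i k h' (OpLie.Hom.f X.s j _) x) + _
      -- The two action terms of the semidirect bracket restore the mixed terms removed in
      -- `wordLift_br`, once [x, s(p y)] is rewritten by skew symmetry.
      rw [X.A.skew i j k h h' x (OpLie.Hom.f X.s j _), map_neg, map_smul]
      abel)
    (fun ω i k h x => by
      refine LieAction.point_ext _ (OpLie.hom_op X.p ω i k h x) ?_
      rw [LieAction.snd_op]
      exact cofreeι_injective q Y hδ k (act_wordLift φ hp (B.opr ω) i k h h x).symm)

variable (hs : pullbackSection q X ≫ φ = Y.s)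

theorem cofreeEv_transpose (i : Γ) (x : X.A.V i) :
    cofreeEv q Y hδ i ((cofree q Y.kernel hδ).snd i (OpLie.Hom.f (transpose hδ φ hp hs) i x)) =
      Y.ker i (kernelMap φ hp i (X.π i x)) :=
  congrArg (Y.ker i) (app_nil_wordLift φ hp i x)

/-- The morphism of points induced by a morphism out of a pullback. -/
noncomputable def transposeHom : X ⟶ (cofree q Y.kernel hδ).point :=
  Pt.Hom.mk (transpose hδ φ hp hs) rfl <| OpLie.hom_ext fun i b =>
    LieAction.point_ext _ (X.sp_apply i b) (cofreeι_injective q Y hδ i (wordLift_s φ hp i b))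

theorem transpose_counit (ψ : pullback q X.p ⟶ pullback q (cofree q Y.kernel hδ).point.p)
    (h₁ : ψ ≫ pullback.fst q _ = pullback.fst q X.p)
    (h₂ : ψ ≫ pullback.snd q _ = pullback.snd q X.p ≫ transpose hδ φ hp hs) :
    ψ ≫ counit q Y hδ = φ :=
  OpLie.hom_ext fun i z => by
    rw [OpLie.comp_f, counit_apply, ← OpLie.comp_f ψ, ← OpLie.comp_f ψ, h₁, h₂,
      OpLie.comp_f _ (transpose ..), cofreeEv_transpose, ker_kernelMap, ← hs, OpLie.comp_f, ← map_add, ← eq_section_add_pair]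

/-- Since χ commutes with sections, its second component is equivariant for letters; the condition
on the counit fixes its value at the empty word, and `WFun.lift_unique` concludes. -/
theorem eq_transpose (ψ : pullback q X.p ⟶ pullback q (cofree q Y.kernel hδ).point.p)
    (χ : X ⟶ (cofree q Y.kernel hδ).point)
    (h₁ : ψ ≫ pullback.fst q _ = pullback.fst q X.p)
    (h₂ : ψ ≫ pullback.snd q _ = pullback.snd q X.p ≫ χ.f) (h : ψ ≫ counit q Y hδ = φ) :
    χ = transposeHom hδ φ hp hs := by
  have hχp (i : Γ) (x : X.A.V i) :
      OpLie.Hom.f (cofree q Y.kernel hδ).point.p i (OpLie.Hom.f χ.f i x) = OpLie.Hom.f X.p i x :=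
    congrArg (fun φ : X.A ⟶ B => OpLie.Hom.f φ i x) χ.comp_p
  have hχs (i : Γ) (b : B.V i) : OpLie.Hom.f χ.f i (OpLie.Hom.f X.s i b) =
      OpLie.Hom.f (cofree q Y.kernel hδ).point.s i b :=
    congrArg (fun φ : B ⟶ (cofree q Y.kernel hδ).point.A => OpLie.Hom.f φ i b) χ.s_comp
  refine Pt.hom_ext (OpLie.hom_ext fun i x => LieAction.point_ext _ (hχp i x)
    (cofreeι_injective q Y hδ i ?_))
  refine WFun.lift_unique (T := X.letterAct) (θ := fun i => kernelMap φ hp i ∘ₗ X.π i)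
    (fun i x => cofreeι q Y hδ i ((cofree q Y.kernel hδ).snd i (OpLie.Hom.f χ.f i x)))
    (fun a i k h x => ?_) (fun i x => ?_) i x
  · have ha : (a.map X.s).dg + i = k := by rw [a.dg_map, h]
    have ha' : (a.map (cofree q Y.kernel hδ).point.s).dg + i = k := by rw [a.dg_map, h]
    rw [← cofreeι_act, ← LieAction.snd_act _ a i k ha' h]
    refine congrArg _ (congrArg _ (Eq.symm ((OpLie.hom_act χ.f (a.map X.s) i k ha x).trans ?_)))
    refine OpLie.act_congr ?_ ..
    rw [OpLie.Letter.map_map, χ.s_comp]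
  · refine Y.ker_injective i ?_
    -- The condition is evaluated at the element (0, x - s(p x)) of the pullback, where the summand
    -- of the counit coming from `E` vanishes.
    rw [LinearMap.comp_apply, ker_kernelMap, ← h, OpLie.comp_f, counit_apply, ← OpLie.comp_f ψ,
      ← OpLie.comp_f ψ, h₁, h₂, OpLie.comp_f, fst_pair, snd_pair, map_zero, zero_add, X.ker_π, map_sub,
      map_sub, hχs, LieAction.snd_s, sub_zero]
    rfl

end Lift

theorem isLACC_opLie (hδ : ∀ ω, c.e (δ ω) (δ ω) = -1) : IsLACC (OpLie.{u} c δ) := by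
  refine ⟨inferInstance, fun {E B} q => isLeftAdjoint_of_couniversal _ fun Y =>
    ⟨(cofree q Y.kernel hδ).point, ⟨counit q Y hδ, counit_p q Y hδ, s_counit q Y hδ⟩,
      fun X φ => ⟨transposeHom hδ φ.f φ.comp_p φ.s_comp, Pt.hom_ext ?_, fun χ hχ => ?_⟩⟩⟩
  · exact transpose_counit hδ φ.f φ.comp_p φ.s_comp _ (pullback.lift_fst _ _ _)
      (pullback.lift_snd _ _ _)
  · exact eq_transpose hδ φ.f φ.comp_p φ.s_comp _ χ (pullback.lift_fst _ _ _)
      (pullback.lift_snd _ _ _) (congrArg Pt.Hom.f hχ)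

end Couniversal

end InternalLie

namespace InternalLie

/-! ### Invariance of local algebraic cartesian closedness under equivalences -/

section Transfer

variable {C : Type*} [Category* C] {D : Type*} [Category* D]

/-- An isomorphism of points. -/
def Pt.isoMk {B : C} {X Y : Pt B} (e : X.A ≅ Y.A) (hp : e.hom ≫ Y.p = X.p)
    (hs : X.s ≫ e.hom = Y.s) : X ≅ Y where
  hom := ⟨e.hom, hp, hs⟩
  inv := ⟨e.inv, by rw [← hp, e.inv_hom_id_assoc], by rw [← hs, Category.assoc, e.hom_inv_id,
    Category.comp_id]⟩
  hom_inv_id := Pt.hom_ext e.hom_inv_id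
  inv_hom_id := Pt.hom_ext e.inv_hom_id

variable (F : D ⥤ C)

/-- The functor induced on points. -/
def Pt.mapFunctor (B : D) : Pt B ⥤ Pt (F.obj B) where
  obj X := ⟨F.obj X.A, F.map X.p, F.map X.s, by rw [← F.map_comp, X.sp, F.map_id]⟩
  map f := ⟨F.map f.f, (F.map_comp _ _).symm.trans (congrArg F.map f.comp_p),
    (F.map_comp _ _).symm.trans (congrArg F.map f.s_comp)⟩
  map_id _ := Pt.hom_ext (F.map_id _)
  map_comp _ _ := Pt.hom_ext (F.map_comp _ _)

instance [F.Faithful] (B : D) : (Pt.mapFunctor F B).Faithful where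
  map_injective h := Pt.hom_ext (F.map_injective (congrArg Pt.Hom.f h))

instance [F.Full] [F.Faithful] (B : D) : (Pt.mapFunctor F B).Full where
  map_surjective {X Y} f :=
    ⟨⟨F.preimage (X := X.A) (Y := Y.A) f.f, F.map_injective <| (F.map_comp _ _).trans <|
        (congrArg (· ≫ F.map Y.p) (F.map_preimage _)).trans f.comp_p,
      F.map_injective <| (F.map_comp _ _).trans <|
        (congrArg (F.map X.s ≫ ·) (F.map_preimage _)).trans f.s_comp⟩,
      Pt.hom_ext (F.map_preimage f.f)⟩

instance [F.IsEquivalence] (B : D) : (Pt.mapFunctor F B).EssSurj where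
  mem_essImage Y := by
    let e := F.objObjPreimageIso Y.A
    refine ⟨⟨F.objPreimage Y.A, F.preimage (e.hom ≫ Y.p), F.preimage (Y.s ≫ e.inv),
      F.map_injective ?_⟩, ⟨Pt.isoMk e ?_ ?_⟩⟩
    · rw [F.map_comp, F.map_preimage, F.map_preimage, Category.assoc, e.inv_hom_id_assoc, Y.sp,
        F.map_id]
    · exact (F.map_preimage _).symm
    · exact (congrArg (· ≫ e.hom) (F.map_preimage (Y.s ≫ e.inv))).trans (by simp)

instance [F.IsEquivalence] (B : D) : (Pt.mapFunctor F B).IsEquivalence where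

variable {F} in
-- With h the identity and k = q ≫ s, this says that the comparison isomorphism of pullbacks
-- respects sections; `map_lift_iso'` is its naturality.
theorem map_lift_iso [HasPullbacks C] [HasPullbacks D] [PreservesLimitsOfShape WalkingCospan F]
    {W X Y Z : D} {f : X ⟶ Z} {g : Y ⟶ Z} {h : W ⟶ X} {k : W ⟶ Y} {h' : F.obj W ⟶ F.obj X}
    {k' : F.obj W ⟶ F.obj Y} (hh : F.map h = h') (hk : F.map k = k') (w : h ≫ f = k ≫ g)
    (w' : h' ≫ F.map f = k' ≫ F.map g) :
    F.map (pullback.lift h k w) ≫ (PreservesPullback.iso F f g).hom = pullback.lift h' k' w' := by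
  apply pullback.hom_ext
  · rw [Category.assoc, PreservesPullback.iso_hom_fst, ← F.map_comp, pullback.lift_fst,
      pullback.lift_fst, hh]
  · rw [Category.assoc, PreservesPullback.iso_hom_snd, ← F.map_comp, pullback.lift_snd,
      pullback.lift_snd, hk]

variable {F} in
theorem map_lift_iso' [HasPullbacks C] [HasPullbacks D] [PreservesLimitsOfShape WalkingCospan F]
    {X Y Y' Z : D} {f : X ⟶ Z} {g : Y ⟶ Z} {g' : Y' ⟶ Z} (k : Y ⟶ Y')
    (w : pullback.fst f g ≫ f = (pullback.snd f g ≫ k) ≫ g')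
    (w' : pullback.fst (F.map f) (F.map g) ≫ F.map f =
      (pullback.snd (F.map f) (F.map g) ≫ F.map k) ≫ F.map g') :
    F.map (pullback.lift _ _ w) ≫ (PreservesPullback.iso F f g').hom =
      (PreservesPullback.iso F f g).hom ≫ pullback.lift _ _ w' := by
  apply pullback.hom_ext
  · rw [Category.assoc, Category.assoc, PreservesPullback.iso_hom_fst, pullback.lift_fst,
      PreservesPullback.iso_hom_fst, ← F.map_comp, pullback.lift_fst]
  · rw [Category.assoc, Category.assoc, PreservesPullback.iso_hom_snd, pullback.lift_snd,
      PreservesPullback.iso_hom_snd_assoc, ← F.map_comp, pullback.lift_snd, F.map_comp]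

/-- Change of base commutes with functors preserving pullbacks. -/
noncomputable def changeOfBaseMap [HasPullbacks C] [HasPullbacks D]
    [PreservesLimitsOfShape WalkingCospan F] {E B : D} (q : E ⟶ B) :
    changeOfBase q ⋙ Pt.mapFunctor F E ≅ Pt.mapFunctor F B ⋙ changeOfBase (F.map q) :=
  NatIso.ofComponents
    (fun X => Pt.isoMk (PreservesPullback.iso F q X.p) (PreservesPullback.iso_hom_fst F q X.p)
      (map_lift_iso (F.map_id _) (F.map_comp _ _) _ _))
    (fun f => Pt.hom_ext (map_lift_iso' f.f _ _))

/-- Change of base along q is, up to equivalences between categories of points, change of base along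
`F.map q`, and left adjoints compose. -/
theorem IsLACC.of_isEquivalence [F.IsEquivalence] (h : IsLACC C) : IsLACC D := by
  obtain ⟨h₁, h₂⟩ := h
  have h₃ : HasFiniteLimits D := ⟨fun J _ _ => Adjunction.hasLimitsOfShape_of_equivalence F⟩
  refine ⟨h₃, fun {E B} q => ?_⟩
  have := h₂ (F.map q)
  have e : changeOfBase q ≅ (Pt.mapFunctor F B ⋙ changeOfBase (F.map q)) ⋙ (Pt.mapFunctor F E).inv :=
    (Functor.rightUnitor _).symm ≪≫
      Functor.isoWhiskerLeft _ (Pt.mapFunctor F E).asEquivalence.unitIso ≪≫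
      (Functor.associator _ _ _).symm ≪≫
      Functor.isoWhiskerRight (changeOfBaseMap F q) _
  exact Functor.isLeftAdjoint_of_iso e.symm

end Transfer

end InternalLie

namespace InternalLie

/-! ### Lie colour algebras and differential graded Lie algebras are locally algebraically cartesian
closed -/

section Colour

variable {Γ : Type w} [AddCommGroup Γ] {R : Type u} [CommRing R]

/-- Here x, y, z stand for [x,[y,z]], [y,[x,z]] and [[x,y],z]: in the cyclic identity, skew symmetry
has been applied to the inner bracket of the second term and the outer bracket of the third.
Multiplying by ε(i,l), the inverse of ε(l,i), gives the Leibniz form. -/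
theorem CommutationFactor.cyclic_iff_leibniz (c : CommutationFactor Γ R) {M : Type*}
    [AddCommGroup M] [Module R M] {i j l ij : Γ} (h : i + j = ij) (x y z : M) :
    c.e l i • x + c.e i j • -(c.e l i • y) + c.e j l • -(c.e l ij • z) = 0 ↔
      x = z + c.e i j • y := by
  rw [c.e_right l h]
  constructor
  · intro H
    have := congrArg (c.e i l • ·) H
    simp only [smul_zero] at this
    linear_combination (norm := module) this - (c.e_mul_e i l) • x + (c.e i j * c.e_mul_e i l) • y +
      (c.e i l * c.e l i * c.e_mul_e j l) • z + c.e_mul_e i l • z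
  · rintro rfl
    linear_combination (norm := module) -(c.e l i * c.e_mul_e j l) • z

variable {c : CommutationFactor Γ R}

/-- The Lie algebra in Leibniz form underlying a Lie algebra in cyclic form. -/
def GLie.ofCyclic {V : Γ → Type u} [∀ i, AddCommGroup (V i)] [∀ i, Module R (V i)]
    (br : ∀ i j k : Γ, i + j = k → (V i →ₗ[R] V j →ₗ[R] V k))
    (skew : ∀ (i j k : Γ) (h : i + j = k) (h' : j + i = k) (x : V i) (y : V j),
      br i j k h x y = -(c.e i j • br j i k h' y x))
    (jac : ∀ (i j l ij jl li n : Γ) (hij : i + j = ij) (hjl : j + l = jl) (hli : l + i = li)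
      (h₁ : i + jl = n) (h₂ : j + li = n) (h₃ : l + ij = n) (x : V i) (y : V j) (z : V l),
      c.e l i • br i jl n h₁ x (br j l jl hjl y z) + c.e i j • br j li n h₂ y (br l i li hli z x) +
        c.e j l • br l ij n h₃ z (br i j ij hij x y) = 0) : GLie.{u} c where
  V := V
  br := br
  skew := skew
  jac i j l ij jl il n hij hjl hil h₁ h₂ h₃ x y z := by
    have hli : l + i = il := (add_comm l i).trans hil
    have h₄ : l + ij = n := (add_comm l ij).trans h₂
    rw [← c.cyclic_iff_leibniz hij, ← jac i j l ij jl il n hij hjl hli h₁ h₃ h₄ x y z,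
      skew l i il hli hil z x, skew l ij n h₄ h₂ z, map_neg, map_smul]

theorem GLie.cyclic (L : GLie.{u} c) (i j l ij jl li n : Γ) (hij : i + j = ij) (hjl : j + l = jl)
    (hli : l + i = li) (h₁ : i + jl = n) (h₂ : j + li = n) (h₃ : l + ij = n) (x : L.V i) (y : L.V j)
    (z : L.V l) : c.e l i • L.br i jl n h₁ x (L.br j l jl hjl y z) +
      c.e i j • L.br j li n h₂ y (L.br l i li hli z x) +
        c.e j l • L.br l ij n h₃ z (L.br i j ij hij x y) = 0 := by
  have hil : i + l = li := (add_comm i l).trans hli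
  have h₄ : ij + l = n := (add_comm ij l).trans h₃
  rw [L.skew l i li hli hil z x, L.skew l ij n h₃ h₄ z, map_neg, map_smul,
    c.cyclic_iff_leibniz hij]
  exact L.jac i j l ij jl li n hij hjl hil h₁ h₄ h₂ x y z

variable (c) in
/-- Lie colour algebras, as Lie algebras without operators. -/
def colourToOpLie : LieColourAlg c ⥤ OpLie.{u} c (Empty.elim : Empty → Γ) where
  obj L :=
    { GLie.ofCyclic (c := c) (V := fun i => L.V i) L.bracket L.skew L.jacobi with
      op := fun ω => ω.elim
      op_br := fun ω => ω.elim
      op_op := fun ω => ω.elim }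
  map f := OpLie.Hom.mk (fun i => (f.f i).hom) f.map_bracket fun ω => ω.elim

instance : (colourToOpLie c).Faithful where
  map_injective h := LieColourAlg.Hom.ext <| funext fun i =>
    ModuleCat.hom_ext (congrFun (congrArg OpLie.Hom.f h) i)

instance : (colourToOpLie c).Full where
  map_surjective f :=
    ⟨LieColourAlg.Hom.mk (fun i => ModuleCat.ofHom (OpLie.Hom.f f i)) (OpLie.Hom.map_br f), rfl⟩

/-- Morphisms of Lie algebras with operators bijective in each degree are isomorphisms. -/
def OpLie.isoMk {Ω : Type} {δ : Ω → Γ} {L M : OpLie c δ} (e : ∀ i, L.V i ≃ₗ[R] M.V i)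
    (br : ∀ (i j k : Γ) (h : i + j = k) (x : L.V i) (y : L.V j),
      e k (L.br i j k h x y) = M.br i j k h (e i x) (e j y))
    (op : ∀ (ω : Ω) (i k : Γ) (h : δ ω + i = k) (x : L.V i),
      e k (L.op ω i k h x) = M.op ω i k h (e i x)) : L ≅ M where
  hom := OpLie.Hom.mk (fun i => (e i).toLinearMap) br op
  inv := OpLie.Hom.mk (fun i => (e i).symm.toLinearMap)
    (fun i j k h x y => (e k).injective (by simp [br]))
    (fun ω i k h x => (e k).injective (by simp [op]))
  hom_inv_id := OpLie.hom_ext fun i x => (e i).symm_apply_apply x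
  inv_hom_id := OpLie.hom_ext fun i x => (e i).apply_symm_apply x

instance : (colourToOpLie c).EssSurj where
  mem_essImage M :=
    ⟨{  V := fun i => ModuleCat.of R (M.V i)
        bracket := M.br
        skew := M.skew
        jacobi := M.cyclic },
      ⟨OpLie.isoMk (fun _ => LinearEquiv.refl R _) (fun _ _ _ _ _ _ => rfl) fun ω => ω.elim⟩⟩

instance : (colourToOpLie c).IsEquivalence where

variable (c) in
theorem isLACC_lieColourAlg [Small.{u} Γ] : IsLACC (LieColourAlg c) :=
  IsLACC.of_isEquivalence (colourToOpLie c) (isLACC_opLie fun ω => ω.elim)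

end Colour

/-! ### Differential graded Lie algebras as Lie algebras with one operator of degree -1. -/

section DG

variable (R : Type u) [CommRing R]

theorem koszul_e_smul {M : Type*} [AddCommGroup M] [Module R M] (i j : ℤ) (x : M) :
    (koszul R).e i j • x = (i * j).negOnePow • x := koszul_smul i j x

variable {R}

/-- As ε(-1, i) = (-1)^i, the graded Leibniz rule says that d is a derivation of degree -1 in the
sense of `OpLie`. -/
theorem DGLieAlg.d_bracket (L : DGLieAlg R) (i j k i' j' m : ℤ) (h : i + j = k) (hk : -1 + k = m)
    (hi : -1 + i = i') (hj : -1 + j = j') (h₁ : i' + j = m) (h₂ : i + j' = m) (x : L.V.X i)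
    (y : L.V.X j) : L.V.d k m (L.bracket i j k h x y) =
      L.bracket i' j m h₁ (L.V.d i i' x) y +
        (koszul R).e (-1) i • L.bracket i j' m h₂ x (L.V.d j j' y) := by
  obtain rfl : m = k - 1 := by lia
  obtain rfl : i' = i - 1 := by lia
  obtain rfl : j' = j - 1 := by lia
  rw [koszul_e_smul, neg_one_mul, Int.negOnePow_neg]
  exact L.leibniz i j k h h₁ h₂ x y

/-- The graded Lie algebra underlying a differential graded Lie algebra. -/
def DGLieAlg.gLie (L : DGLieAlg R) : GLie.{u} (koszul R) :=
  GLie.ofCyclic (c := koszul R) (V := fun i => L.V.X i) L.bracket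
    (fun i j k h h' x y => by rw [koszul_e_smul, L.skew i j k h h'])
    (fun i j l ij jl li n hij hjl hli h₁ h₂ h₃ x y z => by
      rw [koszul_e_smul, koszul_e_smul, koszul_e_smul, mul_comm l i, mul_comm i j, mul_comm j l]
      exact L.jacobi i j l ij jl li n hij hjl hli h₁ h₂ h₃ x y z)

variable (R) in
/-- Differential graded Lie algebras, as Lie algebras with one operator. -/
def dgToOpLie : DGLieAlg R ⥤ OpLie.{u} (koszul R) (fun _ : Unit => (-1 : ℤ)) where
  obj L :=
    { L.gLie with
      op := fun _ i k _ => (L.V.d i k).hom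
      op_br := fun _ => L.d_bracket
      op_op := fun _ i j k _ _ x => Ch.d_d (V := L.V) i j k x }
  map f := OpLie.Hom.mk (fun i => (f.f.f i).hom) f.map_bracket fun _ i k _ x =>
    (Ch.map_d f.f i k x).symm

instance : (dgToOpLie R).Faithful where
  map_injective h := DGLieAlg.Hom.ext <| HomologicalComplex.hom_ext _ _ fun i =>
    ModuleCat.hom_ext (congrFun (congrArg OpLie.Hom.f h) i)

instance : (dgToOpLie R).Full where
  map_surjective {L M} f :=
    ⟨DGLieAlg.Hom.mk (Ch.mkHom (fun i => ModuleCat.ofHom (OpLie.Hom.f f i)) fun k x =>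
      (OpLie.Hom.map_op f () k (k - 1) (by lia) x).symm) (OpLie.Hom.map_br f), rfl⟩

/-- The chain complex underlying a Lie algebra with one operator. -/
def OpLie.complex (M : OpLie.{u} (koszul R) (fun _ : Unit => (-1 : ℤ))) : Ch R where
  X i := ModuleCat.of R (M.V i)
  d i j := if h : -1 + i = j then ModuleCat.ofHom (M.op () i j h) else 0
  shape i j h := dif_neg fun h' => h (by change j + 1 = i; lia)
  d_comp_d' i j k hij hjk := by
    have h₁ : -1 + i = j := by change j + 1 = i at hij; lia
    have h₂ : -1 + j = k := by change k + 1 = j at hjk; lia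
    rw [dif_pos h₁, dif_pos h₂]
    exact ModuleCat.hom_ext (LinearMap.ext (M.op_op () i j k h₁ h₂))

theorem OpLie.complex_d (M : OpLie.{u} (koszul R) (fun _ : Unit => (-1 : ℤ))) (i j : ℤ)
    (h : -1 + i = j) (x : M.V i) : M.complex.d i j x = M.op () i j h x := by
  change (if h : -1 + i = j then ModuleCat.ofHom (M.op () i j h) else 0).hom x = _
  rw [dif_pos h]
  rfl

instance : (dgToOpLie R).EssSurj where
  mem_essImage M :=
    ⟨{  V := M.complex
        bracket := M.br
        skew := fun i j k h h' x y => (M.skew i j k h h' x y).trans (by rw [koszul_e_smul]; rfl)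
        jacobi := fun i j l ij jl li n hij hjl hli h₁ h₂ h₃ x y z => by
          have := M.cyclic i j l ij jl li n hij hjl hli h₁ h₂ h₃ x y z
          rw [koszul_e_smul, koszul_e_smul, koszul_e_smul, mul_comm l i, mul_comm i j,
            mul_comm j l] at this
          exact this
        leibniz := fun i j k h h₁ h₂ x y => by
          have := M.op_br () i j k (i - 1) (j - 1) (k - 1) h (by lia) (by lia) (by lia) h₁ h₂ x y
          rw [koszul_e_smul, neg_one_mul, Int.negOnePow_neg] at this
          exact (M.complex_d k (k - 1) (by lia) _).trans <| this.trans <| congrArg₂ (· + ·)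
            (congrArg (fun t => M.br (i - 1) j (k - 1) h₁ t y) (M.complex_d i (i - 1) _ x).symm)
            (congrArg (fun t => i.negOnePow • M.br i (j - 1) (k - 1) h₂ x t)
              (M.complex_d j (j - 1) _ y).symm) },
      ⟨OpLie.isoMk (fun _ => LinearEquiv.refl R _) (fun _ _ _ _ _ _ => rfl)
        fun _ i k h x => M.complex_d i k h x⟩⟩

instance : (dgToOpLie R).IsEquivalence where

variable (R) in
theorem isLACC_dgLieAlg : IsLACC (DGLieAlg R) :=
  IsLACC.of_isEquivalence (dgToOpLie R) <| isLACC_opLie fun _ => by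
    -- The condition on square-zero operators is ε(-1, -1) = -1, which holds because the
    -- differential has odd degree.
    have := koszul_e_smul R (-1) (-1) (1 : R)
    rw [smul_eq_mul, mul_one] at this
    rw [this]
    simp [Units.smul_def]

end DG

end InternalLie

theorem mainTheorem7 (R : Type u) [CommRing R] :
    -- the differential of the tensor product of chain complexes
    (∀ (V W : InternalLie.Ch R) (i j k : ℤ) (h : i + j = k) (h₁ : (i - 1) + j = k - 1)
        (h₂ : i + (j - 1) = k - 1) (x : V.X i) (y : W.X j),
      (V ⊗ W : InternalLie.Ch R).d k (k - 1) (InternalLie.Ch.tmul V W i j k h x y) =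
        InternalLie.Ch.tmul V W (i - 1) j (k - 1) h₁ (V.d i (i - 1) x) y +
          i.negOnePow • InternalLie.Ch.tmul V W i (j - 1) (k - 1) h₂ x (W.d j (j - 1) y)) ∧
    -- chain complexes form a symmetric monoidal closed, cocomplete, abelian category
    (∃ _ : SymmetricCategory (InternalLie.Ch R),
      (∀ (V W : InternalLie.Ch R) (i j k : ℤ) (h : i + j = k) (h' : j + i = k)
          (x : V.X i) (y : W.X j),
        (β_ V W).hom.f k (InternalLie.Ch.tmul V W i j k h x y) =
          (i * j).negOnePow • InternalLie.Ch.tmul W V j i k h' y x) ∧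
      Nonempty (MonoidalClosed (InternalLie.Ch R)) ∧
      HasColimitsOfSize.{u, u} (InternalLie.Ch R) ∧
      Nonempty (Abelian (InternalLie.Ch R)) ∧
      -- the internal Lie algebras are the differential graded Lie algebras
      (∃ (e : InternalLie.LieObj (InternalLie.Ch R) ≌ InternalLie.DGLieAlg R)
          (φ : e.functor ⋙ InternalLie.DGLieAlg.forget R ≅
            InternalLie.LieObj.forget (InternalLie.Ch R)),
        ∀ (L : InternalLie.LieObj (InternalLie.Ch R)) (i j k : ℤ) (h : i + j = k)
          (x : (e.functor.obj L).V.X i) (y : (e.functor.obj L).V.X j),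
          (φ.hom.app L).f k ((e.functor.obj L).bracket i j k h x y) =
            L.b.f k (InternalLie.Ch.tmul L.X L.X i j k h
              ((φ.hom.app L).f i x) ((φ.hom.app L).f j y))) ∧
      -- the complexes with zero differential inherit all this structure, and their internal Lie
      -- algebras are the `ℤ`-graded Lie colour algebras with the Koszul signs
      (∃ _ : (InternalLie.zeroDiff R).IsMonoidal,
        Nonempty (MonoidalClosed (InternalLie.zeroDiff R).FullSubcategory) ∧
        HasColimitsOfSize.{u, u} (InternalLie.zeroDiff R).FullSubcategory ∧
        Nonempty (Abelian (InternalLie.zeroDiff R).FullSubcategory) ∧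
        ∃ (e : InternalLie.LieObj (InternalLie.zeroDiff R).FullSubcategory ≌
              InternalLie.LieColourAlg (InternalLie.koszul R))
          (φ : e.functor ⋙ InternalLie.LieColourAlg.forget (InternalLie.koszul R) ≅
            InternalLie.LieObj.forget (InternalLie.zeroDiff R).FullSubcategory ⋙
              (InternalLie.zeroDiff R).ι ⋙ HomologicalComplex.forget _ _),
          ∀ (L : InternalLie.LieObj (InternalLie.zeroDiff R).FullSubcategory)
            (i j k : ℤ) (h : i + j = k)
            (x : (e.functor.obj L).V i) (y : (e.functor.obj L).V j),
            φ.hom.app L k ((e.functor.obj L).bracket i j k h x y) =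
              ((InternalLie.zeroDiff R).ι.map L.b).f k
                (InternalLie.Ch.tmul L.X.obj L.X.obj i j k h
                  (φ.hom.app L i x) (φ.hom.app L j y)))) ∧
    -- differential graded Lie algebras
    InternalLie.IsLACC (InternalLie.DGLieAlg R) ∧
    -- graded modules and Lie colour algebras
    (∀ (Γ : Type w) [AddCommGroup Γ] [Small.{u} Γ] [DecidableEq Γ]
        (c : InternalLie.CommutationFactor Γ R),
      (∃ _ : BraidedCategory (InternalLie.Gr Γ R),
        (∀ V W : InternalLie.Gr Γ R, (β_ V W).hom ≫ (β_ W V).hom = 𝟙 (V ⊗ W)) ∧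
        (∀ (V W : InternalLie.Gr Γ R) (i j k : Γ) (h : i + j = k) (h' : j + i = k)
            (x : V i) (y : W j),
          (β_ V W).hom k (InternalLie.Gr.tmul V W i j k h x y) =
            (c.ε i j : R) • InternalLie.Gr.tmul W V j i k h' y x) ∧
        Nonempty (MonoidalClosed (InternalLie.Gr Γ R)) ∧
        HasColimitsOfSize.{u, u} (InternalLie.Gr Γ R) ∧
        Nonempty (Abelian (InternalLie.Gr Γ R)) ∧
        (∃ (e : InternalLie.LieObj (InternalLie.Gr Γ R) ≌ InternalLie.LieColourAlg c)
            (φ : e.functor ⋙ InternalLie.LieColourAlg.forget c ≅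
              InternalLie.LieObj.forget (InternalLie.Gr Γ R)),
          ∀ (L : InternalLie.LieObj (InternalLie.Gr Γ R)) (i j k : Γ) (h : i + j = k)
            (x : (e.functor.obj L).V i) (y : (e.functor.obj L).V j),
            φ.hom.app L k ((e.functor.obj L).bracket i j k h x y) =
              L.b k (InternalLie.Gr.tmul L.X L.X i j k h
                (φ.hom.app L i x) (φ.hom.app L j y)))) ∧
      InternalLie.IsLACC (InternalLie.LieColourAlg c)) ∧
    -- Lie colour algebras in the sense of complexes with zero differential, Lie superalgebras
    InternalLie.IsLACC (InternalLie.LieColourAlg (InternalLie.koszul R)) ∧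
    InternalLie.IsLACC (InternalLie.LieSuperAlg R) := by
  exact ⟨InternalLie.Ch.d_tmul, InternalLie.chain_main R, InternalLie.isLACC_dgLieAlg R,
    fun Γ _ _ _ c => ⟨InternalLie.graded_main Γ R c, InternalLie.isLACC_lieColourAlg c⟩,
    InternalLie.isLACC_lieColourAlg _, InternalLie.isLACC_lieColourAlg _⟩
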